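/- **Setting.** Let $\Sigma$ be a K3 surface with a hyper-Kähler structure $(g,I,J,K)$, $IJ=K$, with Kähler forms $\omega^I=g(I\cdot,\cdot)$, $\omega^J$, $\omega^K$ (that is, $\Sigma$ is a compact connected hyper-Kähler 4-manifold with $b_1(\Sigma)=0$). Let $T^2$ be a flat 2-torus with parallel orthonormal frame $(\partial_{u_-},\partial_{v_-})$, and let $X=T^2\times\Sigma$. Let $\vartheta\in(0,\pi)$ (the gluing angle) and let $(\partial_{u_+},\partial_{v_+})$ be the parallel orthonormal frame of $T^2$ with $$\partial_{v_-}=\cos\vartheta\,\partial_{v_+}+\sin\vartheta\,\partial_{u_+},\qquad \partial_{u_-}=\sin\vartheta\,\partial_{v_+}-\cos\vartheta\,\partial_{u_+}.$$ On the Riemannian cylinder $\mathbb R_t\times X$ consider the torsion-free $G_2$-structure $$\varphi=dv_-\wedge\omega^I+du_-\wedge\omega^J+dt\wedge\omega^K+dt\wedge du_-\wedge dv_-,$$ with cross product $\langle Y\times Z,W\rangle=\varphi(Y,Z,W)$. Let $S$ be the associated real spinor bundle of rank 8, $s$ the parallel unit spinor defining $\varphi$, and $c$ Clifford multiplication, with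 $c_Y^2=-|Y|^2$ and the orientation convention $c_Yc_Zs=c_{Y\times Z}s$ for $Y\perp Z$; thus $S\cong\mathbb R s\oplus\{c_Ys : Y\in T(\mathbb R\times X)\}$. Put $\gamma=c_{\partial_t}$, write the Dirac operator of the cylinder as $\gamma(\partial_t+A)$, and let $\ker A$ be the space of smooth real harmonic spinors on $X$, with the $L^2$-metric, the complex structure $\gamma$ and the symplectic form $\langle\gamma\,\cdot,\cdot\rangle_{L^2}$. Put $$L_{D_\pm}=\operatorname{span}_{\mathbb R}\{s,\,c_{v_\pm}s\}\subset\ker A,\qquad c_{v_\pm}=c_{\partial_{v_\pm}}.$$ **Maslov angle.** Let $W$ be a finite-dimensional Euclidean vector space with an orthogonal complex structure $\gamma$, let $E_{\pm i}\subset W\otimes\mathbb C$ be the $\pm i$-eigenspaces of $\gamma$, and let $L_+,L_-\subset W$ be Lagrangian. The complexification of $L_\pm$ is the graph of a unitary map $\Phi(L_\pm)\colon E_i\to E_{-i}$, and $$m_W(L_+,L_-)=\dim(L_+\cap L_-)-\frac1{\pi i}\operatorname{tr}\log\bigl(-\Phi(L_+)\Phi(L_-)^*\bigr),$$ where the logarithm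 has imaginary part in $(-\pi,\pi]$, so $\log(-1)=\pi i$. **Theorem 5.8.** The space $\ker A$ is 4-dimensional, $L_{D_+}$ and $L_{D_-}$ are Lagrangian subspaces of it, and with $\rho=\pi-2\vartheta$, $$m_{\ker A}(L_{D_+},L_{D_-})=\frac{\rho}{\pi}.$$ -/

import Mathlib

open Bundle MeasureTheory
open scoped Manifold ContDiff TensorProduct Matrix

set_option linter.unusedSectionVars false
set_option linter.unusedVariables false
set_option linter.style.longLine false

noncomputable section

/-- The universal cover of the flat torus `T²`. Coordinate `0` is `u = u₋`, coordinate `1` is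
`v = v₋`; the standard basis is the parallel orthonormal frame `(∂_u, ∂_v)`. -/
abbrev Plane : Type := EuclideanSpace ℝ (Fin 2)
/-- The model space of the K3 surface, as a real four-manifold. -/
abbrev R4 : Type := EuclideanSpace ℝ (Fin 4)

section Geometry

variable (M : Type*) [TopologicalSpace M] [ChartedSpace R4 M] [IsManifold (𝓡 4) ∞ M]
  [RiemannianBundle (fun x : M => TangentSpace (𝓡 4) x)]

variable {M}

/-- Smooth vector fields on `M`. -/
def IsSmoothField (Y : (x : M) → TangentSpace (𝓡 4) x) : Prop :=
  ContMDiff (𝓡 4) (𝓡 4).tangent ∞ (fun x => (⟨x, Y x⟩ : TangentBundle (𝓡 4) M))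

/-- Vector fields that are differentiable at `x`. -/
def IsDiffFieldAt (Y : (x : M) → TangentSpace (𝓡 4) x) (x : M) : Prop :=
  MDifferentiableAt (𝓡 4) (𝓡 4).tangent (fun x => (⟨x, Y x⟩ : TangentBundle (𝓡 4) M)) x

/-- Smooth fields of endomorphisms of the tangent bundle. -/
def IsSmoothEnd (A : (x : M) → TangentSpace (𝓡 4) x →L[ℝ] TangentSpace (𝓡 4) x) : Prop :=
  ContMDiff (𝓡 4) ((𝓡 4).prod 𝓘(ℝ, R4 →L[ℝ] R4)) ∞ (fun x : M =>
      (⟨x, A x⟩ : TotalSpace (R4 →L[ℝ] R4)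
        (fun x : M => TangentSpace (𝓡 4) x →L[ℝ] TangentSpace (𝓡 4) x)))

variable (M)

/-- A hyper-Kähler structure on the Riemannian four-manifold `M`: the Levi-Civita connection `nabla`
of the metric (`nabla Y x e` is `∇_e Y` at `x`; it is pinned down by `torsion_free` and `metric`),
and orthogonal, parallel almost complex structures `I`, `J`, `K` with `IJ = K = -JI`. The Kähler
forms `ω^I(y, z) = ⟨I y, z⟩`, `ω^J`, `ω^K` are then closed and form a hyper-Kähler triple. -/
structure HyperKahlerStructure where
  nabla : CovariantDerivative (𝓡 4) R4 (fun x : M => TangentSpace (𝓡 4) x)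
  nabla_smooth : ∀ Y : (x : M) → TangentSpace (𝓡 4) x,
    IsSmoothField Y → IsSmoothEnd (nabla Y)
  torsion_free : ∀ (X Y : (x : M) → TangentSpace (𝓡 4) x) (x : M),
    IsDiffFieldAt X x → IsDiffFieldAt Y x →
    nabla Y x (X x) - nabla X x (Y x) = VectorField.mlieBracket (𝓡 4) X Y x
  metric : ∀ (X Y : (x : M) → TangentSpace (𝓡 4) x) (x : M),
    IsDiffFieldAt X x → IsDiffFieldAt Y x →
    ∀ e : TangentSpace (𝓡 4) x, mvfderiv (𝓡 4) (fun y => inner ℝ (X y) (Y y)) x e =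
      inner ℝ (nabla X x e) (Y x) + inner ℝ (X x) (nabla Y x e)
  I : (x : M) → TangentSpace (𝓡 4) x →L[ℝ] TangentSpace (𝓡 4) x
  J : (x : M) → TangentSpace (𝓡 4) x →L[ℝ] TangentSpace (𝓡 4) x
  K : (x : M) → TangentSpace (𝓡 4) x →L[ℝ] TangentSpace (𝓡 4) x
  I_smooth : IsSmoothEnd I
  J_smooth : IsSmoothEnd J
  K_smooth : IsSmoothEnd K
  I_sq : ∀ x y, I x (I x y) = -y
  J_sq : ∀ x y, J x (J x y) = -y
  I_J : ∀ x y, I x (J x y) = K x y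
  J_I : ∀ x y, J x (I x y) = -K x y
  I_isometry : ∀ x y z, inner ℝ (I x y) (I x z) = (inner ℝ y z : ℝ)
  J_isometry : ∀ x y z, inner ℝ (J x y) (J x z) = (inner ℝ y z : ℝ)
  I_parallel : ∀ (Y : (x : M) → TangentSpace (𝓡 4) x) (x : M), IsDiffFieldAt Y x →
    ∀ e, nabla (fun y => I y (Y y)) x e = I x (nabla Y x e)
  J_parallel : ∀ (Y : (x : M) → TangentSpace (𝓡 4) x) (x : M), IsDiffFieldAt Y x →
    ∀ e, nabla (fun y => J y (Y y)) x e = J x (nabla Y x e)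

/-- A hyper-Kähler K3 surface. Compact connected hyper-Kähler four-manifolds are K3 surfaces or flat
tori, and the K3 surfaces are those with vanishing first Betti number: every closed one-form is
exact. The one-form `⟨Y, ·⟩` is closed if and only if `∇Y` is symmetric. (Compactness and
connectedness are required where this structure is used.) -/
structure HyperKahlerK3 extends HyperKahlerStructure M where
  closed_exact : ∀ Y : (x : M) → TangentSpace (𝓡 4) x, IsSmoothField Y →
    (∀ x (a b : TangentSpace (𝓡 4) x),
      inner ℝ (nabla Y x a) b = (inner ℝ (nabla Y x b) a : ℝ)) →
    ∃ f : M → ℝ, ContMDiff (𝓡 4) 𝓘(ℝ, ℝ) ∞ f ∧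
      ∀ x (a : TangentSpace (𝓡 4) x), mvfderiv (𝓡 4) f x a = inner ℝ (Y x) a

variable {M}

/-- The fibre, at a point of `{t} × T² × M` over `x : M`, of the spinor bundle of the cylinder
`Z = ℝ × T² × M`, namely `ℝ ⊕ TZ = ℝ ⊕ ℝ³ ⊕ T_x M`. The first summand is spanned by the unit spinor
`s` that defines the `G₂`-structure, and a tangent vector `X` of `Z` is identified with the spinor
`c_X s`. The three coordinates of `ℝ³` belong to `∂_t`, `∂_u`, `∂_v`, in this order. -/
abbrev SpinorFiber (x : M) : Type := ℝ × (Fin 3 → ℝ) × TangentSpace (𝓡 4) x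

/-- Sections over `ℝ² × M` of the (pulled back) spinor bundle; sections over `X = T² × M` are those
that are periodic with respect to the lattice of the torus. -/
abbrev Spinor (M : Type*) [TopologicalSpace M] [ChartedSpace R4 M] : Type _ :=
  Plane → (x : M) → SpinorFiber x

instance tangentFinite (x : M) : FiniteDimensional ℝ (TangentSpace (𝓡 4) x) :=
  inferInstanceAs (FiniteDimensional ℝ R4)

variable (h : HyperKahlerStructure M)

/-- The cross product `a × y` of a vector `a` in the span of `∂_t, ∂_u, ∂_v` with `y` tangent to `M`,
determined by `φ(∂_t, ·, ·) = ω^K`, `φ(∂_u, ·, ·) = ω^J`, `φ(∂_v, ·, ·) = ω^I` on `TM`. -/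
def HyperKahlerStructure.act (x : M) (a : Fin 3 → ℝ) (y : TangentSpace (𝓡 4) x) :
    TangentSpace (𝓡 4) x :=
  a 0 • h.K x y + a 1 • h.J x y + a 2 • h.I x y

/-- The component in the span of `∂_t, ∂_u, ∂_v` of the cross product of two vectors tangent to `M`. -/
def HyperKahlerStructure.pairing (x : M) (y z : TangentSpace (𝓡 4) x) : Fin 3 → ℝ :=
  ![inner ℝ (h.K x y) z, inner ℝ (h.J x y) z, inner ℝ (h.I x y) z]

/-- The cross product of the `G₂`-structure
`φ = dv ∧ ω^I + du ∧ ω^J + dt ∧ ω^K + dt ∧ du ∧ dv` on `Z`, that is `φ(X, Y, Z) = ⟨X × Y, Z⟩`. -/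
def HyperKahlerStructure.cross (x : M) (X Y : (Fin 3 → ℝ) × TangentSpace (𝓡 4) x) :
    (Fin 3 → ℝ) × TangentSpace (𝓡 4) x :=
  (X.1 ⨯₃ Y.1 + h.pairing x X.2 Y.2, h.act x X.1 Y.2 - h.act x Y.1 X.2)


/-- Clifford multiplication by the tangent vector `X` of `Z` on spinors,
`c_X (f, Y) = (-⟨X, Y⟩, f X + X × Y)`; so `c_X c_X = -|X|²`, and `c_X c_Y s = c_(X × Y) s` for
orthogonal `X`, `Y`. -/
def HyperKahlerStructure.clifford (x : M) (X : (Fin 3 → ℝ) × TangentSpace (𝓡 4) x) :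
    SpinorFiber x →ₗ[ℝ] SpinorFiber x where
  toFun σ := (-(X.1 ⬝ᵥ σ.2.1 + inner ℝ X.2 σ.2.2), σ.1 • X + h.cross x X σ.2)
  map_add' σ τ := by
    ext i
    · simp [inner_add_right, dotProduct_add]; ring
    · fin_cases i <;> 
      simp [HyperKahlerStructure.cross, HyperKahlerStructure.pairing, crossProduct, Matrix.vecHead, Matrix.vecTail, inner_add_right] <;> ring
    · simp [HyperKahlerStructure.cross, HyperKahlerStructure.act]; module
  map_smul' c σ := by
    ext i
    · simp [inner_smul_right]; ring
    · fin_cases i <;> 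
      simp [HyperKahlerStructure.cross, HyperKahlerStructure.pairing, crossProduct, Matrix.vecHead, Matrix.vecTail, inner_smul_right] <;> ring
    · simp [HyperKahlerStructure.cross, HyperKahlerStructure.act]; module

/-- The parallel vector fields `∂_t` (`i = 0`), `∂_u` (`i = 1`), `∂_v` (`i = 2`). -/
abbrev frame (x : M) (i : Fin 3) : (Fin 3 → ℝ) × TangentSpace (𝓡 4) x := (Pi.single i 1, 0)

theorem HyperKahlerStructure.clifford_normal (x : M) (σ : SpinorFiber x) :
    h.clifford x (frame x 0) σ = (-σ.2.1 0, ![σ.1, -σ.2.1 2, σ.2.1 1], h.K x σ.2.2) := by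
  ext i
  · simp [clifford]
  · fin_cases i <;> simp [clifford, cross, pairing, crossProduct, Matrix.vecHead, Matrix.vecTail]
  · simp [clifford, cross, act]

theorem HyperKahlerStructure.K_skew (x : M) (y z : TangentSpace (𝓡 4) x) :
    inner ℝ (h.K x y) z = -(inner ℝ y (h.K x z) : ℝ) := by
  have h1 : ∀ y, h.K x (h.K x y) = -y := fun y => by
    rw [← h.I_J, ← neg_eq_iff_eq_neg.2 (h.J_I x y)]; simp [h.I_sq,h.J_sq]
  have h2 : ∀ y z, inner ℝ (h.K x y) (h.K x z) = (inner ℝ y z : ℝ) := fun y z => by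
    rw [← h.I_J, ← h.I_J, h.I_isometry, h.J_isometry]
  rw [← h2 y, h1]; simp

theorem HyperKahlerStructure.clifford_anticomm (x : M) (X : (Fin 3 → ℝ) × TangentSpace (𝓡 4) x)
    (hX : X.1 0 = 0) (σ : SpinorFiber x) :
    h.clifford x X (h.clifford x (frame x 0) σ) =
      -h.clifford x (frame x 0) (h.clifford x X σ) := by
  obtain ⟨a, w⟩ := X
  obtain ⟨f, b, y⟩ := σ
  simp only at hX
  have IK : ∀ y, h.I x (h.K x y) = -h.J x y := fun y => by rw [← h.I_J, h.I_sq]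
  have KI : ∀ y, h.K x (h.I x y) = h.J x y := fun y => by rw [← h.I_J, h.J_I]; simp [IK]
  have JK : ∀ y, h.J x (h.K x y) = h.I x y := fun y => by
    rw [← neg_eq_iff_eq_neg.2 (h.J_I x y)]; simp [h.J_sq]
  have KJ : ∀ y, h.K x (h.J x y) = -h.I x y := fun y => by rw [← h.I_J, h.J_sq]; simp
  have KK : ∀ y, h.K x (h.K x y) = -y := fun y => by
    rw [← h.I_J, ← neg_eq_iff_eq_neg.2 (h.J_I x y)]; simp [h.I_sq,h.J_sq]
  have sI : ∀ y z, inner ℝ (h.I x y) z = -(inner ℝ y (h.I x z) : ℝ) := fun y z => by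
    rw [← h.I_isometry x y, h.I_sq]; simp
  have sJ : ∀ y z, inner ℝ (h.J x y) z = -(inner ℝ y (h.J x z) : ℝ) := fun y z => by
    rw [← h.J_isometry x y, h.J_sq]; simp
  rw [h.clifford_normal, h.clifford_normal]
  ext i
  · simp [clifford, cross, pairing, crossProduct, Matrix.vecHead, Matrix.vecTail, hX, dotProduct, Fin.sum_univ_three, h.K_skew]
    ring
  · fin_cases i <;>
    simp [clifford, cross, pairing, crossProduct, Matrix.vecHead, Matrix.vecTail, hX, dotProduct, Fin.sum_univ_three, h.K_skew, sI, sJ, IK, JK, KK] <;> ring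
  · simp [clifford, cross, act, hX, IK, JK, KI, KJ, KK]
    module


/-- Smooth spinors. -/
structure IsSmoothSpinor (ψ : Spinor M) : Prop where
  flat : ContMDiff (𝓘(ℝ, Plane).prod (𝓡 4)) 𝓘(ℝ, ℝ × (Fin 3 → ℝ)) ∞
    (fun z : Plane × M => ((ψ z.1 z.2).1, (ψ z.1 z.2).2.1))
  tangent : ContMDiff (𝓘(ℝ, Plane).prod (𝓡 4)) (𝓡 4).tangent ∞
    (fun z : Plane × M => (⟨z.2, (ψ z.1 z.2).2.2⟩ : TangentBundle (𝓡 4) M))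

/-- Covariant derivative of a spinor along `∂_u` (`i = 0`) and `∂_v` (`i = 1`). The product metric on
`Z` has the product Levi-Civita connection, and the spin connection is the induced one on `ℝ ⊕ TZ`
because `s` is parallel. -/
def torusDeriv (ψ : Spinor M) (p : Plane) (x : M) (i : Fin 2) : SpinorFiber x :=
  fderiv ℝ (fun q => ψ q x) p (EuclideanSpace.single i 1)

/-- Covariant derivative of a spinor along a tangent vector `e` of `M`. -/
def HyperKahlerStructure.spinorDeriv (ψ : Spinor M) (p : Plane) (x : M)
    (e : TangentSpace (𝓡 4) x) : SpinorFiber x :=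
  (mvfderiv (𝓡 4) (fun y => (ψ p y).1) x e, mvfderiv (𝓡 4) (fun y => (ψ p y).2.1) x e,
    h.nabla (fun y => (ψ p y).2.2) x e)

/-- The Dirac operator `A` on `X`, where `γ (∂/∂t + A) = ∑ c_{e} ∇_{e}` with `γ = c_t` is the Dirac
operator of the cylinder: `A = -γ (c_u ∇_u + c_v ∇_v + ∑ᵢ c_{eᵢ} ∇_{eᵢ})` for an orthonormal basis
`eᵢ` of `T_x M`. -/
def HyperKahlerStructure.diracX (ψ : Spinor M) : Spinor M := fun p x =>
  -h.clifford x (frame x 0)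
    (h.clifford x (frame x 1) (torusDeriv ψ p x 0) + h.clifford x (frame x 2) (torusDeriv ψ p x 1)
      + ∑ i, h.clifford x (0, stdOrthonormalBasis ℝ (TangentSpace (𝓡 4) x) i)
          (h.spinorDeriv ψ p x (stdOrthonormalBasis ℝ (TangentSpace (𝓡 4) x) i)))

/-- Clifford multiplication by `∂_t` on the components in `ℝ ⊕ ℝ³`. -/
def normalFlat : ℝ × (Fin 3 → ℝ) →ₗ[ℝ] ℝ × (Fin 3 → ℝ) where
  toFun a := (-a.2 0, ![a.1, -a.2 2, a.2 1])
  map_add' a b := by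
    ext i
    · simp; ring
    · fin_cases i <;> simp; ring
  map_smul' c a := by
    ext i
    · simp
    · fin_cases i <;> simp

theorem mvfderiv_clm_comp {F G : Type*} [NormedAddCommGroup F] [NormedSpace ℝ F]
    [NormedAddCommGroup G] [NormedSpace ℝ G] (L : F →L[ℝ] G) {f : M → F} {x : M}
    (hf : MDifferentiableAt (𝓡 4) 𝓘(ℝ, F) f x) (e : TangentSpace (𝓡 4) x) :
    mvfderiv (𝓡 4) (fun y => L (f y)) x e = L (mvfderiv (𝓡 4) f x e) := by
  have h := (L.hasMFDerivAt (x := f x)).comp x hf.hasMFDerivAt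
  exact congrArg (fun A => A e) h.mfderiv

namespace IsSmoothSpinor
variable {ψ φ : Spinor M}

theorem field (hψ : IsSmoothSpinor ψ) (p : Plane) (x : M) :
    IsDiffFieldAt (fun y => (ψ p y).2.2) x := by
  have h1 : ContMDiff (𝓡 4) (𝓘(ℝ, Plane).prod (𝓡 4)) ∞ (fun y : M => (p, y)) :=
    contMDiff_const.prodMk contMDiff_id
  exact ((hψ.tangent.comp h1).mdifferentiable (by simp)) x

theorem diff_fst (hψ : IsSmoothSpinor ψ) (p : Plane) (x : M) :
    MDifferentiableAt (𝓡 4) 𝓘(ℝ, ℝ × (Fin 3 → ℝ)) (fun y => ((ψ p y).1, (ψ p y).2.1)) x := by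
  have h1 : ContMDiff (𝓡 4) (𝓘(ℝ, Plane).prod (𝓡 4)) ∞ (fun y : M => (p, y)) :=
    contMDiff_const.prodMk contMDiff_id
  exact ((hψ.flat.comp h1).mdifferentiable (by simp)) x

theorem diff_one (hψ : IsSmoothSpinor ψ) (p : Plane) (x : M) :
    MDifferentiableAt (𝓡 4) 𝓘(ℝ, ℝ) (fun y => (ψ p y).1) x :=
  (ContinuousLinearMap.fst ℝ ℝ (Fin 3 → ℝ)).differentiableAt.mdifferentiableAt.comp x
    (hψ.diff_fst p x)

theorem diff_two (hψ : IsSmoothSpinor ψ) (p : Plane) (x : M) :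
    MDifferentiableAt (𝓡 4) 𝓘(ℝ, Fin 3 → ℝ) (fun y => (ψ p y).2.1) x :=
  (ContinuousLinearMap.snd ℝ ℝ (Fin 3 → ℝ)).differentiableAt.mdifferentiableAt.comp x
    (hψ.diff_fst p x)

theorem diff_torus (hψ : IsSmoothSpinor ψ) (p : Plane) (x : M) :
    DifferentiableAt ℝ (fun q => ψ q x) p := by
  have h1 : ContMDiff 𝓘(ℝ, Plane) (𝓘(ℝ, Plane).prod (𝓡 4)) ∞ (fun q : Plane => (q, x)) :=
    contMDiff_id.prodMk contMDiff_const
  have h2 : DifferentiableAt ℝ (fun q => ((ψ q x).1, (ψ q x).2.1)) p :=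
    ((hψ.flat.comp h1).contDiff.differentiable (by simp)) p
  have h3 : DifferentiableAt ℝ (fun q => (ψ q x).2.2) p := by
    have h4 := (contMDiffAt_totalSpace.1 ((hψ.tangent.comp h1) p)).2
    have h5 := (h4.contDiffAt.differentiableAt (by simp))
    let e := trivializationAt R4 (TangentSpace (𝓡 4) : M → Type _) x
    have hx : x ∈ e.baseSet := FiberBundle.mem_baseSet_trivializationAt' x
    let L := e.continuousLinearEquivAt ℝ x hx
    have h6 : DifferentiableAt ℝ (fun q => L (ψ q x).2.2) p := by
      exact h5
    have h7 := L.symm.differentiableAt.comp p h6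
    exact h7.congr_of_eventuallyEq (Filter.Eventually.of_forall fun q => by simp)
  exact h2.fst.prodMk (h2.snd.prodMk h3)

theorem field_apply (hψ : IsSmoothSpinor ψ) {A : (x : M) → TangentSpace (𝓡 4) x →L[ℝ] TangentSpace (𝓡 4) x} (hA : IsSmoothEnd A)
    (p : Plane) (x : M) : IsDiffFieldAt (fun y => A y (ψ p y).2.2) x := by
  have h1 : ContMDiff (𝓡 4) (𝓘(ℝ, Plane).prod (𝓡 4)) ∞ (fun y : M => (p, y)) :=
    contMDiff_const.prodMk contMDiff_id
  exact ((hA.clm_bundle_apply (hψ.tangent.comp h1)).mdifferentiable (by simp)) x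

theorem zero : IsSmoothSpinor (0 : Spinor M) where
  flat := contMDiff_const (c := ((0, 0) : ℝ × (Fin 3 → ℝ)))
  tangent := (contMDiff_zeroSection ℝ (TangentSpace (𝓡 4) : M → Type _)).comp contMDiff_snd

theorem add (hψ : IsSmoothSpinor ψ) (hφ : IsSmoothSpinor φ) : IsSmoothSpinor (ψ + φ) where
  flat := hψ.flat.add hφ.flat
  tangent z := by
    have h1 := (contMDiffAt_totalSpace.1 (hψ.tangent z))
    have h2 := (contMDiffAt_totalSpace.1 (hφ.tangent z))
    refine contMDiffAt_totalSpace.2 ⟨h1.1, (h1.2.add h2.2).congr_of_eventuallyEq ?_⟩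
    let e := trivializationAt R4 (TangentSpace (𝓡 4) : M → Type _) z.2
    have h3 : ∀ᶠ y : Plane × M in nhds z, y.2 ∈ e.baseSet :=
      continuous_snd.continuousAt.eventually
        (e.open_baseSet.mem_nhds (FiberBundle.mem_baseSet_trivializationAt' z.2))
    filter_upwards [h3] with y hy
    exact (e.linear ℝ hy).map_add _ _

theorem smul (c : ℝ) (hψ : IsSmoothSpinor ψ) : IsSmoothSpinor (c • ψ) where
  flat := (c • ContinuousLinearMap.id ℝ (ℝ × (Fin 3 → ℝ))).contMDiff.comp hψ.flat
  tangent z := by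
    have h1 := (contMDiffAt_totalSpace.1 (hψ.tangent z))
    refine contMDiffAt_totalSpace.2 ⟨h1.1, ((c • ContinuousLinearMap.id ℝ R4).contMDiff.contMDiffAt.comp z h1.2).congr_of_eventuallyEq ?_⟩
    let e := trivializationAt R4 (TangentSpace (𝓡 4) : M → Type _) z.2
    have h3 : ∀ᶠ y : Plane × M in nhds z, y.2 ∈ e.baseSet :=
      continuous_snd.continuousAt.eventually
        (e.open_baseSet.mem_nhds (FiberBundle.mem_baseSet_trivializationAt' z.2))
    filter_upwards [h3] with y hy
    exact (e.linear ℝ hy).map_smul _ _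

theorem normal (hψ : IsSmoothSpinor ψ) :
    IsSmoothSpinor (fun p x => h.clifford x (frame x 0) (ψ p x)) := by
  simp only [h.clifford_normal]
  refine ⟨?_, ?_⟩
  · exact normalFlat.toContinuousLinearMap.contMDiff.comp hψ.flat
  · exact (h.K_smooth.comp contMDiff_snd).clm_bundle_apply hψ.tangent

theorem torusDeriv_add (hψ : IsSmoothSpinor ψ) (hφ : IsSmoothSpinor φ) (p : Plane) (x : M)
    (i : Fin 2) : torusDeriv (ψ + φ) p x i = torusDeriv ψ p x i + torusDeriv φ p x i := by
  have := fderiv_add (hψ.diff_torus p x) (hφ.diff_torus p x)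
  exact congrArg (fun L => L (EuclideanSpace.single i 1)) this

theorem torusDeriv_smul (c : ℝ) (hψ : IsSmoothSpinor ψ) (p : Plane) (x : M)
    (i : Fin 2) : torusDeriv (c • ψ) p x i = c • torusDeriv ψ p x i := by
  have := fderiv_const_smul (hψ.diff_torus p x) c
  exact congrArg (fun L => L (EuclideanSpace.single i 1)) this

theorem torusDeriv_normal (hψ : IsSmoothSpinor ψ) (p : Plane) (x : M) (i : Fin 2) :
    torusDeriv (fun p x => h.clifford x (frame x 0) (ψ p x)) p x i =
      h.clifford x (frame x 0) (torusDeriv ψ p x i) := by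
  have := ((h.clifford x (frame x 0)).toContinuousLinearMap.hasFDerivAt.comp p
    (hψ.diff_torus p x).hasFDerivAt).fderiv
  exact congrArg (fun L => L (EuclideanSpace.single i 1)) this

theorem spinorDeriv_add (hψ : IsSmoothSpinor ψ) (hφ : IsSmoothSpinor φ) (p : Plane) (x : M)
    (e : TangentSpace (𝓡 4) x) :
    h.spinorDeriv (ψ + φ) p x e = h.spinorDeriv ψ p x e + h.spinorDeriv φ p x e := by
  have h1 := congrArg (fun L => L e) (mvfderiv_fun_add (hψ.diff_one p x) (hφ.diff_one p x))
  have h2 := congrArg (fun L => L e) (mvfderiv_fun_add (hψ.diff_two p x) (hφ.diff_two p x))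
  have h3 := congrArg (fun L => L e)
    (h.nabla.isCovariantDerivativeOn.add (hψ.field p x) (hφ.field p x))
  exact Prod.ext h1 (Prod.ext h2 h3)

theorem spinorDeriv_smul (c : ℝ) (hψ : IsSmoothSpinor ψ) (p : Plane) (x : M)
    (e : TangentSpace (𝓡 4) x) :
    h.spinorDeriv (c • ψ) p x e = c • h.spinorDeriv ψ p x e := by
  have h1 : mvfderiv (𝓡 4) (fun y => c • (ψ p y).1) x e = c • mvfderiv (𝓡 4) (fun y => (ψ p y).1) x e := by
    exact mvfderiv_clm_comp (c • ContinuousLinearMap.id ℝ ℝ) (hψ.diff_one p x) e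
  have h2 : mvfderiv (𝓡 4) (fun y => c • (ψ p y).2.1) x e = c • mvfderiv (𝓡 4) (fun y => (ψ p y).2.1) x e := by
    exact mvfderiv_clm_comp (c • ContinuousLinearMap.id ℝ (Fin 3 → ℝ)) (hψ.diff_two p x) e
  have h3 := congrArg (fun L => L e)
    (h.nabla.isCovariantDerivativeOn.smul_const c (hψ.field p x))
  exact Prod.ext h1 (Prod.ext h2 h3)

theorem spinorDeriv_normal (hψ : IsSmoothSpinor ψ) (p : Plane) (x : M)
    (e : TangentSpace (𝓡 4) x) :
    h.spinorDeriv (fun p x => h.clifford x (frame x 0) (ψ p x)) p x e =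
      h.clifford x (frame x 0) (h.spinorDeriv ψ p x e) := by
  have hK : h.nabla (fun y => h.K y (ψ p y).2.2) x e = h.K x (h.nabla (fun y => (ψ p y).2.2) x e) := by
    have h1 := h.I_parallel (fun y => h.J y (ψ p y).2.2) x (hψ.field_apply h.J_smooth p x) e
    rw [h.J_parallel _ x (hψ.field p x) e, h.I_J] at h1
    simpa only [h.I_J] using h1
  simp only [h.clifford_normal]
  refine Prod.ext ?_ (Prod.ext ?_ hK)
  · exact mvfderiv_clm_comp (-ContinuousLinearMap.proj (R := ℝ) (φ := fun _ : Fin 3 => ℝ) 0)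
      (hψ.diff_two p x) e
  · have h1 := mvfderiv_clm_comp (ContinuousLinearMap.fst ℝ ℝ (Fin 3 → ℝ)) (hψ.diff_fst p x) e
    have h2 := mvfderiv_clm_comp (ContinuousLinearMap.snd ℝ ℝ (Fin 3 → ℝ)) (hψ.diff_fst p x) e
    have h3 := mvfderiv_clm_comp (((ContinuousLinearMap.snd ℝ ℝ (Fin 3 → ℝ)).comp
      normalFlat.toContinuousLinearMap)) (hψ.diff_fst p x) e
    refine h3.trans ?_
    have h4 : mvfderiv (𝓡 4) (fun y => ((ψ p y).1, (ψ p y).2.1)) x e =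
        (mvfderiv (𝓡 4) (fun y => (ψ p y).1) x e, mvfderiv (𝓡 4) (fun y => (ψ p y).2.1) x e) :=
      Prod.ext h1.symm h2.symm
    rw [h4]
    rfl

end IsSmoothSpinor


variable (b : Module.Basis (Fin 2) ℝ Plane)

/-- Periodicity with respect to the lattice generated by the basis `b` of the plane. -/
def IsPeriodic (ψ : Spinor M) : Prop := ∀ i p x, ψ (p + b i) x = ψ p x

/-- The space `ker A` of real harmonic spinors on `X = (ℝ² / ℤ b₀ + ℤ b₁) × M`. -/
def HyperKahlerStructure.harmonicSpinors : Submodule ℝ (Spinor M) where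
  carrier := {ψ | IsSmoothSpinor ψ ∧ IsPeriodic b ψ ∧ h.diracX ψ = 0}
  zero_mem' := by
    have h0 : IsSmoothSpinor (0 : Spinor M) := .zero
    refine ⟨h0, fun _ _ _ => rfl, ?_⟩
    have h1 := fun p x i => h0.torusDeriv_smul 0 p x i
    have h2 := fun p x e => h0.spinorDeriv_smul h 0 p x e
    simp only [zero_smul] at h1 h2
    funext p x
    simp [diracX, h1, h2]
  add_mem' := by
    rintro ψ φ ⟨h1, h2, h3⟩ ⟨k1, k2, k3⟩
    refine ⟨h1.add k1, fun i p x => ?_, ?_⟩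
    · simp [h2 i p x, k2 i p x]
    · have : h.diracX (ψ + φ) = h.diracX ψ + h.diracX φ := by
        funext p x
        simp only [diracX, h1.torusDeriv_add k1, h1.spinorDeriv_add h k1, map_add,
          Finset.sum_add_distrib, Pi.add_apply]
        abel
      rw [this, h3, k3, add_zero]
  smul_mem' := by
    rintro c ψ ⟨h1, h2, h3⟩
    refine ⟨h1.smul c, fun i p x => ?_, ?_⟩
    · simp [h2 i p x]
    · have : h.diracX (c • ψ) = c • h.diracX ψ := by
        funext p x
        simp only [diracX, h1.torusDeriv_smul, h1.spinorDeriv_smul h, map_smul,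
          Pi.smul_apply, ← Finset.smul_sum, ← smul_add, smul_neg]
      rw [this, h3, smul_zero]

/-- The complex structure `γ = c_t` on `ker A`. -/
def HyperKahlerStructure.gamma : h.harmonicSpinors b →ₗ[ℝ] h.harmonicSpinors b where
  toFun ψ := ⟨fun p x => h.clifford x (frame x 0) (ψ.1 p x), by
    obtain ⟨ψ, h1, h2, h3⟩ := ψ
    refine ⟨h1.normal h, fun i p x => ?_, ?_⟩
    · simp only [h2 i p x]
    · have : h.diracX (fun p x => h.clifford x (frame x 0) (ψ p x)) =
          fun p x => -h.clifford x (frame x 0) (h.diracX ψ p x) := by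
        funext p x
        simp only [diracX, h1.torusDeriv_normal h, h1.spinorDeriv_normal h]
        rw [h.clifford_anticomm x (frame x 1) (by simp), h.clifford_anticomm x (frame x 2) (by simp)]
        simp only [h.clifford_anticomm x (0, _) rfl, map_neg, map_add, map_sum,
          Finset.sum_neg_distrib]
        abel
      rw [this, h3]
      funext p x
      simp⟩
  map_add' ψ φ := by
    ext1
    funext p x
    exact map_add _ _ _
  map_smul' c ψ := by
    ext1
    funext p x
    exact (h.clifford x (frame x 0)).map_smul c _

/-- The spinor with constant component in `ℝ ⊕ ℝ³` and vanishing component in `TM`. -/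
def constSpinor (f : ℝ) (a : Fin 3 → ℝ) : Spinor M := fun _ _ => (f, a, 0)

theorem constSpinor_mem (f : ℝ) (a : Fin 3 → ℝ) : constSpinor f a ∈ h.harmonicSpinors b := by
  refine ⟨⟨contMDiff_const (c := ((f, a) : ℝ × (Fin 3 → ℝ))), IsSmoothSpinor.zero.tangent⟩,
    fun _ _ _ => rfl, ?_⟩
  funext p x
  have h1 : ∀ i, torusDeriv (constSpinor f a : Spinor M) p x i = 0 := fun i => by
    simp [torusDeriv, constSpinor]
  have h2 : ∀ e, h.spinorDeriv (constSpinor f a : Spinor M) p x e = 0 := fun e => by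
    have h3 : h.nabla (0 : (x : M) → TangentSpace (𝓡 4) x) x = 0 :=
      h.nabla.isCovariantDerivativeOn.zero
    refine Prod.ext ?_ (Prod.ext ?_ (congrArg (fun A => A e) h3)) <;>
    simp [HyperKahlerStructure.spinorDeriv, constSpinor, mvfderiv_const]
  simp [HyperKahlerStructure.diracX, h1, h2]


/-- The metric of the spinor bundle. -/
def spinorInner {x : M} (σ τ : SpinorFiber x) : ℝ :=
  σ.1 * τ.1 + σ.2.1 ⬝ᵥ τ.2.1 + inner ℝ σ.2.2 τ.2.2

/-- The parallel unit spinor `s`, as a harmonic spinor. -/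
def parallelSpinor : h.harmonicSpinors b := ⟨constSpinor 1 0, constSpinor_mem h b 1 0⟩

theorem clifford_parallelSpinor (a : Fin 3 → ℝ) :
    (fun p x => h.clifford x (a, 0) ((parallelSpinor h b).1 p x)) = constSpinor 0 a := by
  funext p x
  ext i
  · simp [parallelSpinor, constSpinor, HyperKahlerStructure.clifford]
  · fin_cases i <;> simp [parallelSpinor, constSpinor, HyperKahlerStructure.clifford,
      HyperKahlerStructure.cross, HyperKahlerStructure.pairing, Matrix.vecHead, Matrix.vecTail]
  · simp [parallelSpinor, constSpinor, HyperKahlerStructure.clifford, HyperKahlerStructure.cross,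
      HyperKahlerStructure.act]

/-- The harmonic spinor `c_a s`, for the parallel vector field `a` with the given components with
respect to `∂_t, ∂_u, ∂_v`. -/
def cliffordParallel (a : Fin 3 → ℝ) : h.harmonicSpinors b :=
  ⟨fun p x => h.clifford x (a, 0) ((parallelSpinor h b).1 p x), by
    rw [clifford_parallelSpinor]
    exact constSpinor_mem h b 0 a⟩

/-- The subspace `span {s, c_a s}` of the space of harmonic spinors. -/
def spinorPlane (a : Fin 3 → ℝ) : Submodule ℝ (h.harmonicSpinors b) :=
  Submodule.span ℝ {parallelSpinor h b, cliffordParallel h b a}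

section Volume

variable [MeasurableSpace M] [BorelSpace M]

/-- The Gram matrix `g_{ij}` of the coordinate vector fields of the preferred chart at `c`. -/
def chartGram (c : M) (y : R4) : Matrix (Fin 4) (Fin 4) ℝ :=
  let e : Fin 4 → TangentSpace (𝓡 4) ((chartAt R4 c).symm y) := fun i =>
    mfderiv 𝓘(ℝ, R4) (𝓡 4) (chartAt R4 c).symm y (EuclideanSpace.single i 1 : R4)
  Matrix.of fun i j => inner ℝ (e i) (e j)

/-- `vol` is the Riemannian volume measure: in charts it is `√(det g_{ij})` times Lebesgue measure. -/
def IsRiemannianVolume (vol : Measure M) : Prop :=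
  ∀ c : M, vol.restrict (chartAt R4 c).source =
    ((volume.restrict (chartAt R4 c).target).withDensity
      fun y => ENNReal.ofReal (Real.sqrt (chartGram c y).det)).map (chartAt R4 c).symm

variable [CompactSpace M]
  [IsContMDiffRiemannianBundle (𝓡 4) ∞ R4 (fun x : M => TangentSpace (𝓡 4) x)]
  (vol : Measure M) [IsFiniteMeasure vol]

theorem integrable_spinorInner {ψ φ : Spinor M} (hψ : IsSmoothSpinor ψ) (hφ : IsSmoothSpinor φ) :
    Integrable (fun z : Plane × M => spinorInner (ψ z.1 z.2) (φ z.1 z.2))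
      ((volume.restrict (ZSpan.fundamentalDomain b)).prod vol) := by
  have hc : Continuous (fun z : Plane × M => spinorInner (ψ z.1 z.2) (φ z.1 z.2)) := by
    have h1 := hψ.flat.continuous
    have h2 := hφ.flat.continuous
    have h3 := (hψ.tangent.inner_bundle hφ.tangent).continuous
    exact ((h1.fst.mul h2.fst).add (h1.snd.dotProduct h2.snd)).add h3
  have hb := ZSpan.fundamentalDomain_isBounded b
  have : IsFiniteMeasure (volume.restrict (ZSpan.fundamentalDomain b)) :=
    isFiniteMeasure_restrict.2 hb.measure_lt_top.ne
  have : SecondCountableTopology M := ChartedSpace.secondCountable_of_sigmaCompact R4 M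
  obtain ⟨C, hC⟩ := (hb.isCompact_closure.prod (isCompact_univ (X := M))).exists_bound_of_continuousOn
    hc.continuousOn
  refine Integrable.of_bound hc.aestronglyMeasurable C ?_
  have h4 : ∀ᵐ p ∂(volume.restrict (ZSpan.fundamentalDomain b)), p ∈ ZSpan.fundamentalDomain b :=
    ae_restrict_mem (ZSpan.fundamentalDomain_measurableSet b)
  filter_upwards [Measure.quasiMeasurePreserving_fst.ae h4] with z hz
  exact hC z ⟨subset_closure hz, Set.mem_univ _⟩

/-- The `L²` metric on the space of harmonic spinors on `X`. -/
def HyperKahlerStructure.l2 :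
    h.harmonicSpinors b →ₗ[ℝ] h.harmonicSpinors b →ₗ[ℝ] ℝ :=
  LinearMap.mk₂ ℝ
    (fun ψ φ => ∫ z : Plane × M, spinorInner (ψ.1 z.1 z.2) (φ.1 z.1 z.2)
      ∂((volume.restrict (ZSpan.fundamentalDomain b)).prod vol))
    (fun ψ ψ' φ => by
      rw [← integral_add (integrable_spinorInner b vol ψ.2.1 φ.2.1)
        (integrable_spinorInner b vol ψ'.2.1 φ.2.1)]
      congr 1
      funext z
      simp [spinorInner, inner_add_left, add_mul]
      ring)
    (fun c ψ φ => by
      rw [smul_eq_mul, ← integral_const_mul]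
      congr 1
      funext z
      simp [spinorInner, inner_smul_left]
      ring)
    (fun ψ φ φ' => by
      rw [← integral_add (integrable_spinorInner b vol ψ.2.1 φ.2.1)
        (integrable_spinorInner b vol ψ.2.1 φ'.2.1)]
      congr 1
      funext z
      simp [spinorInner, inner_add_right, mul_add]
      ring)
    (fun c ψ φ => by
      rw [smul_eq_mul, ← integral_const_mul]
      congr 1
      funext z
      simp [spinorInner, inner_smul_right]
      ring)

end Volume

end Geometry

section Maslov

variable {W : Type*} [AddCommGroup W] [Module ℝ W]
  (g : W →ₗ[ℝ] W →ₗ[ℝ] ℝ) (γ : W →ₗ[ℝ] W)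

/-- `L` is Lagrangian (equal to its own annihilator) for the symplectic form `(x, y) ↦ g(γ x, y)`. -/
def IsLagrangian (L : Submodule ℝ W) : Prop :=
  ∀ x, x ∈ L ↔ ∀ y ∈ L, g (γ x) y = 0

/-- The Hermitian extension of `g` to the complexification of `W`, conjugate linear in the first
variable. -/
def hermitianExt (z z' : ℂ ⊗[ℝ] W) : ℂ :=
  LinearMap.BilinForm.baseChange ℂ g (Complex.conjAe.toLinearMap.rTensor W z) z'

/-- The eigenspaces `E_c` of `γ` on the complexification of `W`. -/
abbrev gammaEigenspace (c : ℂ) : Submodule ℂ (ℂ ⊗[ℝ] W) :=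
  Module.End.eigenspace (γ.baseChange ℂ) c

/-- The complexification of `L` is the graph of `Φ : E_i → E_{-i}`. -/
def IsGraphMap (L : Submodule ℝ W)
    (Φ : gammaEigenspace γ Complex.I →ₗ[ℂ] gammaEigenspace γ (-Complex.I)) : Prop :=
  ∀ z : ℂ ⊗[ℝ] W, z ∈ L.baseChange ℂ ↔
    ∃ x : gammaEigenspace γ Complex.I, z = (x : ℂ ⊗[ℝ] W) + (Φ x : ℂ ⊗[ℝ] W)

/-- `tr log T` for a diagonalizable operator `T`, with the branch of the logarithm whose imaginary part
lies in `(-π, π]`, so that `log (-1) = π i`. -/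
def traceLog {V : Type*} [AddCommGroup V] [Module ℂ V] (T : V →ₗ[ℂ] V) : ℂ :=
  ∑ᶠ c : ℂ, (Module.finrank ℂ (Module.End.eigenspace T c) : ℂ) * Complex.log c

/-- `m` is the Maslov angle of the Lagrangians `Lp`, `Lm` of `W` with the metric `g` and the complex
structure `γ`: if the complexifications of `Lp`, `Lm` are the graphs of the unitary maps
`Φp, Φm : E_i → E_{-i}`, then `m = dim (Lp ∩ Lm) - (1 / π i) tr log (-Φp Φm*)`. -/
def HasMaslovAngle (Lp Lm : Submodule ℝ W) (m : ℝ) : Prop :=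
  ∃ (Φp Φm : gammaEigenspace γ Complex.I →ₗ[ℂ] gammaEigenspace γ (-Complex.I))
    (Φmadj : gammaEigenspace γ (-Complex.I) →ₗ[ℂ] gammaEigenspace γ Complex.I),
    IsGraphMap γ Lp Φp ∧ IsGraphMap γ Lm Φm ∧
    (∀ (x : gammaEigenspace γ Complex.I) (y : gammaEigenspace γ (-Complex.I)),
      hermitianExt g (Φm x : ℂ ⊗[ℝ] W) (y : ℂ ⊗[ℝ] W) =
        hermitianExt g (x : ℂ ⊗[ℝ] W) (Φmadj y : ℂ ⊗[ℝ] W)) ∧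
    (m : ℂ) = (Module.finrank ℝ (Lp ⊓ Lm : Submodule ℝ W) : ℂ)
      - 1 / (Real.pi * Complex.I) * traceLog (-(Φp ∘ₗ Φmadj))

end Maslov

end

/-! ### Hopf's strong maximum principle. -/

section StrongMaximumPrinciple

open Filter Topology Metric

/-! The analytic half is that a harmonic spinor on `T² × M` is constant; the rest is linear algebra
in `ℂ²`.

Write a spinor as `(f, a, Y)`: a function `f`, three functions `a₀, a₁, a₂` belonging to `∂_t, ∂_u,
∂_v`, and a field `Y` tangent to `M`. The Dirac equation splits into one equation in `TM` and four
scalar ones. Since `I, J, K` are parallel, the trace of the covariant derivative of the tangential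
equation can be compared with the torus derivatives of the scalar equations, and `f` and `a₁` turn
out to be harmonic for the product metric (`IsDiracSolution.harmonic`). This is the scalar part of
the identity `D² = ∇*∇`. Clifford multiplication by `∂_t` preserves harmonic spinors and exchanges
`f, a₁` with `a₀, a₂` up to sign, so all four functions are harmonic. They are lattice-periodic and
`M` is compact, so they attain a maximum, and the strong maximum principle with connectedness makes
them constant (`flat_const`).

The scalar equations now say that on each slice `{p} × M` the endomorphisms `∇Y`, `I∇Y`, `J∇Y`,
`K∇Y` have trace zero. The first Bianchi identity, used in the form `d² = 0` for the one-forms `⟨QY,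
·⟩` with `Q = 1, I, J, K`, then gives `∇*∇Y = 0` (`sum_frame_eq_zero` is the algebra). By Bochner's
formula `Δ|Y|² = 2|∇Y|²`, the function `|Y|²` is subharmonic; the maximum principle makes it
constant, hence `∇Y = 0` (`field_parallel`). This is where the vanishing of the first Betti number
enters: `⟨Y, ·⟩` is closed, so it equals some `dF`, which vanishes at a maximum of `F`. Thus `Y`
vanishes at one point, and having constant length it vanishes everywhere (`field_eq_zero`). So `ker
A = ℝ ⊕ ℝ³` has the basis `s, c_t s, c_u s, c_v s`. Maximum principles take the place of integration
by parts throughout, so the local work can be done in charts.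

For the algebra, `γ` sends `s` to `c_t s` and `c_u s` to `c_v s`, so `ker A` is a sum of two complex
lines. Each of the two Lagrangians is a sum of real lines, one in each complex line: both contain
`s`, and in the second summand the lines are at angle `ϑ`. In suitable coordinates of `E_{±i}` the
plane at angle `t` is the graph of `diag(1, -e^{2it})`. Hence `-Φ₊Φ₋*` is `diag(-1, -e^{2iϑ})`, with
logarithms `πi` and `(2ϑ - π)i` since `0 < ϑ < π`. The first cancels the intersection dimension `1`,
and the second leaves `(π - 2ϑ)/π`. -/

/-- The second order differential operator `∑ i, ∂_{v i}² + ∂_β` without zeroth order term. -/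
noncomputable def secondOrderOp {E ι : Type*} [NormedAddCommGroup E] [NormedSpace ℝ E] [Fintype ι]
    (v : ι → E → E) (β : E → E) (w : E → ℝ) (y : E) : ℝ :=
  ∑ i, fderiv ℝ (fderiv ℝ w) y (v i y) (v i y) + fderiv ℝ w y (β y)

/-- On the line `y + t v` a positive second derivative would make `0` a local minimum as well as a
local maximum. The restriction would then be locally constant, with second derivative zero. -/
theorem IsLocalMax.fderiv_fderiv_nonpos {E : Type*} [NormedAddCommGroup E] [NormedSpace ℝ E]
    {w : E → ℝ} {y : E} (hmax : IsLocalMax w y) (hw : ContDiffAt ℝ 2 w y) (v : E) :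
    fderiv ℝ (fderiv ℝ w) y v v ≤ 0 := by
  by_contra! hpos
  have hline : ∀ t : ℝ, HasDerivAt (fun t : ℝ => y + t • v) v t := fun t => by
    simpa using ((hasDerivAt_id t).smul_const v).const_add y
  have hcont : Tendsto (fun t : ℝ => y + t • v) (𝓝 0) (𝓝 y) := by
    simpa using (hline 0).continuousAt.tendsto
  have hdiff : deriv (fun t : ℝ => w (y + t • v)) =ᶠ[𝓝 0]
      fun t => fderiv ℝ w (y + t • v) v := by
    have h1 : ∀ᶠ x in 𝓝 y, DifferentiableAt ℝ w x :=
      (hw.eventually (by simp)).mono fun x hx => hx.differentiableAt (by simp)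
    filter_upwards [hcont.eventually h1] with t ht
    have h2 : HasFDerivAt w (fderiv ℝ w (y + t • v)) (y + t • v) := ht.hasFDerivAt
    have h3 := h2.comp_hasDerivAt t (hline t)
    have h4 := h3.deriv
    simpa only [Function.comp_def] using h4
  have hw' : DifferentiableAt ℝ (fderiv ℝ w) (y + (0 : ℝ) • v) := by
    rw [zero_smul, add_zero]
    exact (hw.fderiv_right (m := 1) (by norm_num)).differentiableAt (by simp)
  have hdd : deriv (deriv fun t : ℝ => w (y + t • v)) 0 = fderiv ℝ (fderiv ℝ w) y v v := by
    rw [hdiff.deriv_eq]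
    have h1 : HasDerivAt (fun t : ℝ => fderiv ℝ w (y + t • v))
        (fderiv ℝ (fderiv ℝ w) (y + (0 : ℝ) • v) v) 0 :=
      hw'.hasFDerivAt.comp_hasDerivAt (0 : ℝ) (hline 0)
    rw [(h1.clm_apply (hasDerivAt_const (0 : ℝ) v)).deriv]
    simp
  have hd0 : deriv (fun t : ℝ => w (y + t • v)) 0 = 0 := by
    rw [hdiff.self_of_nhds]
    simp [hmax.fderiv_eq_zero]
  have hc : ContinuousAt (fun t : ℝ => w (y + t • v)) 0 := by
    have : ContinuousAt w (y + (0 : ℝ) • v) := by simpa using hw.continuousAt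
    exact ContinuousAt.comp (f := fun t : ℝ => y + t • v) this (hline 0).continuousAt
  have hmin := isLocalMin_of_deriv_deriv_pos (by rw [hdd]; exact hpos) hd0 hc
  have hconst : (fun t : ℝ => w (y + t • v)) =ᶠ[𝓝 0] fun _ => w y := by
    filter_upwards [hmin, hcont.eventually hmax] with t h3 h4
    simp only [zero_smul, add_zero] at h3
    exact le_antisymm h4 h3
  have hz : deriv (deriv fun t : ℝ => w (y + t • v)) 0 = 0 := by
    rw [hconst.deriv.deriv_eq]
    simp
  rw [hdd] at hz
  exact hpos.ne' hz

section Inner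

variable {E ι : Type*} [NormedAddCommGroup E] [InnerProductSpace ℝ E] [Fintype ι]

/-- The barrier function of Hopf's lemma, positive on the ball of radius `R` about `c`. -/
noncomputable def hopfBarrier (c : E) (R α : ℝ) (y : E) : ℝ :=
  Real.exp (-α * ‖y - c‖ ^ 2) - Real.exp (-α * R ^ 2)

theorem hopfBarrier_contDiff (c : E) (R α : ℝ) : ContDiff ℝ ∞ (hopfBarrier c R α) := by
  unfold hopfBarrier
  exact ((contDiff_const.mul ((contDiff_id.sub contDiff_const).norm_sq ℝ)).exp).sub contDiff_const

theorem hasFDerivAt_hopfBarrier (c : E) (R α : ℝ) (y : E) :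
    HasFDerivAt (hopfBarrier c R α)
      ((-2 * α * Real.exp (-α * ‖y - c‖ ^ 2)) • innerSL ℝ (y - c)) y := by
  have h1 : HasFDerivAt (fun y : E => ‖y - c‖ ^ 2) (2 • (innerSL ℝ (y - c))) y := by
    simpa using ((hasFDerivAt_id y).sub_const c).norm_sq
  refine (((h1.const_mul (-α)).exp).sub_const (Real.exp (-α * R ^ 2))).congr_fderiv ?_
  ext v
  simp
  ring

theorem fderiv_fderiv_hopfBarrier (c : E) (R α : ℝ) (y v : E) :
    fderiv ℝ (fderiv ℝ (hopfBarrier c R α)) y v v =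
      Real.exp (-α * ‖y - c‖ ^ 2) * (4 * α ^ 2 * inner ℝ (y - c) v ^ 2 - 2 * α * ‖v‖ ^ 2) := by
  have h0 : fderiv ℝ (hopfBarrier c R α) = fun y =>
      (-2 * α * Real.exp (-α * ‖y - c‖ ^ 2)) • innerSL ℝ (y - c) :=
    funext fun y => (hasFDerivAt_hopfBarrier c R α y).fderiv
  have h1 : HasFDerivAt (fun y : E => ‖y - c‖ ^ 2) (2 • (innerSL ℝ (y - c))) y := by
    simpa using ((hasFDerivAt_id y).sub_const c).norm_sq
  have h2 := ((h1.const_mul (-α)).exp).const_mul (-2 * α)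
  have h3 : HasFDerivAt (fun y : E => innerSL ℝ (y - c)) (innerSL ℝ : E →L[ℝ] E →L[ℝ] ℝ) y :=
    ((innerSL ℝ : E →L[ℝ] E →L[ℝ] ℝ).hasFDerivAt).comp y ((hasFDerivAt_id y).sub_const c)
  have h4 := (h2.smul h3).fderiv
  rw [h0]
  have h5 := congrArg (fun A => A v v) h4
  refine h5.trans ?_
  generalize y - c = d
  simp
  rw [innerSL_apply_apply, real_inner_self_eq_norm_sq]
  ring

/-- Up to a positive factor, the operator applied to the barrier has an `α²` term with coefficient
`∑ ⟨z - c, v i⟩² > 0`, while everything else is linear in `α`. A large `α` therefore wins. -/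
theorem exists_secondOrderOp_hopfBarrier_pos {v : ι → E → E} {β : E → E} {c z : E} (R : ℝ)
    (hspan : ∃ i, inner ℝ (z - c) (v i z) ≠ (0 : ℝ)) :
    ∃ α > 0, 0 < secondOrderOp v β (hopfBarrier c R α) z := by
  set P : ℝ := ∑ i, inner ℝ (z - c) (v i z) ^ 2 with hP
  have hPpos : 0 < P := by
    obtain ⟨i, hi⟩ := hspan
    exact Finset.sum_pos' (fun _ _ => sq_nonneg _) ⟨i, Finset.mem_univ i, by positivity⟩
  set Q : ℝ := ∑ i, ‖v i z‖ ^ 2 + inner ℝ (z - c) (β z) with hQ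
  have hform : ∀ α : ℝ, secondOrderOp v β (hopfBarrier c R α) z =
      Real.exp (-α * ‖z - c‖ ^ 2) * (2 * α) * (2 * α * P - Q) := fun α => by
    simp only [secondOrderOp, fderiv_fderiv_hopfBarrier, (hasFDerivAt_hopfBarrier c R α z).fderiv]
    rw [← Finset.mul_sum, Finset.sum_sub_distrib, ← Finset.mul_sum, ← Finset.mul_sum, ← hP, hQ]
    generalize z - c = d
    simp
    ring
  -- With this `α` the decisive factor `2αP - Q` is `2|Q| + 2 - Q > 0`.
  refine ⟨(|Q| + 1) / P, by positivity, ?_⟩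
  rw [hform]
  have : 0 < 2 * ((|Q| + 1) / P) * P - Q := by
    have h1 : 2 * ((|Q| + 1) / P) * P = 2 * (|Q| + 1) := by field_simp
    rw [h1]
    linarith [le_abs_self Q, abs_nonneg Q]
  positivity

theorem continuousOn_secondOrderOp {U : Set E} (hU : IsOpen U) {v : ι → E → E} {β : E → E}
    (hv : ∀ i, ContinuousOn (v i) U) (hβ : ContinuousOn β U) {w : E → ℝ} (hw : ContDiffOn ℝ 2 w U) :
    ContinuousOn (secondOrderOp v β w) U := by
  have h1 : ContDiffOn ℝ 1 (fderiv ℝ w) U := hw.fderiv_of_isOpen hU (by norm_num)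
  have h2 : ContinuousOn (fderiv ℝ (fderiv ℝ w)) U := h1.continuousOn_fderiv_of_isOpen hU le_rfl
  exact (continuousOn_finsetSum _ fun i _ => (h2.clm_apply (hv i)).clm_apply (hv i)).add
    (h1.continuousOn.clm_apply hβ)

variable [FiniteDimensional ℝ E]

/-- Perturb `w` to `w + εk`, with `k` the barrier of the ball. For small `ε` the maximum over a
small closed ball about `z` lies in its interior, where the second order operator is nonpositive.
But the operator is nonnegative on `w` and positive on `k` there. -/
theorem hopf_touching_ball {U : Set E} (hU : IsOpen U) {w : E → ℝ} (hw : ContDiffOn ℝ 2 w U)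
    {v : ι → E → E} {β : E → E} (hv : ∀ i, ContinuousOn (v i) U) (hβ : ContinuousOn β U)
    (hspan : ∀ y ∈ U, ∀ ξ : E, ξ ≠ 0 → ∃ i, inner ℝ ξ (v i y) ≠ (0 : ℝ))
    (hL : ∀ y ∈ U, 0 ≤ secondOrderOp v β w y) {c z : E} {R : ℝ} (hR : 0 < R)
    (hz : dist z c = R) (hzU : z ∈ U) (hmax : ∀ y ∈ U, w y ≤ w z)
    (hlt : ∀ y ∈ U, dist y c ≤ R → y ≠ z → w y < w z) : False := by
  have hzc : z - c ≠ 0 := by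
    rw [← norm_ne_zero_iff, ← dist_eq_norm, hz]; exact hR.ne'
  obtain ⟨α, hα, hpos⟩ := exists_secondOrderOp_hopfBarrier_pos (v := v) (β := β) R
    (hspan z hzU _ hzc)
  set k := hopfBarrier c R α with hk
  have hkC : ContDiff ℝ 2 k := (hopfBarrier_contDiff c R α).of_le (by norm_cast)
  have hev : ∀ᶠ y in 𝓝 z, y ∈ U ∧ 0 < secondOrderOp v β k y :=
    (hU.eventually_mem hzU).and
      (((continuousOn_secondOrderOp hU hv hβ hkC.contDiffOn).continuousAt
        (hU.mem_nhds hzU)).eventually_const_lt hpos)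
  obtain ⟨r, hr, hball⟩ := nhds_basis_closedBall.mem_iff.1 hev
  have hwc : ContinuousOn w (closedBall z r) := hw.continuousOn.mono fun y hy => (hball hy).1
  have hS : IsCompact (sphere z r ∩ closedBall c R) := (isCompact_sphere z r).inter_right
    isClosed_closedBall
  have hk1 : ∀ y, k y ≤ 1 := fun y => by
    have h1 : Real.exp (-α * ‖y - c‖ ^ 2) ≤ 1 := Real.exp_le_one_iff.2 (by
      have := mul_nonneg hα.le (sq_nonneg ‖y - c‖); linarith)
    have h2 := Real.exp_pos (-α * R ^ 2)
    simp only [hk, hopfBarrier]; linarith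
  -- On this compact part of the sphere `w` stays strictly below `w z`, and `k ≤ 1`, so half the gap
  -- serves as `ε`.
  obtain ⟨ε, hε, hεS⟩ : ∃ ε > 0, ∀ y ∈ sphere z r ∩ closedBall c R, w y + ε * k y < w z := by
    rcases (sphere z r ∩ closedBall c R).eq_empty_or_nonempty with he | hne
    · exact ⟨1, one_pos, fun y hy => by simp [he] at hy⟩
    · obtain ⟨p, hp, hpmax⟩ := hS.exists_isMaxOn hne
        (hwc.mono (Set.inter_subset_left.trans sphere_subset_closedBall))
      have hpz : w p < w z := hlt p (hball (sphere_subset_closedBall hp.1)).1 hp.2 (by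
        rintro rfl
        have := hp.1
        simp at this
        exact hr.ne this)
      refine ⟨(w z - w p) / 2, by linarith, fun y hy => ?_⟩
      have h1 : w y ≤ w p := hpmax hy
      have h2 : (w z - w p) / 2 * k y ≤ (w z - w p) / 2 := by
        nlinarith [hk1 y]
      linarith
  have hkz : k z = 0 := by simp [hk, hopfBarrier, ← dist_eq_norm, hz]
  obtain ⟨p, hp, hpmax⟩ := (isCompact_closedBall z r).exists_isMaxOn
    ⟨z, mem_closedBall_self hr.le⟩ (hwc.add (continuousOn_const.mul hkC.continuous.continuousOn) :
      ContinuousOn (fun y => w y + ε * k y) _)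
  have hpz : w z ≤ w p + ε * k p := by
    have := hpmax (mem_closedBall_self hr.le)
    simpa [hkz] using this
  have hpin : p ∈ ball z r := by
    by_contra hnot
    have hps : p ∈ sphere z r := by
      simp only [mem_ball, not_lt] at hnot
      exact le_antisymm hp hnot
    -- Outside the closed ball of radius `R` the barrier is negative, so there every positive `ε`
    -- keeps the sum below `w z`.
    by_cases hpc : dist p c ≤ R
    · exact absurd hpz (not_le.2 (hεS p ⟨hps, hpc⟩))
    · have h1 : k p < 0 := by
        simp only [hk, hopfBarrier, sub_neg, Real.exp_lt_exp, ← dist_eq_norm]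
        have : R ^ 2 < dist p c ^ 2 := by
          push Not at hpc; gcongr
        nlinarith
      have h2 := hmax p (hball hp).1
      nlinarith
  have hloc : IsLocalMax (fun y => w y + ε * k y) p :=
    hpmax.isLocalMax (closedBall_mem_nhds_of_mem hpin)
  have hpU := (hball hp).1
  have hwp : ContDiffAt ℝ 2 w p := hw.contDiffAt (hU.mem_nhds hpU)
  have hWp : ContDiffAt ℝ 2 (fun y => w y + ε * k y) p := hwp.add (contDiffAt_const.mul hkC.contDiffAt)
  have hfd : (fderiv ℝ fun y => w y + ε * k y) =ᶠ[𝓝 p] fun y => fderiv ℝ w y + ε • fderiv ℝ k y := by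
    filter_upwards [hwp.eventually (by simp)] with y hy
    rw [fderiv_fun_add (hy.differentiableAt (by simp))
      ((hkC.differentiable (by simp) y).const_mul ε), fderiv_const_mul (hkC.differentiable (by simp) y)]
  have hop : secondOrderOp v β (fun y => w y + ε * k y) p =
      secondOrderOp v β w p + ε * secondOrderOp v β k p := by
    have d1 : DifferentiableAt ℝ (fderiv ℝ w) p :=
      (hwp.fderiv_right (m := 1) (by norm_num)).differentiableAt (by simp)
    have d2 : DifferentiableAt ℝ (fderiv ℝ k) p :=
      (hkC.contDiffAt.fderiv_right (m := 1) (by norm_num)).differentiableAt (by simp)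
    simp only [secondOrderOp]
    have d3 : fderiv ℝ (fun y => fderiv ℝ w y + ε • fderiv ℝ k y) p =
        fderiv ℝ (fderiv ℝ w) p + ε • fderiv ℝ (fderiv ℝ k) p :=
      (d1.hasFDerivAt.add (d2.hasFDerivAt.const_smul ε)).fderiv
    rw [hfd.fderiv_eq, hfd.self_of_nhds, d3]
    simp [Finset.sum_add_distrib, Finset.mul_sum, mul_add]
    ring
  have hneg : secondOrderOp v β (fun y => w y + ε * k y) p ≤ 0 := by
    simp only [secondOrderOp, hloc.fderiv_eq_zero]
    simpa using Finset.sum_nonpos fun i _ => hloc.fderiv_fderiv_nonpos hWp (v i p)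
  have h1 := hL p hpU
  have h2 := mul_pos hε (hball hp).2
  linarith

/-- Hopf's strong maximum principle. -/
theorem strong_maximum_principle_inner {U : Set E} (hU : IsOpen U) {w : E → ℝ}
    (hw : ContDiffOn ℝ 2 w U)
    {v : ι → E → E} {β : E → E} (hv : ∀ i, ContinuousOn (v i) U) (hβ : ContinuousOn β U)
    (hspan : ∀ y ∈ U, ∀ ξ : E, ξ ≠ 0 → ∃ i, inner ℝ ξ (v i y) ≠ (0 : ℝ))
    (hL : ∀ y ∈ U, 0 ≤ secondOrderOp v β w y) {y₀ : E} (h0 : y₀ ∈ U)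
    (hmax : ∀ y ∈ U, w y ≤ w y₀) : ∀ᶠ y in 𝓝 y₀, w y = w y₀ := by
  obtain ⟨r, hr, hball⟩ := nhds_basis_closedBall.mem_iff.1 (hU.mem_nhds h0)
  by_contra hne
  -- Half the radius is enough: the ball about `q` reaching to the nearest maximum point then stays
  -- inside `closedBall y₀ r`.
  have hfr : ∃ q ∈ ball y₀ (r / 2), w q ≠ w y₀ := by
    by_contra! h
    exact hne (eventually_of_mem (ball_mem_nhds y₀ (half_pos hr)) h)
  obtain ⟨q, hq, hwq⟩ := hfr
  have hwc : ContinuousOn w (closedBall y₀ r) := hw.continuousOn.mono hball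
  have hF : IsCompact (closedBall y₀ r ∩ {y | w y = w y₀}) := by
    refine (isCompact_closedBall y₀ r).of_isClosed_subset ?_ Set.inter_subset_left
    exact hwc.preimage_isClosed_of_isClosed isClosed_closedBall isClosed_singleton
  -- A point of the maximum set nearest to `q`; the open ball about `q` through `z` contains no
  -- maximum point.
  obtain ⟨z, hz, hzmin⟩ := hF.exists_isMinOn ⟨y₀, mem_closedBall_self hr.le, rfl⟩
    (f := fun y => dist y q) (by fun_prop)
  have hzq : z ≠ q := by rintro rfl; exact hwq hz.2
  set R := dist z q with hRdef
  have hRpos : 0 < R := dist_pos.2 hzq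
  have hRr : R < r / 2 := by
    have h1 : R ≤ dist y₀ q := hzmin ⟨mem_closedBall_self hr.le, rfl⟩
    rw [mem_ball, dist_comm] at hq
    linarith
  have hlt : ∀ y, dist y q < R → y ∈ U ∧ w y < w y₀ := fun y hy => by
    have hyb : y ∈ closedBall y₀ r := by
      have := dist_triangle y q y₀
      rw [mem_ball] at hq
      rw [mem_closedBall]; linarith
    refine ⟨hball hyb, lt_of_le_of_ne (hmax y (hball hyb)) fun h => ?_⟩
    exact absurd (hzmin ⟨hyb, h⟩ : R ≤ dist y q) (not_le.2 hy)
  -- The ball about `q` may touch the maximum set at several points. The ball of half the radius,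
  -- internally tangent at `z`, touches it at `z` only.
  have hc1 : dist z (midpoint ℝ q z) = R / 2 := by
    rw [dist_right_midpoint, dist_comm q z]; simp [hRdef]; ring
  refine hopf_touching_ball hU hw hv hβ hspan hL (c := midpoint ℝ q z) (half_pos hRpos) hc1
    (hball hz.1) (fun y hy => (hmax y hy).trans_eq hz.2.symm) fun y _ hyc hyz => ?_
  rw [show w z = w y₀ from hz.2]
  refine (hlt y ?_).2
  set d := z - midpoint ℝ q z with hd
  set a := y - midpoint ℝ q z with ha
  have h1 : y - q = a + d := by
    have : midpoint ℝ q z = (2⁻¹ : ℝ) • (q + z) := by rw [midpoint_eq_smul_add]; simp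
    rw [ha, hd, this]; module
  have h2 : y - z = a - d := by rw [ha, hd]; abel
  -- `‖a + d‖² = 2‖a‖² + 2‖d‖² - ‖a - d‖²` is strictly less than `R²`, because `y ≠ z` makes the
  -- last term nonzero.
  have h3 := parallelogram_law_with_norm ℝ a d
  have h4 : 0 < ‖a - d‖ := by rw [← h2]; exact norm_pos_iff.2 (sub_ne_zero.2 hyz)
  have h5 : ‖d‖ = R / 2 := by rw [hd, ← dist_eq_norm, hc1]
  have h6 : ‖a‖ ≤ R / 2 := by rw [ha, ← dist_eq_norm]; exact hyc
  rw [dist_eq_norm, h1]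
  rw [h5] at h3
  nlinarith [norm_nonneg (a + d), norm_nonneg a]

end Inner

/-- Hopf's strong maximum principle, in a finite-dimensional normed space. -/
theorem strong_maximum_principle {E ι : Type*} [NormedAddCommGroup E] [NormedSpace ℝ E]
    [FiniteDimensional ℝ E] [Fintype ι] {U : Set E} (hU : IsOpen U) {w : E → ℝ}
    (hw : ContDiffOn ℝ 2 w U)
    {v : ι → E → E} {β : E → E} (hv : ∀ i, ContinuousOn (v i) U) (hβ : ContinuousOn β U)
    (hspan : ∀ y ∈ U, ∀ ℓ : E →L[ℝ] ℝ, (∀ i, ℓ (v i y) = 0) → ℓ = 0)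
    (hL : ∀ y ∈ U, 0 ≤ secondOrderOp v β w y) {y₀ : E} (h0 : y₀ ∈ U)
    (hmax : ∀ y ∈ U, w y ≤ w y₀) : ∀ᶠ y in 𝓝 y₀, w y = w y₀ := by
  -- Hopf's argument needs round balls. The form of the operator and the spanning condition survive
  -- a linear change of coordinates, so a Euclidean norm may be imposed.
  set A : E ≃L[ℝ] EuclideanSpace ℝ (Fin (Module.finrank ℝ E)) := toEuclidean with hA
  have hAc : ContinuousOn A.symm (A.symm ⁻¹' U) := A.symm.continuous.continuousOn
  have key := strong_maximum_principle_inner (U := A.symm ⁻¹' U) (w := w ∘ A.symm)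
    (v := fun i x => A (v i (A.symm x))) (β := fun x => A (β (A.symm x)))
    (hU.preimage A.symm.continuous)
    (hw.comp A.symm.contDiff.contDiffOn fun _ h => h)
    (fun i => A.continuous.comp_continuousOn ((hv i).comp hAc fun _ h => h))
    (A.continuous.comp_continuousOn (hβ.comp hAc fun _ h => h))
    (fun x hx ξ hξ => by
      by_contra! h
      have h1 := hspan _ hx ((innerSL ℝ ξ).comp (A : E →L[ℝ] EuclideanSpace ℝ (Fin (Module.finrank ℝ E)))) h
      have h2 := congrArg (fun l => l (A.symm ξ)) h1
      simp at h2
      exact hξ h2)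
    (fun x hx => by
      have h1 := hL _ hx
      have hwx : ContDiffAt ℝ 2 w (A.symm x) := hw.contDiffAt (hU.mem_nhds hx)
      have hfd : fderiv ℝ (w ∘ A.symm) = fun x =>
          (fderiv ℝ w (A.symm x)).comp (A.symm : EuclideanSpace ℝ _ →L[ℝ] E) :=
        funext fun x => A.symm.comp_right_fderiv
      have d1 : DifferentiableAt ℝ (fderiv ℝ w) (A.symm x) :=
        (hwx.fderiv_right (m := 1) (by norm_num)).differentiableAt (by simp)
      have hfd2 : ∀ a b, fderiv ℝ (fderiv ℝ (w ∘ A.symm)) x a b =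
          fderiv ℝ (fderiv ℝ w) (A.symm x) (A.symm a) (A.symm b) := fun a b => by
        rw [hfd]
        have h1 : HasFDerivAt (fun x => fderiv ℝ w (A.symm x))
            ((fderiv ℝ (fderiv ℝ w) (A.symm x)).comp
              (A.symm : EuclideanSpace ℝ (Fin (Module.finrank ℝ E)) →L[ℝ] E)) x :=
          d1.hasFDerivAt.comp x A.symm.hasFDerivAt
        have h2 := h1.clm_comp (hasFDerivAt_const
          (A.symm : EuclideanSpace ℝ (Fin (Module.finrank ℝ E)) →L[ℝ] E) x)
        have h3 := congrArg (fun L => L a b) h2.fderiv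
        refine h3.trans ?_
        simp
      have h4 : secondOrderOp (fun i x => A (v i (A.symm x))) (fun x => A (β (A.symm x)))
          (w ∘ A.symm) x = secondOrderOp v β w (A.symm x) := by
        simp only [secondOrderOp, hfd2]
        rw [hfd]
        simp
      rw [h4]
      exact h1)
    (y₀ := A y₀) (by simpa using h0) (fun x hx => by simpa using hmax _ hx)
  have h5 := A.continuous.continuousAt.eventually key
  simpa using h5

end StrongMaximumPrinciple

/-! ### Linear algebra of a quaternionic triple in dimension four. -/

/-- A Euclidean inner product `g` with a compatible quaternionic triple `I`, `J`, `K`. -/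
structure IsHermitianTriple {V : Type*} [NormedAddCommGroup V] [NormedSpace ℝ V]
    (g : V →L[ℝ] V →L[ℝ] ℝ) (I J K : V →L[ℝ] V) : Prop where
  symm : ∀ x y, g x y = g y x
  pos : ∀ x, x ≠ 0 → 0 < g x x
  I_sq : ∀ x, I (I x) = -x
  J_sq : ∀ x, J (J x) = -x
  I_J : ∀ x, I (J x) = K x
  J_I : ∀ x, J (I x) = -K x
  I_isometry : ∀ x y, g (I x) (I y) = g x y
  J_isometry : ∀ x y, g (J x) (J y) = g x y

namespace IsHermitianTriple

variable {V : Type*} [NormedAddCommGroup V] [NormedSpace ℝ V]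
  {g : V →L[ℝ] V →L[ℝ] ℝ} {I J K : V →L[ℝ] V}

section

variable (H : IsHermitianTriple g I J K)
include H

theorem I_K (x : V) : I (K x) = -J x := by rw [← H.I_J, H.I_sq]
theorem K_I (x : V) : K (I x) = J x := by rw [← H.I_J, H.J_I]; simp [H.I_K]
theorem J_K (x : V) : J (K x) = I x := by
  rw [← neg_eq_iff_eq_neg.2 (H.J_I x)]; simp [H.J_sq]
theorem K_J (x : V) : K (J x) = -I x := by rw [← H.I_J, H.J_sq]; simp
theorem K_sq (x : V) : K (K x) = -x := by rw [← H.I_J, H.J_K, H.I_sq]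
theorem K_isometry (x y : V) : g (K x) (K y) = g x y := by
  rw [← H.I_J, ← H.I_J, H.I_isometry, H.J_isometry]
theorem I_skew (x y : V) : g (I x) y = -g x (I y) := by
  rw [← H.I_isometry x, H.I_sq]; simp
theorem J_skew (x y : V) : g (J x) y = -g x (J y) := by
  rw [← H.J_isometry x, H.J_sq]; simp
theorem K_skew (x y : V) : g (K x) y = -g x (K y) := by
  rw [← H.K_isometry x, H.K_sq]; simp
theorem I_self (x : V) : g x (I x) = 0 := by
  have := H.I_skew x x; rw [H.symm] at this; linarith
theorem J_self (x : V) : g x (J x) = 0 := by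
  have := H.J_skew x x; rw [H.symm] at this; linarith
theorem K_self (x : V) : g x (K x) = 0 := by
  have := H.K_skew x x; rw [H.symm] at this; linarith

theorem nonneg (x : V) : 0 ≤ g x x := by
  rcases eq_or_ne x 0 with rfl | hx
  · simp
  · exact (H.pos x hx).le

theorem eq_zero_of_forall {x : V} (h : ∀ y, g x y = 0) : x = 0 := by
  by_contra hx
  exact (H.pos x hx).ne' (h x)

end

/-- The orthogonal frame `z, I z, J z, K z`. -/
def frame (I J K : V →L[ℝ] V) (z : V) : Fin 4 → V := ![z, I z, J z, K z]

section

variable (H : IsHermitianTriple g I J K)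
include H

theorem frame_orthogonal (z : V) (a b : Fin 4) :
    g (frame I J K z a) (frame I J K z b) = if a = b then g z z else 0 := by
  fin_cases a <;> fin_cases b <;>
    simp [frame, H.I_isometry, H.J_isometry, H.K_isometry, H.I_self, H.J_self, H.K_self,
      H.I_skew, H.J_skew, H.K_skew, H.I_J, H.I_K, H.J_K, H.J_I, H.K_I, H.K_J]

theorem linearIndependent_frame {z : V} (hz : z ≠ 0) : LinearIndependent ℝ (frame I J K z) := by
  rw [Fintype.linearIndependent_iff]
  intro c hc a
  have h1 := congrArg (fun x => g (frame I J K z a) x) hc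
  simp only [map_sum, map_smul, smul_eq_mul, H.frame_orthogonal, map_zero] at h1
  simpa [(H.pos z hz).ne'] using h1

variable (hV : Module.finrank ℝ V = 4)
include hV

/-- The vectors `z, Iz, Jz, Kz` are orthogonal of equal length, so for `z ≠ 0` they form a basis.
The factor `g z z` avoids normalising and keeps the formula valid at `z = 0`. -/
theorem frame_expansion (z x : V) :
    g z z • x = ∑ a, g (frame I J K z a) x • frame I J K z a := by
  rcases eq_or_ne z 0 with rfl | hz
  · simp [frame, Fin.sum_univ_four]
  set e := basisOfLinearIndependentOfCardEqFinrank (H.linearIndependent_frame hz) (by simp [hV])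
  have he : ∀ a, e a = frame I J K z a := fun a => by simp [e]
  have h1 : ∀ a, g (frame I J K z a) x = e.repr x a * g z z := fun a => by
    conv_lhs => rw [← e.sum_repr x]
    simp [he, H.frame_orthogonal]
  conv_lhs => rw [← e.sum_repr x]
  rw [Finset.smul_sum]
  refine Finset.sum_congr rfl fun a _ => ?_
  rw [h1, smul_smul, he, mul_comm]

theorem trace_frame (z : V) (A : V →L[ℝ] V) :
    g z z * LinearMap.trace ℝ V (A : V →ₗ[ℝ] V) = ∑ a, g (frame I J K z a) (A (frame I J K z a)) := by
  rcases eq_or_ne z 0 with rfl | hz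
  · simp [frame, Fin.sum_univ_four]
  set e := basisOfLinearIndependentOfCardEqFinrank (H.linearIndependent_frame hz) (by simp [hV])
  have he : ∀ a, e a = frame I J K z a := fun a => by simp [e]
  have h1 : ∀ a x, g (frame I J K z a) x = e.repr x a * g z z := fun a x => by
    conv_lhs => rw [← e.sum_repr x]
    simp [he, H.frame_orthogonal]
  rw [LinearMap.trace_eq_matrix_trace ℝ e, Matrix.trace, Finset.mul_sum]
  refine Finset.sum_congr rfl fun a _ => ?_
  simp [h1, LinearMap.toMatrix_apply, he, mul_comm]

/-- The algebraic part of the Weitzenböck formula: the first Bianchi identity makes the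
curvature term vanish. -/
theorem sum_frame_eq_zero {T : V →L[ℝ] V →L[ℝ] V}
    (h1 : ∀ e, LinearMap.trace ℝ V (T e : V →ₗ[ℝ] V) = 0)
    (hI : ∀ e, LinearMap.trace ℝ V (I.comp (T e) : V →ₗ[ℝ] V) = 0)
    (hJ : ∀ e, LinearMap.trace ℝ V (J.comp (T e) : V →ₗ[ℝ] V) = 0)
    (hK : ∀ e, LinearMap.trace ℝ V (K.comp (T e) : V →ₗ[ℝ] V) = 0)
    (hB : ∀ Q ∈ [ContinuousLinearMap.id ℝ V, I, J, K], ∀ a b c,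
      g (Q (T a b)) c - g (Q (T a c)) b + (g (Q (T b c)) a - g (Q (T b a)) c)
        + (g (Q (T c a)) b - g (Q (T c b)) a) = 0) (z : V) :
    ∑ a, T (frame I J K z a) (frame I J K z a) = 0 := by
  -- The trace conditions for `1, I, J, K` are taken at `T z, T (I z), T (J z), T (K z)`, and the
  -- cyclic identity for each `Q` on the three frame vectors other than `Q z`. These eight scalar
  -- relations add up to the claim.
  have key : ∀ z, g (∑ a, T (frame I J K z a) (frame I J K z a)) z = 0 := fun z => by
    have e1 := H.trace_frame hV z (T z)
    have e2 := H.trace_frame hV z (I.comp (T (I z)))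
    have e3 := H.trace_frame hV z (J.comp (T (J z)))
    have e4 := H.trace_frame hV z (K.comp (T (K z)))
    rw [h1] at e1
    rw [hI] at e2
    rw [hJ] at e3
    rw [hK] at e4
    have b1 := hB (.id ℝ V) (by simp) (I z) (J z) (K z)
    have b2 := hB I (by simp) z (J z) (K z)
    have b3 := hB J (by simp) z (K z) (I z)
    have b4 := hB K (by simp) z (I z) (J z)
    simp only [frame, Fin.sum_univ_four, Matrix.cons_val, Matrix.cons_val_zero, Matrix.cons_val_one,
      H.symm _ (T _ _), H.symm _ (I (T _ _)), H.symm _ (J (T _ _)), H.symm _ (K (T _ _)),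
      ContinuousLinearMap.comp_apply, H.I_skew, H.J_skew, H.K_skew,
      H.I_J, H.I_K, H.J_K, H.J_I, H.K_I, H.K_J, H.I_sq, H.J_sq, H.K_sq, map_neg, map_add,
      add_apply, ContinuousLinearMap.id_apply, mul_zero, neg_neg] at e1 e2 e3 e4 b1 b2 b3 b4 ⊢
    linarith
  -- Starting the frame at another of its members only permutes it up to signs, and the sum is
  -- quadratic in the frame. So the sum is orthogonal to every frame vector.
  have hz : ∀ a, g (∑ a, T (frame I J K z a) (frame I J K z a)) (frame I J K z a) = 0 := fun a => by
    have h2 := key (frame I J K z a)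
    have h3 : ∑ b, T (frame I J K (frame I J K z a) b) (frame I J K (frame I J K z a) b) =
        ∑ b, T (frame I J K z b) (frame I J K z b) := by
      fin_cases a <;>
      simp [frame, Fin.sum_univ_four, H.I_J, H.I_K, H.J_K, H.J_I, H.K_I, H.K_J, H.I_sq, H.J_sq,
        H.K_sq] <;> abel
    rwa [h3] at h2
  rcases eq_or_ne z 0 with rfl | hz0
  · simp [frame, Fin.sum_univ_four]
  refine H.eq_zero_of_forall fun y => ?_
  generalize ∑ a, T (frame I J K z a) (frame I J K z a) = s at hz ⊢
  have h4 := congrArg (g s) (H.frame_expansion hV z y)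
  simp only [map_sum, map_smul, hz, mul_zero, Finset.sum_const_zero, smul_eq_mul] at h4
  exact (mul_eq_zero.1 h4).resolve_left (H.pos z hz0).ne'

end

end IsHermitianTriple

/-! ### Covariant calculus in a chart, the Bianchi identity and the Weitzenböck formula. -/

section ChartCalculus

variable {V : Type*} [NormedAddCommGroup V] [NormedSpace ℝ V]

/-- The covariant derivative with Christoffel symbols `Γ` of a vector field on an open subset of a
vector space. -/
noncomputable def chartCov (Γ : V → V →L[ℝ] V →L[ℝ] V) (Y : V → V) (y : V) : V →L[ℝ] V :=
  fderiv ℝ Y y + (Γ y).flip (Y y)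

/-- The covariant derivative with Christoffel symbols `Γ` of a field of endomorphisms. -/
noncomputable def chartCovEnd (Γ : V → V →L[ℝ] V →L[ℝ] V) (B : V → V →L[ℝ] V) (y : V) :
    V →L[ℝ] V →L[ℝ] V :=
  fderiv ℝ B y + ((ContinuousLinearMap.compL ℝ V V V).flip (B y)).comp (Γ y)
    - (ContinuousLinearMap.compL ℝ V V V (B y)).comp (Γ y)

theorem chartCov_apply (Γ : V → V →L[ℝ] V →L[ℝ] V) (Y : V → V) (y e : V) :
    chartCov Γ Y y e = fderiv ℝ Y y e + Γ y e (Y y) := rfl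

theorem chartCovEnd_apply (Γ : V → V →L[ℝ] V →L[ℝ] V) (B : V → V →L[ℝ] V) (y e z : V) :
    chartCovEnd Γ B y e z = fderiv ℝ B y e z + Γ y e (B y z) - B y (Γ y e z) := rfl

/-- The expression in a chart of a hyper-Kähler structure: metric, Christoffel symbols of the
Levi-Civita connection, and parallel complex structures. -/
structure HyperKahlerChart (U : Set V) where
  isOpen : IsOpen U
  g : V → V →L[ℝ] V →L[ℝ] ℝ
  Γ : V → V →L[ℝ] V →L[ℝ] V
  I : V → V →L[ℝ] V
  J : V → V →L[ℝ] V
  K : V → V →L[ℝ] V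
  g_smooth : ContDiffOn ℝ ∞ g U
  Γ_smooth : ContDiffOn ℝ ∞ Γ U
  I_smooth : ContDiffOn ℝ ∞ I U
  J_smooth : ContDiffOn ℝ ∞ J U
  K_smooth : ContDiffOn ℝ ∞ K U
  triple : ∀ y ∈ U, IsHermitianTriple (g y) (I y) (J y) (K y)
  Γ_symm : ∀ y ∈ U, ∀ e z, Γ y e z = Γ y z e
  metric : ∀ y ∈ U, ∀ e a b, fderiv ℝ g y e a b = g y (Γ y e a) b + g y a (Γ y e b)
  I_parallel : ∀ y ∈ U, chartCovEnd Γ I y = 0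
  J_parallel : ∀ y ∈ U, chartCovEnd Γ J y = 0
  K_parallel : ∀ y ∈ U, chartCovEnd Γ K y = 0

namespace HyperKahlerChart

variable {U : Set V} (C : HyperKahlerChart U)
include C

variable {C} in
theorem diffAt {F : Type*} [NormedAddCommGroup F] [NormedSpace ℝ F] {f : V → F}
    (hf : ContDiffOn ℝ ∞ f U) {y : V} (hy : y ∈ U) : DifferentiableAt ℝ f y :=
  (hf.contDiffAt (C.isOpen.mem_nhds hy)).differentiableAt (by simp)

theorem contDiffOn_chartCov {Y : V → V} (hY : ContDiffOn ℝ ∞ Y U) :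
    ContDiffOn ℝ ∞ (chartCov C.Γ Y) U := by
  refine (hY.fderiv_of_isOpen C.isOpen (by simp)).add ?_
  have h1 : ContDiffOn ℝ ∞ (fun y => (C.Γ y).flip) U :=
    (ContinuousLinearMap.flipₗᵢ ℝ V V V).toContinuousLinearEquiv.contDiff.comp_contDiffOn C.Γ_smooth
  exact h1.clm_apply hY

theorem fderiv_metric {X Z : V → V} {y : V} (hy : y ∈ U) (hX : DifferentiableAt ℝ X y)
    (hZ : DifferentiableAt ℝ Z y) (e : V) :
    fderiv ℝ (fun y => C.g y (X y) (Z y)) y e =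
      C.g y (chartCov C.Γ X y e) (Z y) + C.g y (X y) (chartCov C.Γ Z y e) := by
  have h1 := (C.diffAt C.g_smooth hy).hasFDerivAt
  have h2 := ((h1.clm_apply hX.hasFDerivAt).clm_apply hZ.hasFDerivAt).fderiv
  rw [h2]
  simp [C.metric y hy, chartCov_apply]
  ring

theorem chartCov_end {Q : V → V →L[ℝ] V} (hQ : ContDiffOn ℝ ∞ Q U)
    (hpar : ∀ y ∈ U, chartCovEnd C.Γ Q y = 0) {Y : V → V} {y : V} (hy : y ∈ U)
    (hY : DifferentiableAt ℝ Y y) :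
    chartCov C.Γ (fun y => Q y (Y y)) y = (Q y).comp (chartCov C.Γ Y y) := by
  ext1 e
  have h1 := ((C.diffAt hQ hy).hasFDerivAt.clm_apply hY.hasFDerivAt).fderiv
  have h2 := congrArg (fun A => A e (Y y)) (hpar y hy)
  simp only [chartCovEnd_apply, zero_apply] at h2
  rw [chartCov_apply, h1]
  simp only [chartCov_apply, ContinuousLinearMap.comp_apply, map_add, add_apply,
    ContinuousLinearMap.flip_apply]
  rw [← sub_eq_zero, ← h2]
  abel

theorem chartCovEnd_comp {Q : V → V →L[ℝ] V} (hQ : ContDiffOn ℝ ∞ Q U)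
    (hpar : ∀ y ∈ U, chartCovEnd C.Γ Q y = 0) {B : V → V →L[ℝ] V} {y : V} (hy : y ∈ U)
    (hB : DifferentiableAt ℝ B y) (e : V) :
    chartCovEnd C.Γ (fun y => (Q y).comp (B y)) y e = (Q y).comp (chartCovEnd C.Γ B y e) := by
  ext1 z
  have h1 := ((C.diffAt hQ hy).hasFDerivAt.clm_comp hB.hasFDerivAt).fderiv
  have h2 := congrArg (fun A => A e (B y z)) (hpar y hy)
  simp only [chartCovEnd_apply, zero_apply] at h2
  rw [chartCovEnd_apply, h1]
  simp only [chartCovEnd_apply, ContinuousLinearMap.comp_apply, map_add, map_sub, add_apply,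
    ContinuousLinearMap.flip_apply, ContinuousLinearMap.compL_apply]
  rw [← sub_eq_zero, ← h2]
  abel

/-- The Christoffel terms form a commutator, which has no trace; what remains is the derivative of
the trace, and this vanishes identically on `U`. -/
theorem trace_chartCovEnd [FiniteDimensional ℝ V] {B : V → V →L[ℝ] V} {y : V} (hy : y ∈ U)
    (hB : DifferentiableAt ℝ B y)
    (h0 : ∀ y ∈ U, LinearMap.trace ℝ V (B y : V →ₗ[ℝ] V) = 0) (e : V) :
    LinearMap.trace ℝ V (chartCovEnd C.Γ B y e : V →ₗ[ℝ] V) = 0 := by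
  let tr : (V →L[ℝ] V) →L[ℝ] ℝ := (LinearMap.trace ℝ V ∘ₗ
    (ContinuousLinearMap.coeLM ℝ : (V →L[ℝ] V) →ₗ[ℝ] V →ₗ[ℝ] V)).toContinuousLinearMap
  have h1 : (fun y => tr (B y)) =ᶠ[nhds y] fun _ => 0 := by
    filter_upwards [C.isOpen.mem_nhds hy] with x hx using h0 x hx
  have h2 : fderiv ℝ (tr ∘ B) y = fderiv ℝ (fun _ => (0 : ℝ)) y := h1.fderiv_eq
  rw [(tr.hasFDerivAt.comp y hB.hasFDerivAt).fderiv] at h2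
  have h3 : LinearMap.trace ℝ V (fderiv ℝ B y e : V →ₗ[ℝ] V) = 0 := by
    have h4 : tr (fderiv ℝ B y e) = 0 := by simpa using congrArg (fun L => L e) h2
    exact h4
  have h4 : (chartCovEnd C.Γ B y e : V →ₗ[ℝ] V) = (fderiv ℝ B y e : V →ₗ[ℝ] V) +
      ((C.Γ y e : V →ₗ[ℝ] V) * (B y : V →ₗ[ℝ] V) - (B y : V →ₗ[ℝ] V) * (C.Γ y e : V →ₗ[ℝ] V)) := by
    ext z
    simp [chartCovEnd_apply]
    abel
  rw [h4, map_add, map_sub, h3, LinearMap.trace_mul_comm]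
  simp

/-- The first Bianchi identity, in the form `d² = 0`. -/
theorem bianchi {Y : V → V} (hY : ContDiffOn ℝ ∞ Y U) {y : V} (hy : y ∈ U) (a b c : V) :
    C.g y (chartCovEnd C.Γ (chartCov C.Γ Y) y a b) c
        - C.g y (chartCovEnd C.Γ (chartCov C.Γ Y) y a c) b
      + (C.g y (chartCovEnd C.Γ (chartCov C.Γ Y) y b c) a
        - C.g y (chartCovEnd C.Γ (chartCov C.Γ Y) y b a) c)
      + (C.g y (chartCovEnd C.Γ (chartCov C.Γ Y) y c a) b
        - C.g y (chartCovEnd C.Γ (chartCov C.Γ Y) y c b) a) = 0 := by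
  set B := chartCov C.Γ Y with hB
  have hBs : ContDiffOn ℝ ∞ B U := C.contDiffOn_chartCov hY
  have hα : ∀ z, ContDiffOn ℝ ∞ (fun y => C.g y (Y y) z) U := fun z =>
    (C.g_smooth.clm_apply hY).clm_apply contDiffOn_const
  have hfd : ∀ x ∈ U, ∀ z e, fderiv ℝ (fun y => C.g y (Y y) z) x e =
      C.g x (B x e) z + C.g x (Y x) (C.Γ x e z) := fun x hx z e => by
    rw [C.fderiv_metric hx (C.diffAt hY hx) (differentiableAt_const z)]
    simp [chartCov_apply, hB]
  have hsym : ∀ z e e', fderiv ℝ (fderiv ℝ (fun y => C.g y (Y y) z)) y e e' =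
      fderiv ℝ (fderiv ℝ (fun y => C.g y (Y y) z)) y e' e := fun z e e' =>
    ((hα z).contDiffAt (C.isOpen.mem_nhds hy)).isSymmSndFDerivAt (by simp; norm_cast) e e'
  -- The exterior derivative of `⟨Y, ·⟩` is the skew part of `∇Y`: the Christoffel terms drop out
  -- because `Γ` is symmetric.
  have hcross : ∀ x ∈ U, ∀ e z, C.g x (B x e) z - C.g x (B x z) e =
      fderiv ℝ (fun y => C.g y (Y y) z) x e - fderiv ℝ (fun y => C.g y (Y y) e) x z :=
    fun x hx e z => by
      rw [hfd x hx, hfd x hx, C.Γ_symm x hx e z]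
      ring
  have hBe : ∀ e, DifferentiableAt ℝ (fun y => B y e) y := fun e =>
    (C.diffAt hBs hy).clm_apply (differentiableAt_const e)
  have hcovB : ∀ a e, chartCov C.Γ (fun y => B y e) y a =
      chartCovEnd C.Γ B y a e + B y (C.Γ y a e) := fun a e => by
    rw [chartCov_apply, chartCovEnd_apply]
    have := ((C.diffAt hBs hy).hasFDerivAt.clm_apply (hasFDerivAt_const e y)).fderiv
    rw [this]
    simp
  have hcovc : ∀ a e, chartCov C.Γ (fun _ => e) y a = C.Γ y a e := fun a e => by
    simp [chartCov_apply]
  have hD : ∀ a e z, C.g y (chartCovEnd C.Γ B y a e) z + C.g y (B y (C.Γ y a e)) z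
        + C.g y (B y e) (C.Γ y a z)
        - (C.g y (chartCovEnd C.Γ B y a z) e + C.g y (B y (C.Γ y a z)) e
          + C.g y (B y z) (C.Γ y a e)) =
      fderiv ℝ (fderiv ℝ (fun y => C.g y (Y y) z)) y a e
        - fderiv ℝ (fderiv ℝ (fun y => C.g y (Y y) e)) y a z := fun a e z => by
    have h1 : (fun x => C.g x (B x e) z - C.g x (B x z) e) =ᶠ[nhds y]
        fun x => fderiv ℝ (fun y => C.g y (Y y) z) x e - fderiv ℝ (fun y => C.g y (Y y) e) x z := by
      filter_upwards [C.isOpen.mem_nhds hy] with x hx using hcross x hx e z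
    have h2 := congrArg (fun L => L a) (h1.fderiv_eq (𝕜 := ℝ))
    have hdg : ∀ e z, DifferentiableAt ℝ (fun x => C.g x (B x e) z) y := fun e z =>
      ((C.diffAt C.g_smooth hy).clm_apply (hBe e)).clm_apply (differentiableAt_const z)
    have hd2 : ∀ z, DifferentiableAt ℝ (fderiv ℝ (fun y => C.g y (Y y) z)) y := fun z =>
      C.diffAt ((hα z).fderiv_of_isOpen C.isOpen (by simp)) hy
    have hd3 : ∀ z e, fderiv ℝ (fun x => fderiv ℝ (fun y => C.g y (Y y) z) x e) y a =
        fderiv ℝ (fderiv ℝ (fun y => C.g y (Y y) z)) y a e := fun z e => by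
      rw [((hd2 z).hasFDerivAt.clm_apply (hasFDerivAt_const e y)).fderiv]
      simp
    rw [fderiv_fun_sub (hdg e z) (hdg z e), fderiv_fun_sub
      ((hd2 z).clm_apply (differentiableAt_const e)) ((hd2 e).clm_apply (differentiableAt_const z))] at h2
    simp only [sub_apply, hd3] at h2
    rw [← h2, C.fderiv_metric hy (hBe e) (differentiableAt_const z),
      C.fderiv_metric hy (hBe z) (differentiableAt_const e), hcovB, hcovB, hcovc, hcovc]
    simp only [map_add, add_apply]
  -- In the cyclic sum the second derivatives cancel by symmetry, and the Christoffel terms cancel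
  -- by the symmetry of `Γ`.
  have k1 := hD a b c
  have k2 := hD b c a
  have k3 := hD c a b
  rw [hsym c a b] at k1
  rw [hsym a b c] at k2
  rw [hsym b c a] at k3
  rw [C.Γ_symm y hy a b, C.Γ_symm y hy a c] at k1
  rw [C.Γ_symm y hy b c] at k2
  linarith

/-- The Weitzenböck formula for a vector field that satisfies the Dirac equation. -/
theorem sum_chartCovEnd_frame_eq_zero [FiniteDimensional ℝ V] (hV : Module.finrank ℝ V = 4)
    {Y : V → V} (hY : ContDiffOn ℝ ∞ Y U)
    (h1 : ∀ y ∈ U, LinearMap.trace ℝ V (chartCov C.Γ Y y : V →ₗ[ℝ] V) = 0)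
    (hI : ∀ y ∈ U, LinearMap.trace ℝ V ((C.I y).comp (chartCov C.Γ Y y) : V →ₗ[ℝ] V) = 0)
    (hJ : ∀ y ∈ U, LinearMap.trace ℝ V ((C.J y).comp (chartCov C.Γ Y y) : V →ₗ[ℝ] V) = 0)
    (hK : ∀ y ∈ U, LinearMap.trace ℝ V ((C.K y).comp (chartCov C.Γ Y y) : V →ₗ[ℝ] V) = 0)
    {y : V} (hy : y ∈ U) (z : V) :
    ∑ a, chartCovEnd C.Γ (chartCov C.Γ Y) y (IsHermitianTriple.frame (C.I y) (C.J y) (C.K y) z a)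
      (IsHermitianTriple.frame (C.I y) (C.J y) (C.K y) z a) = 0 := by
  have hBs := C.contDiffOn_chartCov hY
  have hB := C.diffAt hBs hy
  -- For parallel `Q` one has `∇(QY) = Q ∘ ∇Y`. Trace conditions and the Bianchi identity applied to
  -- `QY` thus become statements about `Q ∘ ∇²Y`.
  have hQ : ∀ Q : V → V →L[ℝ] V, ContDiffOn ℝ ∞ Q U → (∀ y ∈ U, chartCovEnd C.Γ Q y = 0) →
      ((∀ y ∈ U, LinearMap.trace ℝ V ((Q y).comp (chartCov C.Γ Y y) : V →ₗ[ℝ] V) = 0) →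
      ∀ e, LinearMap.trace ℝ V ((Q y).comp (chartCovEnd C.Γ (chartCov C.Γ Y) y e) : V →ₗ[ℝ] V) = 0) ∧
      ∀ a b c, C.g y (Q y (chartCovEnd C.Γ (chartCov C.Γ Y) y a b)) c
        - C.g y (Q y (chartCovEnd C.Γ (chartCov C.Γ Y) y a c)) b
      + (C.g y (Q y (chartCovEnd C.Γ (chartCov C.Γ Y) y b c)) a
        - C.g y (Q y (chartCovEnd C.Γ (chartCov C.Γ Y) y b a)) c)
      + (C.g y (Q y (chartCovEnd C.Γ (chartCov C.Γ Y) y c a)) b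
        - C.g y (Q y (chartCovEnd C.Γ (chartCov C.Γ Y) y c b)) a) = 0 := fun Q hQs hQp => by
    have e1 := C.chartCovEnd_comp hQs hQp hy hB
    refine ⟨fun h e => ?_, fun a b c => ?_⟩
    · rw [← e1 e]
      exact C.trace_chartCovEnd hy ((C.diffAt hQs hy).clm_comp hB) h e
    · have e2 := C.bianchi (hQs.clm_apply hY) hy a b c
      have e3 : chartCovEnd C.Γ (chartCov C.Γ fun y => Q y (Y y)) y =
          chartCovEnd C.Γ (fun y => (Q y).comp (chartCov C.Γ Y y)) y := by
        have e4 : (chartCov C.Γ fun y => Q y (Y y)) =ᶠ[nhds y]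
            fun y => (Q y).comp (chartCov C.Γ Y y) := by
          filter_upwards [C.isOpen.mem_nhds hy] with x hx
          exact C.chartCov_end hQs hQp hx (C.diffAt hY hx)
        rw [chartCovEnd, chartCovEnd, e4.fderiv_eq, e4.self_of_nhds]
      simpa only [e3, e1, ContinuousLinearMap.comp_apply] using e2
  refine (C.triple y hy).sum_frame_eq_zero hV (C.trace_chartCovEnd hy hB h1)
    ((hQ C.I C.I_smooth C.I_parallel).1 hI) ((hQ C.J C.J_smooth C.J_parallel).1 hJ)
    ((hQ C.K C.K_smooth C.K_parallel).1 hK) (fun Q hQm a b c => ?_) z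
  simp only [List.mem_cons, List.not_mem_nil, or_false] at hQm
  rcases hQm with rfl | rfl | rfl | rfl
  · exact C.bianchi hY hy a b c
  · exact (hQ C.I C.I_smooth C.I_parallel).2 a b c
  · exact (hQ C.J C.J_smooth C.J_parallel).2 a b c
  · exact (hQ C.K C.K_smooth C.K_parallel).2 a b c

/-- Metric compatibility applied twice; the `Γ` term on the left turns the coordinate second
derivative into the Hessian of the connection. -/
theorem hessian_norm_sq {Y : V → V} (hY : ContDiffOn ℝ ∞ Y U) {y : V} (hy : y ∈ U) (e : V) :
    fderiv ℝ (fderiv ℝ fun y => C.g y (Y y) (Y y)) y e e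
        - fderiv ℝ (fun y => C.g y (Y y) (Y y)) y (C.Γ y e e) =
      2 * C.g y (chartCovEnd C.Γ (chartCov C.Γ Y) y e e) (Y y)
        + 2 * C.g y (chartCov C.Γ Y y e) (chartCov C.Γ Y y e) := by
  set B := chartCov C.Γ Y with hB
  have hBs : ContDiffOn ℝ ∞ B U := C.contDiffOn_chartCov hY
  have hu : ContDiffOn ℝ ∞ (fun y => C.g y (Y y) (Y y)) U := (C.g_smooth.clm_apply hY).clm_apply hY
  have hfd : ∀ x ∈ U, ∀ e, fderiv ℝ (fun y => C.g y (Y y) (Y y)) x e =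
      2 * C.g x (B x e) (Y x) := fun x hx e => by
    rw [C.fderiv_metric hx (C.diffAt hY hx) (C.diffAt hY hx), (C.triple x hx).symm (Y x)]
    ring
  have hBe : DifferentiableAt ℝ (fun y => B y e) y :=
    (C.diffAt hBs hy).clm_apply (differentiableAt_const e)
  have hcovB : chartCov C.Γ (fun y => B y e) y e =
      chartCovEnd C.Γ B y e e + B y (C.Γ y e e) := by
    rw [chartCov_apply, chartCovEnd_apply]
    have := ((C.diffAt hBs hy).hasFDerivAt.clm_apply (hasFDerivAt_const e y)).fderiv
    rw [this]
    simp
  have hd2 : DifferentiableAt ℝ (fderiv ℝ (fun y => C.g y (Y y) (Y y))) y :=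
    C.diffAt (hu.fderiv_of_isOpen C.isOpen (by simp)) hy
  have hd3 : fderiv ℝ (fun x => fderiv ℝ (fun y => C.g y (Y y) (Y y)) x e) y e =
      fderiv ℝ (fderiv ℝ (fun y => C.g y (Y y) (Y y))) y e e := by
    rw [(hd2.hasFDerivAt.clm_apply (hasFDerivAt_const e y)).fderiv]
    simp
  have h1 : (fun x => fderiv ℝ (fun y => C.g y (Y y) (Y y)) x e) =ᶠ[nhds y]
      fun x => 2 * C.g x (B x e) (Y x) := by
    filter_upwards [C.isOpen.mem_nhds hy] with x hx using hfd x hx e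
  have hdg : DifferentiableAt ℝ (fun x => C.g x (B x e) (Y x)) y :=
    ((C.diffAt C.g_smooth hy).clm_apply hBe).clm_apply (C.diffAt hY hy)
  rw [← hd3, h1.fderiv_eq, fderiv_const_mul hdg, hfd y hy]
  simp only [smul_apply, smul_eq_mul, C.fderiv_metric hy hBe (C.diffAt hY hy), hcovB, ← hB]
  simp only [map_add, add_apply]
  ring

end HyperKahlerChart

end ChartCalculus

/-! ### Tracing the tangential part of the Dirac equation. -/

section ChartDirac

variable {V : Type*} [NormedAddCommGroup V] [NormedSpace ℝ V]

/-- The Hessian of a function with respect to the connection with Christoffel symbols `Γ`. -/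
noncomputable def chartHess (Γ : V → V →L[ℝ] V →L[ℝ] V) (f : V → ℝ) (y e z : V) : ℝ :=
  fderiv ℝ (fderiv ℝ f) y e z - fderiv ℝ f y (Γ y e z)

namespace HyperKahlerChart

variable {U : Set V} (C : HyperKahlerChart U)
include C

theorem chartHess_symm {f : V → ℝ} (hf : ContDiffOn ℝ ∞ f U) {y : V} (hy : y ∈ U) (e z : V) :
    chartHess C.Γ f y e z = chartHess C.Γ f y z e := by
  have := (hf.contDiffAt (C.isOpen.mem_nhds hy)).isSymmSndFDerivAt (by simp; norm_cast) e z
  rw [chartHess, chartHess, this, C.Γ_symm y hy e z]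

omit C in
theorem chartHess_neg_right (Γ : V → V →L[ℝ] V →L[ℝ] V) (f : V → ℝ) (y e z : V) :
    chartHess Γ f y e (-z) = -chartHess Γ f y e z := by
  simp [chartHess]; ring

/-- As `Q` is parallel, its derivative can be traded for Christoffel terms, leaving the Hessian and
one term in `Γ y e z`. In `covariant_dirac` these last terms recombine into the undifferentiated
equation at the vector `Γ y e z` and disappear. -/
theorem fderiv_fderiv_end {Q : V → V →L[ℝ] V} (hQ : ContDiffOn ℝ ∞ Q U)
    (hpar : ∀ y ∈ U, chartCovEnd C.Γ Q y = 0) {f : V → ℝ} (hf : ContDiffOn ℝ ∞ f U) {y : V}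
    (hy : y ∈ U) (e z : V) :
    HasFDerivAt (fun x => fderiv ℝ f x (Q x z))
      (fderiv ℝ (fun x => fderiv ℝ f x (Q x z)) y) y ∧
    fderiv ℝ (fun x => fderiv ℝ f x (Q x z)) y e =
      chartHess C.Γ f y e (Q y z) + fderiv ℝ f y (Q y (C.Γ y e z)) := by
  have hf2 : DifferentiableAt ℝ (fderiv ℝ f) y :=
    C.diffAt (hf.fderiv_of_isOpen C.isOpen (by simp)) hy
  have hQz := (C.diffAt hQ hy).hasFDerivAt.clm_apply (hasFDerivAt_const z y)
  have h1 := hf2.hasFDerivAt.clm_apply hQz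
  refine ⟨h1.differentiableAt.hasFDerivAt, ?_⟩
  have h2 := congrArg (fun A => A e z) (hpar y hy)
  simp only [chartCovEnd_apply, zero_apply] at h2
  have h3 := congrArg (fderiv ℝ f y) h2
  simp only [map_sub, map_add, map_zero] at h3
  rw [h1.fderiv]
  simp [chartHess]
  linarith

omit C in
theorem chartCovEnd_id (Γ : V → V →L[ℝ] V →L[ℝ] V) (y : V) :
    chartCovEnd Γ (fun _ => ContinuousLinearMap.id ℝ V) y = 0 := by
  ext e z
  simp [chartCovEnd_apply]

/-- The covariant derivative of the tangential part of the Dirac equation. -/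
theorem covariant_dirac {W : V → V} {f a₀ a₁ a₂ : V → ℝ} (hW : ContDiffOn ℝ ∞ W U)
    (hf : ContDiffOn ℝ ∞ f U) (h₀ : ContDiffOn ℝ ∞ a₀ U) (h₁ : ContDiffOn ℝ ∞ a₁ U)
    (h₂ : ContDiffOn ℝ ∞ a₂ U)
    (heq : ∀ y ∈ U, ∀ z, C.g y (W y) z + fderiv ℝ f y z + fderiv ℝ a₀ y (C.K y z)
      + fderiv ℝ a₁ y (C.J y z) + fderiv ℝ a₂ y (C.I y z) = 0) {y : V} (hy : y ∈ U) (e z : V) :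
    C.g y (chartCov C.Γ W y e) z + chartHess C.Γ f y e z + chartHess C.Γ a₀ y e (C.K y z)
      + chartHess C.Γ a₁ y e (C.J y z) + chartHess C.Γ a₂ y e (C.I y z) = 0 := by
  have k0 := C.fderiv_fderiv_end (Q := fun _ => .id ℝ V) contDiffOn_const
    (fun _ _ => chartCovEnd_id _ _) hf hy e z
  have k1 := C.fderiv_fderiv_end C.K_smooth C.K_parallel h₀ hy e z
  have k2 := C.fderiv_fderiv_end C.J_smooth C.J_parallel h₁ hy e z
  have k3 := C.fderiv_fderiv_end C.I_smooth C.I_parallel h₂ hy e z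
  simp only [ContinuousLinearMap.id_apply] at k0
  have k4 := C.fderiv_metric hy (C.diffAt hW hy) (differentiableAt_const z) e
  have k5 : DifferentiableAt ℝ (fun x => C.g x (W x) z) y :=
    ((C.diffAt C.g_smooth hy).clm_apply (C.diffAt hW hy)).clm_apply (differentiableAt_const z)
  have k6 := (((k5.hasFDerivAt.add k0.1).add k1.1).add k2.1).add k3.1
  have k7 : HasFDerivAt (fun _ : V => (0 : ℝ)) _ y := k6.congr_of_eventuallyEq (by
    filter_upwards [C.isOpen.mem_nhds hy] with x hx using (heq x hx z).symm)
  have k8 := congrArg (fun L => L e) (k7.unique (hasFDerivAt_const 0 y))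
  simp only [add_apply, zero_apply, k0.2, k1.2, k2.2, k3.2, k4] at k8
  have k9 := heq y hy (C.Γ y e z)
  simp only [chartCov_apply, fderiv_fun_const, Pi.zero_apply, zero_apply, zero_add] at k8 ⊢
  linarith

/-- Summing the differentiated equation over pairs `(eᵢ, eᵢ)` of frame vectors pairs the symmetric
Hessians of `a₀, a₁, a₂` with the skew `K, J, I`, so only `f` survives. Over pairs `(eᵢ, J eᵢ)` only
`a₁` survives, because `J² = -1`. -/
theorem sum_chartHess_add_trace (hV : Module.finrank ℝ V = 4) {W : V → V} {f a₀ a₁ a₂ : V → ℝ}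
    (hW : ContDiffOn ℝ ∞ W U)
    (hf : ContDiffOn ℝ ∞ f U) (h₀ : ContDiffOn ℝ ∞ a₀ U) (h₁ : ContDiffOn ℝ ∞ a₁ U)
    (h₂ : ContDiffOn ℝ ∞ a₂ U)
    (heq : ∀ y ∈ U, ∀ z, C.g y (W y) z + fderiv ℝ f y z + fderiv ℝ a₀ y (C.K y z)
      + fderiv ℝ a₁ y (C.J y z) + fderiv ℝ a₂ y (C.I y z) = 0) {y : V} (hy : y ∈ U) (z : V) :
    C.g y z z * LinearMap.trace ℝ V (chartCov C.Γ W y : V →ₗ[ℝ] V) +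
      ∑ i, chartHess C.Γ f y (IsHermitianTriple.frame (C.I y) (C.J y) (C.K y) z i)
        (IsHermitianTriple.frame (C.I y) (C.J y) (C.K y) z i) = 0 ∧
    C.g y z z * LinearMap.trace ℝ V ((C.J y).comp (chartCov C.Γ W y) : V →ₗ[ℝ] V) +
      ∑ i, chartHess C.Γ a₁ y (IsHermitianTriple.frame (C.I y) (C.J y) (C.K y) z i)
        (IsHermitianTriple.frame (C.I y) (C.J y) (C.K y) z i) = 0 := by
  have H := C.triple y hy
  have key := C.covariant_dirac hW hf h₀ h₁ h₂ heq hy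
  rw [H.trace_frame hV, H.trace_frame hV]
  have s0 := fun e z => C.chartHess_symm h₀ hy e z
  have s1 := fun e z => C.chartHess_symm h₁ hy e z
  have s2 := fun e z => C.chartHess_symm h₂ hy e z
  have sf := fun e z => C.chartHess_symm hf hy e z
  constructor
  · have e0 := key z z
    have e1 := key (C.I y z) (C.I y z)
    have e2 := key (C.J y z) (C.J y z)
    have e3 := key (C.K y z) (C.K y z)
    simp only [IsHermitianTriple.frame, Fin.sum_univ_four, Matrix.cons_val,
      H.I_J, H.I_K, H.J_K, H.J_I, H.K_I, H.K_J, H.I_sq, H.J_sq, H.K_sq, chartHess_neg_right,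
      H.symm _ (chartCov _ _ _ _)] at e0 e1 e2 e3 ⊢
    rw [s0 (C.K y z) z, s1 (C.K y z) (C.I y z), s2 (C.K y z) (C.J y z)] at e3
    rw [s1 (C.J y z) z, s0 (C.J y z) (C.I y z)] at e2
    rw [s2 (C.I y z) z] at e1
    linarith
  · have e0 := key z (C.J y z)
    have e1 := key (C.I y z) (C.K y z)
    have e2 := key (C.J y z) z
    have e3 := key (C.K y z) (C.I y z)
    simp only [IsHermitianTriple.frame, Fin.sum_univ_four, Matrix.cons_val,
      H.I_J, H.I_K, H.J_K, H.J_I, H.K_I, H.K_J, H.I_sq, H.J_sq, H.K_sq, chartHess_neg_right,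
      ContinuousLinearMap.comp_apply, H.symm _ (C.J y (chartCov _ _ _ _)),
      H.J_skew, map_neg] at e0 e1 e2 e3 ⊢
    rw [sf (C.K y z) (C.I y z), s2 (C.K y z) z] at e3
    rw [sf (C.J y z) z, s0 (C.J y z) (C.K y z), s2 (C.J y z) (C.I y z)] at e2
    rw [s0 (C.I y z) z] at e1
    linarith

end HyperKahlerChart

end ChartDirac

/-! ### The Dirac equation on the plane times a chart; harmonicity of its scalar components. -/

section ProductDirac

variable {P V : Type*} [NormedAddCommGroup P] [NormedSpace ℝ P]
  [NormedAddCommGroup V] [NormedSpace ℝ V]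

section Slices

variable {F : Type*} [NormedAddCommGroup F] [NormedSpace ℝ F] {U : Set V} {f : P × V → F}

theorem contDiffOn_slice (hf : ContDiffOn ℝ ∞ f (Set.univ ×ˢ U)) (p : P) :
    ContDiffOn ℝ ∞ (fun y => f (p, y)) U :=
  hf.comp (contDiffOn_const.prodMk contDiffOn_id) fun _ hy => ⟨trivial, hy⟩

theorem isOpen_univ_prod (hU : IsOpen U) : IsOpen ((Set.univ : Set P) ×ˢ U) :=
  isOpen_univ.prod hU

theorem contDiffOn_partialDeriv (hU : IsOpen U) (hf : ContDiffOn ℝ ∞ f (Set.univ ×ˢ U))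
    (w : P × V) : ContDiffOn ℝ ∞ (fun q => fderiv ℝ f q w) (Set.univ ×ˢ U) :=
  (hf.fderiv_of_isOpen (isOpen_univ_prod hU) (by simp)).clm_apply contDiffOn_const

theorem hasFDerivAt_of_mem_prod (hU : IsOpen U) (hf : ContDiffOn ℝ ∞ f (Set.univ ×ˢ U)) {q : P × V}
    (hq : q.2 ∈ U) : HasFDerivAt f (fderiv ℝ f q) q :=
  ((hf.contDiffAt ((isOpen_univ_prod hU).mem_nhds ⟨trivial, hq⟩)).differentiableAt
    (by simp)).hasFDerivAt

theorem fderiv_slice (hU : IsOpen U) (hf : ContDiffOn ℝ ∞ f (Set.univ ×ˢ U)) {p : P} {y : V}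
    (hy : y ∈ U) (z : V) : fderiv ℝ (fun y => f (p, y)) y z = fderiv ℝ f (p, y) (0, z) := by
  have h1 : HasFDerivAt (fun y : V => (p, y)) (ContinuousLinearMap.inr ℝ P V) y :=
    hasFDerivAt_prodMk_right p y
  have h2 := ((hasFDerivAt_of_mem_prod hU hf (q := (p, y)) hy).comp y h1).fderiv
  exact congrArg (fun L => L z) h2

theorem fderiv_partialDeriv (hU : IsOpen U) (hf : ContDiffOn ℝ ∞ f (Set.univ ×ˢ U)) {q : P × V}
    (hq : q.2 ∈ U) (w w' : P × V) :
    fderiv ℝ (fun q => fderiv ℝ f q w) q w' = fderiv ℝ (fderiv ℝ f) q w' w := by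
  have h1 := hasFDerivAt_of_mem_prod hU (hf.fderiv_of_isOpen (isOpen_univ_prod hU) (by simp)) hq
  rw [(h1.clm_apply (hasFDerivAt_const w q)).fderiv]
  simp

theorem fderiv_fderiv_symm (hU : IsOpen U) (hf : ContDiffOn ℝ ∞ f (Set.univ ×ˢ U)) {q : P × V}
    (hq : q.2 ∈ U) (w w' : P × V) :
    fderiv ℝ (fderiv ℝ f) q w' w = fderiv ℝ (fderiv ℝ f) q w w' :=
  (hf.contDiffAt ((isOpen_univ_prod hU).mem_nhds ⟨trivial, hq⟩)).isSymmSndFDerivAt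
    (by simp; norm_cast) w' w

theorem fderiv_fderiv_slice (hU : IsOpen U) (hf : ContDiffOn ℝ ∞ f (Set.univ ×ˢ U)) {p : P} {y : V}
    (hy : y ∈ U) (z z' : V) : fderiv ℝ (fderiv ℝ fun y => f (p, y)) y z z' =
      fderiv ℝ (fderiv ℝ f) (p, y) (0, z) (0, z') := by
  have h0 := contDiffOn_slice hf p
  have h1 : DifferentiableAt ℝ (fderiv ℝ fun y => f (p, y)) y :=
    ((h0.fderiv_of_isOpen hU (m := ∞) (by simp)).contDiffAt (hU.mem_nhds hy)).differentiableAt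
      (by simp)
  have h2 : fderiv ℝ (fun y => fderiv ℝ (fun y => f (p, y)) y z') y z =
      fderiv ℝ (fderiv ℝ fun y => f (p, y)) y z z' := by
    rw [(h1.hasFDerivAt.clm_apply (hasFDerivAt_const z' y)).fderiv]
    simp
  have h3 : (fun y => fderiv ℝ (fun y => f (p, y)) y z') =ᶠ[nhds y]
      fun y => fderiv ℝ f (p, y) (0, z') := by
    filter_upwards [hU.mem_nhds hy] with x hx using fderiv_slice hU hf hx z'
  rw [← h2, h3.fderiv_eq, fderiv_slice hU (contDiffOn_partialDeriv hU hf _) hy,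
    fderiv_partialDeriv hU hf hy]

theorem hasDerivAt_line (hU : IsOpen U) (hf : ContDiffOn ℝ ∞ f (Set.univ ×ˢ U)) {p : P} {y : V}
    (hy : y ∈ U) (w : P) :
    HasDerivAt (fun t : ℝ => f (p + t • w, y)) (fderiv ℝ f (p, y) (w, 0)) 0 := by
  have h1 : HasDerivAt (fun t : ℝ => (p + t • w, y)) (w, 0) 0 := by
    have := ((hasDerivAt_id (0 : ℝ)).smul_const w).const_add p
    simp only [one_smul] at this
    exact this.prodMk (hasDerivAt_const _ _)
  have h2 : HasFDerivAt f (fderiv ℝ f (p, y)) (p + (0 : ℝ) • w, y) := by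
    simpa using hasFDerivAt_of_mem_prod hU hf (q := (p, y)) hy
  exact h2.comp_hasDerivAt (0 : ℝ) h1

end Slices

namespace HyperKahlerChart

variable {U : Set V} (C : HyperKahlerChart U)
include C

/-- The connection on `M` does not depend on the torus variable and mixed partials commute, so torus
derivatives commute with `∇`. -/
theorem hasDerivAt_chartCov_line {Y : P × V → V} (hY : ContDiffOn ℝ ∞ Y (Set.univ ×ˢ U)) {p : P}
    {y : V} (hy : y ∈ U) (w : P) :
    HasDerivAt (fun t : ℝ => chartCov C.Γ (fun y => Y (p + t • w, y)) y)
      (chartCov C.Γ (fun y => fderiv ℝ Y (p, y) (w, 0)) y) 0 := by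
  have h1 := hasDerivAt_line C.isOpen hY hy (p := p) w
  have h2 := hasDerivAt_line C.isOpen
    (hY.fderiv_of_isOpen (isOpen_univ_prod C.isOpen) (by simp)) hy (p := p) w
  have h3 := (h2.clm_comp (hasDerivAt_const (0 : ℝ) (ContinuousLinearMap.inr ℝ P V))).add
    ((C.Γ y).flip.hasFDerivAt.comp_hasDerivAt (0 : ℝ) h1)
  refine (h3.congr_of_eventuallyEq (.of_forall fun t => ?_)).congr_deriv ?_
  · ext z
    simp [chartCov_apply, fderiv_slice C.isOpen hY hy]
  · ext z
    simp [chartCov_apply, fderiv_slice C.isOpen (contDiffOn_partialDeriv C.isOpen hY (w, 0)) hy,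
      fderiv_partialDeriv C.isOpen hY (q := (p, y)) hy,
      fderiv_fderiv_symm C.isOpen hY (q := (p, y)) hy (w, 0) (0, z)]

theorem hasDerivAt_trace_chartCov_line [FiniteDimensional ℝ V] {Y : P × V → V}
    (hY : ContDiffOn ℝ ∞ Y (Set.univ ×ˢ U)) {p : P}
    {y : V} (hy : y ∈ U) (w : P) (Q : V →L[ℝ] V) :
    HasDerivAt (fun t : ℝ => LinearMap.trace ℝ V
        (Q.comp (chartCov C.Γ (fun y => Y (p + t • w, y)) y) : V →ₗ[ℝ] V))
      (LinearMap.trace ℝ V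
        (Q.comp (chartCov C.Γ (fun y => fderiv ℝ Y (p, y) (w, 0)) y) : V →ₗ[ℝ] V)) 0 := by
  let tr : (V →L[ℝ] V) →L[ℝ] ℝ := (LinearMap.trace ℝ V ∘ₗ
    (ContinuousLinearMap.coeLM ℝ : (V →L[ℝ] V) →ₗ[ℝ] V →ₗ[ℝ] V)).toContinuousLinearMap
  exact ((tr.comp (ContinuousLinearMap.compL ℝ V V V Q)).hasFDerivAt).comp_hasDerivAt (0 : ℝ)
    (C.hasDerivAt_chartCov_line hY hy w)

/-- The components of the Dirac equation on the product of a surface with a hyper-Kähler chart. -/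
structure IsDiracSolution (u v : P) (f a₀ a₁ a₂ : P × V → ℝ) (Y : P × V → V) : Prop where
  f_smooth : ContDiffOn ℝ ∞ f (Set.univ ×ˢ U)
  a₀_smooth : ContDiffOn ℝ ∞ a₀ (Set.univ ×ˢ U)
  a₁_smooth : ContDiffOn ℝ ∞ a₁ (Set.univ ×ˢ U)
  a₂_smooth : ContDiffOn ℝ ∞ a₂ (Set.univ ×ˢ U)
  Y_smooth : ContDiffOn ℝ ∞ Y (Set.univ ×ˢ U)
  tangent : ∀ p, ∀ y ∈ U, ∀ z,
    C.g y (C.J y (fderiv ℝ Y (p, y) (u, 0)) + C.I y (fderiv ℝ Y (p, y) (v, 0))) z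
      + fderiv ℝ (fun y => f (p, y)) y z + fderiv ℝ (fun y => a₀ (p, y)) y (C.K y z)
      + fderiv ℝ (fun y => a₁ (p, y)) y (C.J y z) + fderiv ℝ (fun y => a₂ (p, y)) y (C.I y z) = 0
  real : ∀ p, ∀ y ∈ U, fderiv ℝ a₁ (p, y) (u, 0) + fderiv ℝ a₂ (p, y) (v, 0)
    + LinearMap.trace ℝ V (chartCov C.Γ (fun y => Y (p, y)) y : V →ₗ[ℝ] V) = 0
  normal : ∀ p, ∀ y ∈ U, fderiv ℝ a₂ (p, y) (u, 0) - fderiv ℝ a₁ (p, y) (v, 0)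
    - LinearMap.trace ℝ V ((C.K y).comp (chartCov C.Γ (fun y => Y (p, y)) y) : V →ₗ[ℝ] V) = 0
  first : ∀ p, ∀ y ∈ U, fderiv ℝ f (p, y) (u, 0) + fderiv ℝ a₀ (p, y) (v, 0)
    - LinearMap.trace ℝ V ((C.J y).comp (chartCov C.Γ (fun y => Y (p, y)) y) : V →ₗ[ℝ] V) = 0
  second : ∀ p, ∀ y ∈ U, fderiv ℝ f (p, y) (v, 0) - fderiv ℝ a₀ (p, y) (u, 0)
    - LinearMap.trace ℝ V ((C.I y).comp (chartCov C.Γ (fun y => Y (p, y)) y) : V →ₗ[ℝ] V) = 0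

variable {C}

/-- With `W = J Y_u + I Y_v`, parallelism gives `tr ∇W = tr J∇Y_u + tr I∇Y_v`. The torus derivatives
of `first` and `second` evaluate these traces as `f_uu + a₀_uv` and `f_vv - a₀_uv`, and the mixed
terms cancel. For `a₁` the same happens to `tr J∇W = -tr ∇Y_u - tr K∇Y_v`, with `real` and `normal`.
-/
theorem IsDiracSolution.harmonic [FiniteDimensional ℝ V] (hV : Module.finrank ℝ V = 4)
    {u v : P} {f a₀ a₁ a₂ : P × V → ℝ} {Y : P × V → V}
    (S : C.IsDiracSolution u v f a₀ a₁ a₂ Y) {p : P} {y : V} (hy : y ∈ U) (z : V) :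
    C.g y z z * (fderiv ℝ (fderiv ℝ f) (p, y) (u, 0) (u, 0)
        + fderiv ℝ (fderiv ℝ f) (p, y) (v, 0) (v, 0)) +
      ∑ i, chartHess C.Γ (fun y => f (p, y)) y
        (IsHermitianTriple.frame (C.I y) (C.J y) (C.K y) z i)
        (IsHermitianTriple.frame (C.I y) (C.J y) (C.K y) z i) = 0 ∧
    C.g y z z * (fderiv ℝ (fderiv ℝ a₁) (p, y) (u, 0) (u, 0)
        + fderiv ℝ (fderiv ℝ a₁) (p, y) (v, 0) (v, 0)) +
      ∑ i, chartHess C.Γ (fun y => a₁ (p, y)) y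
        (IsHermitianTriple.frame (C.I y) (C.J y) (C.K y) z i)
        (IsHermitianTriple.frame (C.I y) (C.J y) (C.K y) z i) = 0 := by
  have H := C.triple y hy
  have hU := C.isOpen
  set Yu : V → V := fun y => fderiv ℝ Y (p, y) (u, 0) with hYu
  set Yv : V → V := fun y => fderiv ℝ Y (p, y) (v, 0) with hYv
  have hYus : ContDiffOn ℝ ∞ Yu U :=
    contDiffOn_slice (contDiffOn_partialDeriv hU S.Y_smooth (u, 0)) p
  have hYvs : ContDiffOn ℝ ∞ Yv U :=
    contDiffOn_slice (contDiffOn_partialDeriv hU S.Y_smooth (v, 0)) p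
  have hW : ContDiffOn ℝ ∞ (fun y => C.J y (Yu y) + C.I y (Yv y)) U :=
    (C.J_smooth.clm_apply hYus).add (C.I_smooth.clm_apply hYvs)
  have hcovW : chartCov C.Γ (fun y => C.J y (Yu y) + C.I y (Yv y)) y =
      (C.J y).comp (chartCov C.Γ Yu y) + (C.I y).comp (chartCov C.Γ Yv y) := by
    rw [← C.chartCov_end C.J_smooth C.J_parallel hy (C.diffAt hYus hy),
      ← C.chartCov_end C.I_smooth C.I_parallel hy (C.diffAt hYvs hy)]
    ext e
    rw [chartCov_apply, fderiv_fun_add (C.diffAt (C.J_smooth.clm_apply hYus) hy)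
      (C.diffAt (C.I_smooth.clm_apply hYvs) hy)]
    simp only [chartCov_apply, add_apply, map_add]
    abel
  have key := C.sum_chartHess_add_trace hV hW (contDiffOn_slice S.f_smooth p)
    (contDiffOn_slice S.a₀_smooth p) (contDiffOn_slice S.a₁_smooth p)
    (contDiffOn_slice S.a₂_smooth p) (S.tangent p) hy z
  have tr1 : LinearMap.trace ℝ V (chartCov C.Γ (fun y => C.J y (Yu y) + C.I y (Yv y)) y : V →ₗ[ℝ] V) =
      LinearMap.trace ℝ V ((C.J y).comp (chartCov C.Γ Yu y) : V →ₗ[ℝ] V) +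
      LinearMap.trace ℝ V ((C.I y).comp (chartCov C.Γ Yv y) : V →ₗ[ℝ] V) := by
    rw [hcovW, ← map_add]; rfl
  have tr2 : LinearMap.trace ℝ V
        ((C.J y).comp (chartCov C.Γ (fun y => C.J y (Yu y) + C.I y (Yv y)) y) : V →ₗ[ℝ] V) =
      -LinearMap.trace ℝ V (chartCov C.Γ Yu y : V →ₗ[ℝ] V) -
      LinearMap.trace ℝ V ((C.K y).comp (chartCov C.Γ Yv y) : V →ₗ[ℝ] V) := by
    rw [hcovW, ← map_neg, ← map_sub]
    congr 1
    ext e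
    simp [H.J_sq, H.J_I, sub_eq_add_neg]
  have hd : ∀ {φ : P × V → ℝ} (_ : ContDiffOn ℝ ∞ φ (Set.univ ×ˢ U)) (w w' : P),
      HasDerivAt (fun t : ℝ => fderiv ℝ φ (p + t • w, y) (w', 0))
        (fderiv ℝ (fderiv ℝ φ) (p, y) (w, 0) (w', 0)) 0 := fun hφ w w' => by
    rw [← fderiv_partialDeriv hU hφ hy]
    exact hasDerivAt_line hU (contDiffOn_partialDeriv hU hφ (w', 0)) hy w
  have hz : ∀ {F : ℝ → ℝ} {d : ℝ}, HasDerivAt F d 0 → (∀ t, F t = 0) → d = 0 := fun hF h0 => by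
    have : HasDerivAt (fun _ : ℝ => (0 : ℝ)) _ 0 :=
      hF.congr_of_eventuallyEq (.of_forall fun t => (h0 t).symm)
    exact this.unique (hasDerivAt_const _ _)
  have eu := fun Q => C.hasDerivAt_trace_chartCov_line S.Y_smooth (p := p) hy u Q
  have ev := fun Q => C.hasDerivAt_trace_chartCov_line S.Y_smooth (p := p) hy v Q
  have d1 := hz (((hd S.f_smooth u u).add (hd S.a₀_smooth u v)).sub (eu (C.J y)))
    fun t => S.first _ y hy
  have d2 := hz (((hd S.f_smooth v v).sub (hd S.a₀_smooth v u)).sub (ev (C.I y)))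
    fun t => S.second _ y hy
  have d3 := hz (((hd S.a₁_smooth u u).add (hd S.a₂_smooth u v)).add (eu (.id ℝ V)))
    fun t => by simpa using S.real (p + t • u) y hy
  have d4 := hz (((hd S.a₂_smooth v u).sub (hd S.a₁_smooth v v)).sub (ev (C.K y)))
    fun t => S.normal _ y hy
  rw [fderiv_fderiv_symm hU S.a₀_smooth (q := (p, y)) hy (v, 0) (u, 0)] at d1
  rw [fderiv_fderiv_symm hU S.a₂_smooth (q := (p, y)) hy (v, 0) (u, 0)] at d3
  simp only [ContinuousLinearMap.id_comp] at d3
  rw [tr1, tr2] at key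
  constructor
  · linear_combination key.1 + C.g y z z * (d1 + d2)
  · linear_combination key.2 + C.g y z z * (d3 - d4)

end HyperKahlerChart

end ProductDirac

/-! ### The maximum principle for harmonic functions and the Bochner argument in a chart. -/

section ChartMaximumPrinciple

variable {P V : Type*} [NormedAddCommGroup P] [NormedSpace ℝ P] [FiniteDimensional ℝ P]
  [NormedAddCommGroup V] [NormedSpace ℝ V] [FiniteDimensional ℝ V]

namespace HyperKahlerChart

variable {U : Set V} (C : HyperKahlerChart U)

/-- The orthogonal frame `z, I z, J z, K z` of a hyper-Kähler chart. -/
noncomputable def frame (z : V) (i : Fin 4) (y : V) : V :=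
  IsHermitianTriple.frame (C.I y) (C.J y) (C.K y) z i

theorem continuousOn_frame (z : V) (i : Fin 4) : ContinuousOn (C.frame z i) U := by
  have hI := C.I_smooth.continuousOn.clm_apply (continuousOn_const (c := z))
  have hJ := C.J_smooth.continuousOn.clm_apply (continuousOn_const (c := z))
  have hK := C.K_smooth.continuousOn.clm_apply (continuousOn_const (c := z))
  fin_cases i
  · exact continuousOn_const
  · exact hI
  · exact hJ
  · exact hK

/-- The first order part of the Laplacian in a hyper-Kähler chart. -/
noncomputable def drift (z : V) (y : V) : V := -∑ i, C.Γ y (C.frame z i y) (C.frame z i y)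

theorem continuousOn_drift (z : V) : ContinuousOn (C.drift z) U :=
  (continuousOn_finsetSum _ fun i _ => (C.Γ_smooth.continuousOn.clm_apply
    (C.continuousOn_frame z i)).clm_apply (C.continuousOn_frame z i)).neg

/-- Ellipticity of the frame Laplacian, in the form required by the maximum principle. -/
theorem eq_zero_of_frame (hV : Module.finrank ℝ V = 4) {z : V} (hz : z ≠ 0) {y : V} (hy : y ∈ U)
    {ℓ : V →L[ℝ] ℝ} (h : ∀ i, ℓ (C.frame z i y) = 0) : ℓ = 0 := by
  ext x
  have h1 := congrArg ℓ ((C.triple y hy).frame_expansion hV z x)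
  simp only [map_sum, map_smul] at h1
  change _ = ∑ a, _ • ℓ (C.frame z a y) at h1
  simp only [h, smul_eq_mul, mul_zero, Finset.sum_const_zero] at h1
  exact (mul_eq_zero.1 h1).resolve_left ((C.triple y hy).pos z hz).ne'

theorem sum_chartHess_frame (f : V → ℝ) (z y : V) :
    ∑ i, chartHess C.Γ f y (C.frame z i y) (C.frame z i y) =
      secondOrderOp (C.frame z) (C.drift z) f y := by
  simp [secondOrderOp, chartHess, drift, Finset.sum_sub_distrib]
  ring

theorem exists_ne_zero_of_finrank (hV : Module.finrank ℝ V = 4) : ∃ z : V, z ≠ 0 := by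
  have : Nontrivial V := Module.nontrivial_of_finrank_pos (R := ℝ) (by omega)
  exact exists_ne 0

/-- A function on the product of a surface and a hyper-Kähler chart that is harmonic for the product
metric is constant near a maximum. -/
theorem eventually_const_of_harmonic (hV : Module.finrank ℝ V = 4) {u v : P}
    (hP : ∀ ℓ : P →L[ℝ] ℝ, ℓ u = 0 → ℓ v = 0 → ℓ = 0) {f : P × V → ℝ}
    (hf : ContDiffOn ℝ ∞ f (Set.univ ×ˢ U))
    (hh : ∀ p, ∀ y ∈ U, ∀ z, C.g y z z * (fderiv ℝ (fderiv ℝ f) (p, y) (u, 0) (u, 0)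
        + fderiv ℝ (fderiv ℝ f) (p, y) (v, 0) (v, 0)) +
      ∑ i, chartHess C.Γ (fun y => f (p, y)) y (C.frame z i y) (C.frame z i y) = 0)
    {p₀ : P} {y₀ : V} (hy₀ : y₀ ∈ U) (hmax : ∀ p, ∀ y ∈ U, f (p, y) ≤ f (p₀, y₀)) :
    ∀ᶠ q in nhds (p₀, y₀), f q = f (p₀, y₀) := by
  obtain ⟨z, hz⟩ := exists_ne_zero_of_finrank hV
  have hU := isOpen_univ_prod (P := P) C.isOpen
  -- The frame on `M` has length `√(g z z)`. Scaling the torus directions by this length makes the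
  -- operator `g z z` times the product Laplacian.
  let fr : Fin 2 ⊕ Fin 4 → P × V → P × V := Sum.elim
    (fun i q => (√(C.g q.2 z z) • (![u, v] i : P), (0 : V))) (fun i q => ((0 : P), C.frame z i q.2))
  let dr : P × V → P × V := fun q => (0, C.drift z q.2)
  have hsnd : ContinuousOn (Prod.snd : P × V → V) (Set.univ ×ˢ U) := continuousOn_snd
  have hmaps : Set.MapsTo (Prod.snd : P × V → V) (Set.univ ×ˢ U) U := fun q hq => hq.2
  refine strong_maximum_principle hU (v := fr) (β := dr)
    (hf.of_le (by norm_cast)) ?_ ?_ ?_ ?_ ⟨trivial, hy₀⟩ fun q hq => hmax q.1 q.2 hq.2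
  · rintro (i | i)
    · have h1 : ContinuousOn (fun y => C.g y z z) U :=
        (C.g_smooth.continuousOn.clm_apply continuousOn_const).clm_apply continuousOn_const
      exact (((h1.comp hsnd hmaps).sqrt).smul continuousOn_const).prodMk continuousOn_const
    · exact continuousOn_const.prodMk ((C.continuousOn_frame z i).comp hsnd hmaps)
  · exact continuousOn_const.prodMk ((C.continuousOn_drift z).comp hsnd hmaps)
  · intro q hq ℓ hℓ
    have hpos : 0 < √(C.g q.2 z z) := Real.sqrt_pos.2 ((C.triple q.2 hq.2).pos z hz)
    have h1 : ℓ.comp (ContinuousLinearMap.inl ℝ P V) = 0 := by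
      have hi : ∀ i : Fin 2, ℓ.comp (ContinuousLinearMap.inl ℝ P V) (![u, v] i) = 0 := fun i => by
        have h2 := hℓ (Sum.inl i)
        have h3 : fr (Sum.inl i) q = √(C.g q.2 z z) • ((![u, v] i : P), (0 : V)) := by simp [fr]
        rw [h3, map_smul] at h2
        exact (smul_eq_zero.1 h2).resolve_left hpos.ne'
      exact hP _ (hi 0) (hi 1)
    have h2 : ℓ.comp (ContinuousLinearMap.inr ℝ P V) = 0 :=
      C.eq_zero_of_frame hV hz hq.2 fun i => hℓ (Sum.inr i)
    ext x
    · exact congrArg (fun L => L x) h1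
    · exact congrArg (fun L => L x) h2
  · rintro ⟨p, y⟩ ⟨-, hy⟩
    have hy : y ∈ U := hy
    have h1 := hh p y hy z
    have hn : √(C.g y z z) * √(C.g y z z) = C.g y z z :=
      Real.mul_self_sqrt ((C.triple y hy).nonneg z)
    have hleft : ∀ w : P, fderiv ℝ (fderiv ℝ f) (p, y) (√(C.g y z z) • w, 0) (√(C.g y z z) • w, 0) =
        C.g y z z * fderiv ℝ (fderiv ℝ f) (p, y) (w, 0) (w, 0) := fun w => by
      have h3 : ((√(C.g y z z) • w, 0) : P × V) = √(C.g y z z) • (w, 0) := by simp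
      rw [h3, map_smul, map_smul, smul_apply, smul_smul, hn, smul_eq_mul]
    refine (h1.symm.trans ?_).le
    rw [C.sum_chartHess_frame]
    simp only [secondOrderOp, Fintype.sum_sum_type, fr, dr, Sum.elim_inl, Sum.elim_inr,
      Fin.sum_univ_two, Matrix.cons_val_zero, Matrix.cons_val_one, hleft,
      fderiv_fderiv_slice C.isOpen hf hy, fderiv_slice C.isOpen hf hy]
    ring

section Norm

variable {Y : V → V} (hV : Module.finrank ℝ V = 4) (hY : ContDiffOn ℝ ∞ Y U)
    (h1 : ∀ y ∈ U, LinearMap.trace ℝ V (chartCov C.Γ Y y : V →ₗ[ℝ] V) = 0)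
    (hI : ∀ y ∈ U, LinearMap.trace ℝ V ((C.I y).comp (chartCov C.Γ Y y) : V →ₗ[ℝ] V) = 0)
    (hJ : ∀ y ∈ U, LinearMap.trace ℝ V ((C.J y).comp (chartCov C.Γ Y y) : V →ₗ[ℝ] V) = 0)
    (hK : ∀ y ∈ U, LinearMap.trace ℝ V ((C.K y).comp (chartCov C.Γ Y y) : V →ₗ[ℝ] V) = 0)
include hV hY h1 hI hJ hK

/-- The Bochner formula `Δ|Y|² = 2|∇Y|²`. -/
theorem bochner {y : V} (hy : y ∈ U) (z : V) :
    secondOrderOp (C.frame z) (C.drift z) (fun y => C.g y (Y y) (Y y)) y =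
      2 * ∑ i, C.g y (chartCov C.Γ Y y (C.frame z i y)) (chartCov C.Γ Y y (C.frame z i y)) := by
  have h2 := congrArg (fun x => C.g y x (Y y))
    (C.sum_chartCovEnd_frame_eq_zero hV hY h1 hI hJ hK hy z)
  simp only [map_sum, map_zero, zero_apply, sum_apply] at h2
  rw [← C.sum_chartHess_frame]
  simp only [chartHess, C.hessian_norm_sq hY hy]
  rw [Finset.sum_add_distrib, ← Finset.mul_sum, ← Finset.mul_sum]
  change 2 * (∑ i, C.g y (chartCovEnd C.Γ (chartCov C.Γ Y) y (IsHermitianTriple.frame _ _ _ z i)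
    (IsHermitianTriple.frame _ _ _ z i)) (Y y)) + _ = _
  rw [h2]
  ring

/-- By `bochner` the squared norm is subharmonic, so the strong maximum principle applies. -/
theorem eventually_norm_sq_const {y₀ : V} (hy₀ : y₀ ∈ U)
    (hmax : ∀ y ∈ U, C.g y (Y y) (Y y) ≤ C.g y₀ (Y y₀) (Y y₀)) :
    ∀ᶠ y in nhds y₀, C.g y (Y y) (Y y) = C.g y₀ (Y y₀) (Y y₀) := by
  obtain ⟨z, hz⟩ := exists_ne_zero_of_finrank hV
  refine strong_maximum_principle C.isOpen (v := C.frame z) (β := C.drift z)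
    (w := fun y => C.g y (Y y) (Y y))
    (((C.g_smooth.clm_apply hY).clm_apply hY).of_le (by norm_cast)) (C.continuousOn_frame z)
    (C.continuousOn_drift z) (fun y hy ℓ => C.eq_zero_of_frame hV hz hy) (fun y hy => ?_) hy₀ hmax
  rw [C.bochner hV hY h1 hI hJ hK hy]
  exact mul_nonneg two_pos.le (Finset.sum_nonneg fun i _ => (C.triple y hy).nonneg _)

/-- Where `|Y|²` is locally constant, the left side of `bochner` is zero, so `∇Y` kills every frame
vector. -/
theorem chartCov_eq_zero_of_norm_sq_const {y₀ : V} (hy₀ : y₀ ∈ U) {c : ℝ}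
    (hc : ∀ᶠ y in nhds y₀, C.g y (Y y) (Y y) = c) : chartCov C.Γ Y y₀ = 0 := by
  obtain ⟨z, hz⟩ := exists_ne_zero_of_finrank hV
  have h2 := C.bochner hV hY h1 hI hJ hK hy₀ z
  have h3 : (fun y => C.g y (Y y) (Y y)) =ᶠ[nhds y₀] fun _ => c := hc
  have h4 : secondOrderOp (C.frame z) (C.drift z) (fun y => C.g y (Y y) (Y y)) y₀ = 0 := by
    simp [secondOrderOp, h3.fderiv.fderiv_eq, h3.fderiv_eq]
  rw [h4] at h2
  have H := C.triple y₀ hy₀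
  have h5 : ∑ i, C.g y₀ (chartCov C.Γ Y y₀ (C.frame z i y₀)) (chartCov C.Γ Y y₀ (C.frame z i y₀)) = 0 := by
    linarith
  rw [Finset.sum_eq_zero_iff_of_nonneg fun i _ => H.nonneg _] at h5
  have h6 : ∀ i, chartCov C.Γ Y y₀ (C.frame z i y₀) = 0 := fun i => by
    by_contra hne
    exact (H.pos _ hne).ne' (h5 i (Finset.mem_univ i))
  ext x
  have h7 := congrArg (chartCov C.Γ Y y₀) (H.frame_expansion hV z x)
  simp only [map_sum, map_smul] at h7
  change _ = ∑ a, _ • chartCov C.Γ Y y₀ (C.frame z a y₀) at h7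
  simp only [h6, smul_zero, Finset.sum_const_zero] at h7
  exact (smul_eq_zero.1 h7).resolve_left (H.pos z hz).ne'

end Norm

end HyperKahlerChart

end ChartMaximumPrinciple

/-! ### Coordinate vector fields on the manifold. -/

section ChartFields

variable {M : Type*} [TopologicalSpace M] [ChartedSpace R4 M] [IsManifold (𝓡 4) ∞ M]

/-- The components of tangent vectors with respect to the coordinate fields of the chart at `c`. -/
noncomputable def chartProj (c x : M) : TangentSpace (𝓡 4) x →L[ℝ] R4 :=
  (trivializationAt R4 (TangentSpace (𝓡 4) : M → Type _) c).continuousLinearMapAt ℝ x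

/-- The tangent vectors with given components with respect to the coordinate fields of the chart at
`c`. -/
noncomputable def chartLift (c x : M) : R4 →L[ℝ] TangentSpace (𝓡 4) x :=
  (trivializationAt R4 (TangentSpace (𝓡 4) : M → Type _) c).symmL ℝ x

variable {c x : M}

theorem chartLift_chartProj (hx : x ∈ (chartAt R4 c).source) (z : TangentSpace (𝓡 4) x) :
    chartLift c x (chartProj c x z) = z :=
  (trivializationAt R4 (TangentSpace (𝓡 4) : M → Type _) c).symmL_continuousLinearMapAt
    (R := ℝ) (by simpa using hx) z

theorem chartProj_chartLift (hx : x ∈ (chartAt R4 c).source) (z : R4) :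
    chartProj c x (chartLift c x z) = z :=
  (trivializationAt R4 (TangentSpace (𝓡 4) : M → Type _) c).continuousLinearMapAt_symmL
    (R := ℝ) (by simpa using hx) z

theorem chartProj_eq (hx : x ∈ (chartAt R4 c).source) (z : TangentSpace (𝓡 4) x) :
    (trivializationAt R4 (TangentSpace (𝓡 4) : M → Type _) c ⟨x, z⟩).2 = chartProj c x z :=
  ((trivializationAt R4 (TangentSpace (𝓡 4) : M → Type _) c).continuousLinearMapAt_apply_of_mem ℝ
    (by simpa using hx) z).symm

section

variable {F H : Type*} [NormedAddCommGroup F] [NormedSpace ℝ F] [TopologicalSpace H]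
  {IN : ModelWithCorners ℝ F H} {N : Type*} [TopologicalSpace N] [ChartedSpace H N]
  {s : Set N} {f : N → M} {Y : (q : N) → TangentSpace (𝓡 4) (f q)}

theorem contMDiffOn_chartProj
    (hY : ContMDiffOn IN (𝓡 4).tangent ∞ (fun q => (⟨f q, Y q⟩ : TangentBundle (𝓡 4) M)) s)
    (hf : Set.MapsTo f s (chartAt R4 c).source) :
    ContMDiffOn IN 𝓘(ℝ, R4) ∞ (fun q => chartProj c (f q) (Y q)) s := by
  refine (((Bundle.Trivialization.contMDiffOn_iff
    (e := trivializationAt R4 (TangentSpace (𝓡 4) : M → Type _) c) ?_).1 hY).2).congr fun q hq =>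
    (chartProj_eq (hf hq) _).symm
  intro q hq
  simpa [Trivialization.mem_source] using hf hq

theorem mdifferentiableAt_chartProj {Y : (x : M) → TangentSpace (𝓡 4) x}
    (hx : x ∈ (chartAt R4 c).source) :
    IsDiffFieldAt Y x ↔ MDifferentiableAt (𝓡 4) 𝓘(ℝ, R4) (fun x => chartProj c x (Y x)) x := by
  have h1 := Bundle.Trivialization.mdifferentiableAt_section_iff (𝓡 4)
    (trivializationAt R4 (TangentSpace (𝓡 4) : M → Type _) c) Y
    (b₀ := x) (by simpa using hx)
  refine h1.trans (Filter.EventuallyEq.mdifferentiableAt_iff ?_)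
  filter_upwards [(chartAt R4 c).open_source.mem_nhds hx] with q hq using chartProj_eq hq _

end

theorem contMDiffOn_chartLift (c : M) (z : R4) :
    ContMDiffOn (𝓡 4) (𝓡 4).tangent ∞
      (fun x => (⟨x, chartLift c x z⟩ : TangentBundle (𝓡 4) M)) (chartAt R4 c).source := by
  have h1 := (Bundle.Trivialization.contMDiffOn_section_baseSet_iff (IB := 𝓡 4) (n := ∞)
    (s := fun x => chartLift c x z)
    (trivializationAt R4 (TangentSpace (𝓡 4) : M → Type _) c)).2
  rw [TangentBundle.trivializationAt_baseSet] at h1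
  refine h1 ((contMDiffOn_const (c := z)).congr fun x hx => ?_)
  rw [chartProj_eq hx, chartProj_chartLift hx]

theorem isDiffFieldAt_chartLift (hx : x ∈ (chartAt R4 c).source) (z : R4) :
    IsDiffFieldAt (fun x => chartLift c x z) x :=
  ((contMDiffOn_chartLift c z).contMDiffAt
    ((chartAt R4 c).open_source.mem_nhds hx)).mdifferentiableAt (by simp)

/-- `nabla_smooth` speaks only of globally smooth fields. Cutting a coordinate field off with a bump
function, together with locality of the connection, yields smoothness of the Christoffel symbols. -/
theorem exists_isSmoothField_eventuallyEq [T2Space M] (hx : x ∈ (chartAt R4 c).source) (z : R4) :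
    ∃ Z : (x : M) → TangentSpace (𝓡 4) x, IsSmoothField Z ∧ ∀ᶠ q in nhds x, Z q = chartLift c q z := by
  obtain ⟨χ, -, hχ⟩ := (SmoothBumpFunction.nhds_basis_tsupport (I := 𝓡 4) x).mem_iff.1
    ((chartAt R4 c).open_source.mem_nhds hx)
  refine ⟨fun q => χ q • chartLift c q z, ?_, ?_⟩
  · exact ContMDiffOn.smul_section_of_tsupport χ.contMDiff.contMDiffOn
      (chartAt R4 c).open_source hχ (contMDiffOn_chartLift c z)
  · filter_upwards [χ.eventuallyEq_one] with q hq
    simp [hq]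

theorem chartLift_eq_mfderiv {y : R4} (hy : y ∈ (chartAt R4 c).target) (z : R4) :
    chartLift c ((chartAt R4 c).symm y) z =
      mfderiv 𝓘(ℝ, R4) (𝓡 4) (chartAt R4 c).symm y z := by
  have h1 := TangentBundle.symmL_trivializationAt (I := 𝓡 4) (𝕜 := ℝ)
    ((chartAt R4 c).map_target hy)
  have h2 : extChartAt (𝓡 4) c ((chartAt R4 c).symm y) = y := by
    simp [(chartAt R4 c).right_inv hy]
  rw [h2] at h1
  simp only [modelWithCornersSelf_coe, Set.range_id, mfderivWithin_univ] at h1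
  exact congrArg (fun L => L z) h1

theorem mdifferentiableAt_chart_symm {y : R4} (hy : y ∈ (chartAt R4 c).target) :
    MDifferentiableAt 𝓘(ℝ, R4) (𝓡 4) (chartAt R4 c).symm y :=
  (((contMDiffOn_chart_symm (I := 𝓡 4) (n := ∞) (x := c)).contMDiffAt
    ((chartAt R4 c).open_target.mem_nhds hy))).mdifferentiableAt (by simp)

theorem mvfderiv_chartLift {F : Type*} [NormedAddCommGroup F] [NormedSpace ℝ F] {f : M → F} {y : R4}
    (hy : y ∈ (chartAt R4 c).target)
    (hf : MDifferentiableAt (𝓡 4) 𝓘(ℝ, F) f ((chartAt R4 c).symm y)) (z : R4) :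
    mvfderiv (𝓡 4) f ((chartAt R4 c).symm y) (chartLift c _ z) =
      fderiv ℝ (fun y => f ((chartAt R4 c).symm y)) y z := by
  have h1 := mfderiv_comp y hf (mdifferentiableAt_chart_symm hy)
  rw [chartLift_eq_mfderiv hy]
  have h2 : mfderiv 𝓘(ℝ, R4) 𝓘(ℝ, F) (f ∘ (chartAt R4 c).symm) y z =
    mfderiv (𝓡 4) 𝓘(ℝ, F) f ((chartAt R4 c).symm y)
      (mfderiv 𝓘(ℝ, R4) (𝓡 4) (chartAt R4 c).symm y z) := by rw [h1]; rfl
  rw [mfderiv_eq_fderiv] at h2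
  exact h2.symm

/-- The constant vector fields on the model space. -/
def constField (z : R4) : (y : R4) → TangentSpace 𝓘(ℝ, R4) y := fun _ => z

/-- Coordinate fields commute. -/
theorem mlieBracket_chartLift (hx : x ∈ (chartAt R4 c).source) (z z' : R4) :
    VectorField.mlieBracket (𝓡 4) (fun x => chartLift c x z) (fun x => chartLift c x z') x = 0 := by
  -- Coordinate fields are the pullbacks of constant fields under the chart. Pullback respects
  -- brackets, and constant fields commute.
  have h0 : ∀ z : R4, (fun q => chartLift c q z) =ᶠ[nhds x] VectorField.mpullback (𝓡 4) 𝓘(ℝ, R4)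
      (extChartAt (𝓡 4) c) (constField z) := fun z => by
    filter_upwards [(chartAt R4 c).open_source.mem_nhds hx] with q hq
    have hq' : q ∈ (extChartAt (𝓡 4) c).source := by simpa using hq
    obtain ⟨A, hA⟩ := isInvertible_mfderiv_extChartAt (I := 𝓡 4) hq'
    have h2 : chartProj c q = mfderiv (𝓡 4) 𝓘(ℝ, R4) (extChartAt (𝓡 4) c) q :=
      TangentBundle.continuousLinearMapAt_trivializationAt (I := 𝓡 4) hq
    have h3 := chartProj_chartLift hq z
    rw [h2, ← hA] at h3
    refine Eq.trans ?_ (VectorField.mpullback_apply (I := 𝓡 4) (I' := 𝓘(ℝ, R4))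
      (f := extChartAt (𝓡 4) c) (V := constField z) (x := q)).symm
    rw [← hA, ContinuousLinearMap.inverse_equiv]
    exact (A.symm_apply_eq.2 h3.symm).symm
  rw [(h0 z).mlieBracket_vectorField_eq (h0 z')]
  have hc : ∀ z : R4, MDifferentiableAt 𝓘(ℝ, R4) 𝓘(ℝ, R4).tangent
      (fun y => (⟨y, constField z y⟩ : TangentBundle 𝓘(ℝ, R4) R4)) (extChartAt (𝓡 4) c x) :=
    fun z => by
    rw [mdifferentiableAt_section]
    simp only [constField, trivializationAt_model_space_apply]
    exact mdifferentiableAt_const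
  have : IsManifold (𝓡 4) (minSmoothness ℝ 2) M := by
    rw [minSmoothness_of_isRCLikeNormedField]
    exact IsManifold.of_le (n := ∞) (by norm_cast)
  rw [← VectorField.mpullback_mlieBracket (n := ∞) (hc z) (hc z')
    (contMDiffAt_extChartAt' hx)
    (by rw [minSmoothness_of_isRCLikeNormedField]; norm_cast)]
  have h1 : VectorField.mlieBracket 𝓘(ℝ, R4) (constField z) (constField z') =
      VectorField.lieBracket ℝ (fun _ => z) (fun _ => z') := by
    rw [← VectorField.mlieBracketWithin_univ, VectorField.mlieBracketWithin_eq_lieBracketWithin]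
    exact VectorField.lieBracketWithin_univ
  refine (VectorField.mpullback_apply ..).trans ?_
  rw [h1]
  simp only [VectorField.lieBracket, fderiv_fun_const, Pi.zero_apply, zero_apply, sub_zero]
  exact map_zero _

end ChartFields

/-! ### The hyper-Kähler structure in coordinates. -/

section ChartExpressions

variable {M : Type*} [TopologicalSpace M] [ChartedSpace R4 M] [IsManifold (𝓡 4) ∞ M]

/-- The expression of a vector field in the chart at `c`. -/
noncomputable def chartField (c : M) (Y : (x : M) → TangentSpace (𝓡 4) x) (y : R4) : R4 :=
  chartProj c ((chartAt R4 c).symm y) (Y ((chartAt R4 c).symm y))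

/-- The expression of a field of endomorphisms in the chart at `c`. -/
noncomputable def chartEnd (c : M) (A : (x : M) → TangentSpace (𝓡 4) x →L[ℝ] TangentSpace (𝓡 4) x)
    (y : R4) : R4 →L[ℝ] R4 :=
  (chartProj c ((chartAt R4 c).symm y)).comp
    ((A ((chartAt R4 c).symm y)).comp (chartLift c ((chartAt R4 c).symm y)))

variable {c : M}

theorem chartEnd_apply (A : (x : M) → TangentSpace (𝓡 4) x →L[ℝ] TangentSpace (𝓡 4) x)
    (y z : R4) : chartEnd c A y z = chartProj c ((chartAt R4 c).symm y)
      (A ((chartAt R4 c).symm y) (chartLift c ((chartAt R4 c).symm y) z)) := rfl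

theorem chartLift_chartEnd (A : (x : M) → TangentSpace (𝓡 4) x →L[ℝ] TangentSpace (𝓡 4) x)
    {y : R4} (hy : y ∈ (chartAt R4 c).target) (z : R4) :
    chartLift c ((chartAt R4 c).symm y) (chartEnd c A y z) =
      A ((chartAt R4 c).symm y) (chartLift c ((chartAt R4 c).symm y) z) :=
  chartLift_chartProj ((chartAt R4 c).map_target hy) _

theorem contDiffOn_chartEnd
    {A : (x : M) → TangentSpace (𝓡 4) x →L[ℝ] TangentSpace (𝓡 4) x} (hA : IsSmoothEnd A) :
    ContDiffOn ℝ ∞ (chartEnd c A) (chartAt R4 c).target := by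
  rw [contDiffOn_clm_apply]
  intro z
  rw [← contMDiffOn_iff_contDiffOn]
  have h1 : ContMDiffOn (𝓡 4) (𝓡 4).tangent ∞
      (fun x => (⟨x, A x (chartLift c x z)⟩ : TangentBundle (𝓡 4) M)) (chartAt R4 c).source :=
    ContMDiffOn.clm_bundle_apply hA.contMDiffOn (contMDiffOn_chartLift c z)
  exact contMDiffOn_chartProj (c := c) (f := (chartAt R4 c).symm)
    (h1.comp contMDiffOn_chart_symm (chartAt R4 c).mapsTo_symm) (chartAt R4 c).mapsTo_symm

theorem mdifferentiableAt_comp_chart_symm {F : Type*} [NormedAddCommGroup F] [NormedSpace ℝ F]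
    {f : M → F} {y : R4} (hy : y ∈ (chartAt R4 c).target)
    (hf : MDifferentiableAt (𝓡 4) 𝓘(ℝ, F) f ((chartAt R4 c).symm y)) :
    DifferentiableAt ℝ (fun y => f ((chartAt R4 c).symm y)) y :=
  (hf.comp y (mdifferentiableAt_chart_symm hy)).differentiableAt

theorem differentiableAt_chartField {Y : (x : M) → TangentSpace (𝓡 4) x} {y : R4}
    (hy : y ∈ (chartAt R4 c).target) (hY : IsDiffFieldAt Y ((chartAt R4 c).symm y)) :
    DifferentiableAt ℝ (chartField c Y) y :=
  mdifferentiableAt_comp_chart_symm hy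
    ((mdifferentiableAt_chartProj ((chartAt R4 c).map_target hy)).1 hY)

variable [RiemannianBundle (fun x : M => TangentSpace (𝓡 4) x)]

/-- The expression of the metric in the chart at `c`. -/
noncomputable def chartMetric (c : M) (y : R4) : R4 →L[ℝ] R4 →L[ℝ] ℝ :=
  LinearMap.toContinuousBilinearMap (LinearMap.mk₂ ℝ
    (fun a b => inner ℝ (chartLift c ((chartAt R4 c).symm y) a)
      (chartLift c ((chartAt R4 c).symm y) b))
    (fun a a' b => by simp [inner_add_left]) (fun r a b => by simp [inner_smul_left])
    (fun a b b' => by simp [inner_add_right]) (fun r a b => by simp [inner_smul_right]))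

theorem chartMetric_apply (c : M) (y a b : R4) : chartMetric c y a b =
    inner ℝ (chartLift c ((chartAt R4 c).symm y) a) (chartLift c ((chartAt R4 c).symm y) b) := rfl

theorem contDiffOn_chartMetric
    [IsContMDiffRiemannianBundle (𝓡 4) ∞ R4 (fun x : M => TangentSpace (𝓡 4) x)] (c : M) :
    ContDiffOn ℝ ∞ (chartMetric c) (chartAt R4 c).target := by
  rw [contDiffOn_clm_apply]
  intro a
  rw [contDiffOn_clm_apply]
  intro b
  rw [← contMDiffOn_iff_contDiffOn]
  exact ((contMDiffOn_chartLift c a).inner_bundle (contMDiffOn_chartLift c b)).comp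
    contMDiffOn_chart_symm (chartAt R4 c).mapsTo_symm

namespace HyperKahlerStructure

variable (h : HyperKahlerStructure M)

/-- The Christoffel symbols of the Levi-Civita connection in the chart at `c`. -/
noncomputable def christoffel (c : M) (y : R4) : R4 →L[ℝ] R4 →L[ℝ] R4 :=
  ∑ i : Fin 4, (ContinuousLinearMap.smulRightL ℝ R4 R4 (EuclideanSpace.proj i)).comp
    (chartEnd c (h.nabla fun x => chartLift c x (EuclideanSpace.single i 1)) y)

theorem christoffel_apply (c : M) (y e z : R4) : h.christoffel c y e z =
    ∑ i, z i • chartEnd c (h.nabla fun x => chartLift c x (EuclideanSpace.single i 1)) y e := by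
  simp [christoffel]

theorem contDiffOn_christoffel [T2Space M] (c : M) :
    ContDiffOn ℝ ∞ (h.christoffel c) (chartAt R4 c).target := by
  refine ContDiffOn.sum fun i _ => contDiffOn_const.clm_comp ?_
  intro y hy
  have hx := (chartAt R4 c).map_target hy
  obtain ⟨Z, hZ, hZe⟩ := exists_isSmoothField_eventuallyEq hx (EuclideanSpace.single i (1 : ℝ))
  have h1 := (contDiffOn_chartEnd (c := c) (h.nabla_smooth Z hZ)) y hy
  have h2 : ∀ᶠ q in nhds ((chartAt R4 c).symm y), h.nabla Z q =
      h.nabla (fun x => chartLift c x (EuclideanSpace.single i 1)) q := by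
    filter_upwards [hZe.eventually_nhds, (chartAt R4 c).open_source.mem_nhds hx] with q hq hq'
    exact h.nabla.isCovariantDerivativeOn.congr_of_eventuallyEq (hZ.mdifferentiable (by simp) q)
      (isDiffFieldAt_chartLift hq' _) Filter.univ_mem hq
  have h3 := ((chartAt R4 c).continuousAt_symm hy).eventually h2
  refine (h1.contDiffAt ((chartAt R4 c).open_target.mem_nhds hy)).contDiffWithinAt.congr_of_eventuallyEq
    ?_ ?_
  · refine Filter.Eventually.filter_mono nhdsWithin_le_nhds ?_
    filter_upwards [h3] with q hq
    rw [chartEnd, chartEnd, hq]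
  · rw [chartEnd, chartEnd, h3.self_of_nhds]

theorem nabla_sum {ι : Type*} (s : Finset ι) (f : ι → M → ℝ)
    (Z : ι → (x : M) → TangentSpace (𝓡 4) x) {x : M}
    (hf : ∀ i ∈ s, MDifferentiableAt (𝓡 4) 𝓘(ℝ, ℝ) (f i) x) (hZ : ∀ i ∈ s, IsDiffFieldAt (Z i) x) :
    IsDiffFieldAt (∑ i ∈ s, f i • Z i) x ∧ ∀ e, h.nabla (∑ i ∈ s, f i • Z i) x e =
      ∑ i ∈ s, (f i x • h.nabla (Z i) x e + mvfderiv (𝓡 4) (f i) x e • Z i x) := by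
  classical
  induction s using Finset.induction_on with
  | empty =>
    simp only [Finset.sum_empty]
    refine ⟨mdifferentiableAt_zeroSection _ _, fun e => ?_⟩
    rw [h.nabla.isCovariantDerivativeOn.zero]
    rfl
  | insert i s hi ih =>
    obtain ⟨h1, h2⟩ := ih (fun j hj => hf j (Finset.mem_insert_of_mem hj))
      fun j hj => hZ j (Finset.mem_insert_of_mem hj)
    have hfi := hf i (Finset.mem_insert_self i s)
    have hZi := hZ i (Finset.mem_insert_self i s)
    have h3 : IsDiffFieldAt (f i • Z i) x := hfi.smul_section hZi
    simp only [Finset.sum_insert hi]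
    refine ⟨mdifferentiableAt_add_section h3 h1, fun e => ?_⟩
    rw [h.nabla.isCovariantDerivativeOn.add h3 h1, h.nabla.isCovariantDerivativeOn.leibniz hZi hfi,
      ← h2]
    rfl

/-- Expand `Y` in coordinate fields and apply the Leibniz rule: differentiating the coefficients
gives `fderiv`, and differentiating the fields gives the Christoffel term. -/
theorem chartEnd_nabla {Y : (x : M) → TangentSpace (𝓡 4) x} {y : R4}
    (hy : y ∈ (chartAt R4 c).target) (hY : IsDiffFieldAt Y ((chartAt R4 c).symm y)) :
    chartEnd c (h.nabla Y) y = chartCov (h.christoffel c) (chartField c Y) y := by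
  ext1 e
  have hx := (chartAt R4 c).map_target hy
  set x := (chartAt R4 c).symm y with hxdef
  have hm := (mdifferentiableAt_chartProj hx).1 hY
  have hm' : ∀ i : Fin 4, MDifferentiableAt (𝓡 4) 𝓘(ℝ, ℝ) (fun x => chartProj c x (Y x) i) x :=
    fun i => (EuclideanSpace.proj (𝕜 := ℝ) i).differentiableAt.mdifferentiableAt.comp x hm
  obtain ⟨h1, h2⟩ := h.nabla_sum Finset.univ (fun i x => chartProj c x (Y x) i)
    (fun i x => chartLift c x (EuclideanSpace.single i 1)) (fun i _ => hm' i)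
    fun i _ => isDiffFieldAt_chartLift hx _
  have hb : ∀ z : R4, ∑ i, z i • (EuclideanSpace.single i (1 : ℝ)) = z := fun z => by
    ext j
    simp [Finset.sum_apply, Pi.single_apply]
  have h3 : h.nabla Y x = h.nabla (∑ i : Fin 4, (fun x => chartProj c x (Y x) i) •
      fun x => chartLift c x (EuclideanSpace.single i 1)) x := by
    refine h.nabla.isCovariantDerivativeOn.congr_of_eventuallyEq hY h1 Filter.univ_mem ?_
    filter_upwards [(chartAt R4 c).open_source.mem_nhds hx] with q hq
    rw [Finset.sum_apply]
    simp only [Pi.smul_apply']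
    rw [← chartLift_chartProj hq (Y q)]
    simp only [← map_smul, ← map_sum, hb, chartProj_chartLift hq]
  have h4 : ∀ i : Fin 4, mvfderiv (𝓡 4) (fun x => chartProj c x (Y x) i) x (chartLift c x e) =
      fderiv ℝ (chartField c Y) y e i := fun i => by
    rw [mvfderiv_chartLift hy (hm' i)]
    have := ((EuclideanSpace.proj (𝕜 := ℝ) i).hasFDerivAt.comp y
      (differentiableAt_chartField hy hY).hasFDerivAt).fderiv
    exact congrArg (fun L => L e) this
  rw [chartEnd_apply, ← hxdef, h3, h2, map_sum, chartCov_apply, christoffel_apply]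
  simp only [map_add, map_smul, h4, chartProj_chartLift hx, Finset.sum_add_distrib, hb]
  rw [add_comm]
  rfl

theorem christoffel_eq {y : R4} (hy : y ∈ (chartAt R4 c).target) (e z : R4) :
    h.christoffel c y e z = chartEnd c (h.nabla fun x => chartLift c x z) y e := by
  rw [h.chartEnd_nabla hy (isDiffFieldAt_chartLift ((chartAt R4 c).map_target hy) z), chartCov_apply]
  have h1 : chartField c (fun x => chartLift c x z) =ᶠ[nhds y] fun _ => z := by
    filter_upwards [(chartAt R4 c).open_target.mem_nhds hy] with q hq
    exact chartProj_chartLift ((chartAt R4 c).map_target hq) z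
  rw [h1.fderiv_eq, h1.self_of_nhds]
  simp

/-- Parallelism is tested on coordinate fields: their components are constant, so only the
derivative of `Q` and the Christoffel terms remain. -/
theorem chartCovEnd_eq_zero {Q : (x : M) → TangentSpace (𝓡 4) x →L[ℝ] TangentSpace (𝓡 4) x}
    (hQ : IsSmoothEnd Q) (hpar : ∀ (Y : (x : M) → TangentSpace (𝓡 4) x) (x : M), IsDiffFieldAt Y x →
      ∀ e, h.nabla (fun y => Q y (Y y)) x e = Q x (h.nabla Y x e)) {y : R4}
    (hy : y ∈ (chartAt R4 c).target) : chartCovEnd (h.christoffel c) (chartEnd c Q) y = 0 := by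
  ext1 e
  ext1 z
  have hx := (chartAt R4 c).map_target hy
  have hZ := isDiffFieldAt_chartLift hx z
  have hQZ : IsDiffFieldAt (fun q => Q q (chartLift c q z)) ((chartAt R4 c).symm y) :=
    MDifferentiableAt.clm_bundle_apply (hQ.mdifferentiable (by simp) _) hZ
  have h1 := congrArg (fun L => L e) (h.chartEnd_nabla hy hQZ)
  simp only [chartCov_apply, chartEnd_apply, hpar _ _ hZ] at h1
  have h2 : fderiv ℝ (chartField c fun q => Q q (chartLift c q z)) y e =
      fderiv ℝ (chartEnd c Q) y e z := by
    have h3 := ((contDiffOn_chartEnd (c := c) hQ).contDiffAt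
      ((chartAt R4 c).open_target.mem_nhds hy)).differentiableAt (by simp)
    have h4 := (h3.hasFDerivAt.clm_apply (hasFDerivAt_const z y)).fderiv
    have h5 := congrArg (fun L => L e) h4
    simp only [add_apply, ContinuousLinearMap.comp_apply, zero_apply, map_zero,
      ContinuousLinearMap.flip_apply, zero_add] at h5
    exact h5
  rw [chartCovEnd_apply, ← h2, h.christoffel_eq hy e z, chartEnd_apply (c := c) Q y (chartEnd _ _ _ _),
    chartLift_chartEnd _ hy]
  exact sub_eq_zero.2 h1.symm

theorem K_parallel (Y : (x : M) → TangentSpace (𝓡 4) x) (x : M) (hY : IsDiffFieldAt Y x)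
    (e : TangentSpace (𝓡 4) x) : h.nabla (fun y => h.K y (Y y)) x e = h.K x (h.nabla Y x e) := by
  have h0 : IsDiffFieldAt (fun q => h.J q (Y q)) x :=
    MDifferentiableAt.clm_bundle_apply (h.J_smooth.mdifferentiable (by simp) _) hY
  have h1 := h.I_parallel (fun y => h.J y (Y y)) x h0 e
  rw [h.J_parallel _ x hY e, h.I_J] at h1
  simpa only [h.I_J] using h1

/-- The expression of the hyper-Kähler structure in the chart at `c`. -/
noncomputable def chart [T2Space M]
    [IsContMDiffRiemannianBundle (𝓡 4) ∞ R4 (fun x : M => TangentSpace (𝓡 4) x)] (c : M) :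
    HyperKahlerChart (chartAt R4 c).target where
  isOpen := (chartAt R4 c).open_target
  g := chartMetric c
  Γ := h.christoffel c
  I := chartEnd c h.I
  J := chartEnd c h.J
  K := chartEnd c h.K
  g_smooth := contDiffOn_chartMetric c
  Γ_smooth := h.contDiffOn_christoffel c
  I_smooth := contDiffOn_chartEnd h.I_smooth
  J_smooth := contDiffOn_chartEnd h.J_smooth
  K_smooth := contDiffOn_chartEnd h.K_smooth
  triple y hy := by
    have hx := (chartAt R4 c).map_target hy
    have hcc : ∀ {A B : (x : M) → TangentSpace (𝓡 4) x →L[ℝ] TangentSpace (𝓡 4) x} (z : R4),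
        chartEnd c A y (chartEnd c B y z) = chartProj c _ (A _ (B _ (chartLift c _ z))) :=
      fun z => by rw [chartEnd_apply, chartLift_chartEnd _ hy]
    refine ⟨fun a b => by rw [chartMetric_apply, chartMetric_apply, real_inner_comm], fun a ha => ?_, fun a => ?_, fun a => ?_, fun a => ?_,
      fun a => ?_, fun a b => ?_, fun a b => ?_⟩
    · rw [chartMetric_apply]
      refine real_inner_self_pos.2 fun h0 => ha ?_
      rw [← chartProj_chartLift hx a, h0, map_zero]
    · rw [hcc, h.I_sq, map_neg, chartProj_chartLift hx]
    · rw [hcc, h.J_sq, map_neg, chartProj_chartLift hx]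
    · rw [hcc, h.I_J, chartEnd_apply]
    · rw [hcc, h.J_I, map_neg, chartEnd_apply]
    · rw [chartMetric_apply, chartLift_chartEnd _ hy, chartLift_chartEnd _ hy, h.I_isometry,
        chartMetric_apply]
    · rw [chartMetric_apply, chartLift_chartEnd _ hy, chartLift_chartEnd _ hy, h.J_isometry,
        chartMetric_apply]
  Γ_symm y hy e z := by
    have hx := (chartAt R4 c).map_target hy
    have h1 := h.torsion_free (fun x => chartLift c x e) (fun x => chartLift c x z) _
      (isDiffFieldAt_chartLift hx e) (isDiffFieldAt_chartLift hx z)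
    rw [mlieBracket_chartLift hx, sub_eq_zero] at h1
    rw [h.christoffel_eq hy, h.christoffel_eq hy, chartEnd_apply, chartEnd_apply, h1]
  metric y hy e a b := by
    have hx := (chartAt R4 c).map_target hy
    have ha := isDiffFieldAt_chartLift hx a
    have hb := isDiffFieldAt_chartLift hx b
    have h1 := h.metric _ _ _ ha hb (chartLift c _ e)
    rw [mvfderiv_chartLift hy (((((contMDiffOn_chartLift c a).inner_bundle
      (contMDiffOn_chartLift c b)).contMDiffAt
      ((chartAt R4 c).open_source.mem_nhds hx))).mdifferentiableAt (by simp))] at h1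
    have h2 := ((contDiffOn_chartMetric c).contDiffAt
      ((chartAt R4 c).open_target.mem_nhds hy)).differentiableAt (by simp)
    have h3 := congrArg (fun L => L e) ((h2.hasFDerivAt.clm_apply
      (hasFDerivAt_const a y)).clm_apply (hasFDerivAt_const b y)).fderiv
    have h4 : fderiv ℝ (fun y => chartMetric c y a b) y e = fderiv ℝ (chartMetric c) y e a b := by
      simpa using h3
    rw [← h4, h.christoffel_eq hy, h.christoffel_eq hy, chartMetric_apply, chartMetric_apply,
      chartLift_chartEnd _ hy, chartLift_chartEnd _ hy]
    exact h1
  I_parallel y hy := h.chartCovEnd_eq_zero h.I_smooth h.I_parallel hy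
  J_parallel y hy := h.chartCovEnd_eq_zero h.J_smooth h.J_parallel hy
  K_parallel y hy := h.chartCovEnd_eq_zero h.K_smooth h.K_parallel hy

end HyperKahlerStructure

end ChartExpressions

/-! ### The Dirac equation in components. -/

section DiracInChart

variable {M : Type*} [TopologicalSpace M] [ChartedSpace R4 M] [IsManifold (𝓡 4) ∞ M]

section Representation

/-- The real component of a spinor, in the chart at `c`. -/
noncomputable def spinorReal (c : M) (ψ : Spinor M) (q : Plane × R4) : ℝ :=
  (ψ q.1 ((chartAt R4 c).symm q.2)).1

/-- The components of a spinor along `∂_t`, `∂_u`, `∂_v`, in the chart at `c`. -/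
noncomputable def spinorFlat (c : M) (ψ : Spinor M) (i : Fin 3) (q : Plane × R4) : ℝ :=
  (ψ q.1 ((chartAt R4 c).symm q.2)).2.1 i

/-- The component of a spinor tangent to `M`, in the chart at `c`. -/
noncomputable def spinorField (c : M) (ψ : Spinor M) (q : Plane × R4) : R4 :=
  chartProj c ((chartAt R4 c).symm q.2) (ψ q.1 ((chartAt R4 c).symm q.2)).2.2

variable {c : M}

theorem contMDiffOn_prod_chart_symm : ContMDiffOn 𝓘(ℝ, Plane × R4) (𝓘(ℝ, Plane).prod (𝓡 4)) ∞
    (fun q : Plane × R4 => (q.1, (chartAt R4 c).symm q.2))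
    (Set.univ ×ˢ (chartAt R4 c).target) :=
  (contDiff_fst.contMDiff.contMDiffOn).prodMk
    ((contMDiffOn_chart_symm (I := 𝓡 4) (n := ∞) (x := c)).comp
      contDiff_snd.contMDiff.contMDiffOn fun _ hq => hq.2)

variable {ψ : Spinor M}

namespace IsSmoothSpinor

theorem contDiffOn_flat (hψ : IsSmoothSpinor ψ) :
    ContDiffOn ℝ ∞ (fun q : Plane × R4 => ((ψ q.1 ((chartAt R4 c).symm q.2)).1,
      (ψ q.1 ((chartAt R4 c).symm q.2)).2.1)) (Set.univ ×ˢ (chartAt R4 c).target) :=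
  (hψ.flat.comp_contMDiffOn contMDiffOn_prod_chart_symm).contDiffOn

theorem contDiffOn_spinorReal (hψ : IsSmoothSpinor ψ) :
    ContDiffOn ℝ ∞ (spinorReal c ψ) (Set.univ ×ˢ (chartAt R4 c).target) :=
  hψ.contDiffOn_flat.fst

theorem contDiffOn_spinorFlat (hψ : IsSmoothSpinor ψ) (i : Fin 3) :
    ContDiffOn ℝ ∞ (spinorFlat c ψ i) (Set.univ ×ˢ (chartAt R4 c).target) :=
  (contDiffOn_pi.1 hψ.contDiffOn_flat.snd) i

theorem contDiffOn_spinorField (hψ : IsSmoothSpinor ψ) :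
    ContDiffOn ℝ ∞ (spinorField c ψ) (Set.univ ×ˢ (chartAt R4 c).target) :=
  (contMDiffOn_chartProj (hψ.tangent.comp_contMDiffOn contMDiffOn_prod_chart_symm)
    fun _ hq => (chartAt R4 c).map_target hq.2).contDiffOn

theorem fderiv_torus [RiemannianBundle (fun x : M => TangentSpace (𝓡 4) x)] {F : Type*} [NormedAddCommGroup F] [NormedSpace ℝ F] {x : M}
    (hψ : IsSmoothSpinor ψ) (p : Plane) (L : SpinorFiber x →L[ℝ] F) (i : Fin 2) :
    fderiv ℝ (fun q => L (ψ q x)) p (EuclideanSpace.single i 1) = L (torusDeriv ψ p x i) :=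
  congrArg (fun A => A (EuclideanSpace.single i 1))
    (L.hasFDerivAt.comp p (hψ.diff_torus p x).hasFDerivAt).fderiv

end IsSmoothSpinor

theorem fderiv_left {F : Type*} [NormedAddCommGroup F] [NormedSpace ℝ F]
    {U : Set R4} {f : Plane × R4 → F} (hU : IsOpen U) (hf : ContDiffOn ℝ ∞ f (Set.univ ×ˢ U))
    {p : Plane} {y : R4} (hy : y ∈ U) (w : Plane) :
    fderiv ℝ (fun p => f (p, y)) p w = fderiv ℝ f (p, y) (w, 0) :=
by
  have h1 := ((hasFDerivAt_of_mem_prod hU hf (q := (p, y)) hy).comp p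
    (hasFDerivAt_prodMk_left (𝕜 := ℝ) p y)).fderiv
  exact congrArg (fun L => L w) h1

/-- Invariance of the trace under conjugation. It lets traces computed in an orthonormal basis of
`T_x M` be read in chart coordinates, where no orthonormal frame is chosen. -/
theorem trace_chartEnd {A : (x : M) → TangentSpace (𝓡 4) x →L[ℝ] TangentSpace (𝓡 4) x} {y : R4}
    (hy : y ∈ (chartAt R4 c).target) :
    LinearMap.trace ℝ R4 (chartEnd c A y : R4 →ₗ[ℝ] R4) =
      LinearMap.trace ℝ _ (A ((chartAt R4 c).symm y) :
        TangentSpace (𝓡 4) ((chartAt R4 c).symm y) →ₗ[ℝ] _) := by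
  have h1 := LinearMap.trace_comp_comm' (R := ℝ)
    (((A ((chartAt R4 c).symm y)).comp (chartLift c ((chartAt R4 c).symm y)) : R4 →L[ℝ] _) :
      R4 →ₗ[ℝ] TangentSpace (𝓡 4) ((chartAt R4 c).symm y))
    (chartProj c ((chartAt R4 c).symm y) : _ →ₗ[ℝ] R4)
  refine h1.trans (congrArg _ ?_)
  ext z
  simp [chartLift_chartProj ((chartAt R4 c).map_target hy)]

end Representation

variable [RiemannianBundle (fun x : M => TangentSpace (𝓡 4) x)] (h : HyperKahlerStructure M)

namespace HyperKahlerStructure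

theorem clifford_tangent (x : M) (w : TangentSpace (𝓡 4) x) (f : ℝ) (a : Fin 3 → ℝ)
    (y : TangentSpace (𝓡 4) x) : h.clifford x (0, w) (f, a, y) =
      (-inner ℝ w y, ![inner ℝ (h.K x w) y, inner ℝ (h.J x w) y, inner ℝ (h.I x w) y],
        f • w - h.act x a w) := by
  refine Prod.ext ?_ (Prod.ext ?_ ?_)
  · simp [clifford]
  · simp [clifford, cross, pairing]
  · simp [clifford, cross, act, sub_eq_add_neg]

theorem clifford_first (x : M) (σ : SpinorFiber x) : h.clifford x (frame x 1) σ =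
    (-σ.2.1 1, ![σ.2.1 2, σ.1, -σ.2.1 0], h.J x σ.2.2) := by
  ext i
  · simp [clifford]
  · fin_cases i <;> simp [clifford, cross, pairing, crossProduct, Matrix.vecHead, Matrix.vecTail]
  · simp [clifford, cross, act]

theorem clifford_second (x : M) (σ : SpinorFiber x) : h.clifford x (frame x 2) σ =
    (-σ.2.1 2, ![-σ.2.1 1, σ.2.1 0, σ.1], h.I x σ.2.2) := by
  ext i
  · simp [clifford]
  · fin_cases i <;> simp [clifford, cross, pairing, crossProduct, Matrix.vecHead, Matrix.vecTail]
  · simp [clifford, cross, act]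

theorem K_K (x : M) (y : TangentSpace (𝓡 4) x) : h.K x (h.K x y) = -y := by
  rw [← h.I_J, ← neg_eq_iff_eq_neg.2 (h.J_I x y)]
  simp [h.I_sq, h.J_sq]

theorem clifford_normal_sq (x : M) (σ : SpinorFiber x) :
    h.clifford x (frame x 0) (h.clifford x (frame x 0) σ) = -σ := by
  rw [h.clifford_normal, h.clifford_normal]
  ext i
  · simp
  · fin_cases i <;> simp
  · simp [h.K_K]

theorem I_skew (x : M) (y z : TangentSpace (𝓡 4) x) :
    inner ℝ (h.I x y) z = -(inner ℝ y (h.I x z) : ℝ) := by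
  rw [← h.I_isometry x y, h.I_sq]; simp

theorem J_skew (x : M) (y z : TangentSpace (𝓡 4) x) :
    inner ℝ (h.J x y) z = -(inner ℝ y (h.J x z) : ℝ) := by
  rw [← h.J_isometry x y, h.J_sq]; simp

/-- The five equations are the components along `TM`, `s`, `∂_t`, `∂_u` and `∂_v`. In the scalar
ones, sums over the orthonormal basis become traces after `I, J, K` are moved across the inner
product by skewness. -/
theorem dirac_equations {ψ : Spinor M} {p : Plane} {x : M} (hD : h.diracX ψ p x = 0) :
    (∀ z, inner ℝ (h.J x (torusDeriv ψ p x 0).2.2 + h.I x (torusDeriv ψ p x 1).2.2) z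
      + mvfderiv (𝓡 4) (fun y => (ψ p y).1) x z
      + mvfderiv (𝓡 4) (fun y => (ψ p y).2.1) x (h.K x z) 0
      + mvfderiv (𝓡 4) (fun y => (ψ p y).2.1) x (h.J x z) 1
      + mvfderiv (𝓡 4) (fun y => (ψ p y).2.1) x (h.I x z) 2 = 0) ∧
    ((torusDeriv ψ p x 0).2.1 1 + (torusDeriv ψ p x 1).2.1 2 + LinearMap.trace ℝ _
      (h.nabla (fun y => (ψ p y).2.2) x : TangentSpace (𝓡 4) x →ₗ[ℝ] _) = 0) ∧
    ((torusDeriv ψ p x 0).2.1 2 - (torusDeriv ψ p x 1).2.1 1 - LinearMap.trace ℝ _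
      ((h.K x).comp (h.nabla (fun y => (ψ p y).2.2) x) : TangentSpace (𝓡 4) x →ₗ[ℝ] _) = 0) ∧
    ((torusDeriv ψ p x 0).1 + (torusDeriv ψ p x 1).2.1 0 - LinearMap.trace ℝ _
      ((h.J x).comp (h.nabla (fun y => (ψ p y).2.2) x) : TangentSpace (𝓡 4) x →ₗ[ℝ] _) = 0) ∧
    ((torusDeriv ψ p x 1).1 - (torusDeriv ψ p x 0).2.1 0 - LinearMap.trace ℝ _
      ((h.I x).comp (h.nabla (fun y => (ψ p y).2.2) x) : TangentSpace (𝓡 4) x →ₗ[ℝ] _) = 0) := by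
  set B := stdOrthonormalBasis ℝ (TangentSpace (𝓡 4) x) with hB
  rw [diracX, neg_eq_zero] at hD
  -- `A` carries the factor `-γ`; since `γ² = -1`, applying `γ` once more removes it.
  have hD' := congrArg (h.clifford x (frame x 0)) hD
  rw [h.clifford_normal_sq, map_zero, neg_eq_zero] at hD'
  simp only [h.clifford_first, h.clifford_second, spinorDeriv, clifford_tangent, ← hB] at hD'
  have e1 := congrArg Prod.fst hD'
  have e2 := congrArg (fun σ : SpinorFiber x => σ.2.1) hD'
  have e3 := congrArg (fun σ : SpinorFiber x => σ.2.2) hD'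
  simp only [Prod.fst_add, Prod.snd_add, Prod.fst_sum, Prod.snd_sum, Prod.fst_zero,
    Prod.snd_zero] at e1 e2 e3
  have e20 := congrFun e2 0
  have e21 := congrFun e2 1
  have e22 := congrFun e2 2
  simp only [Pi.add_apply, Finset.sum_apply, Pi.zero_apply, Matrix.cons_val_zero,
    Matrix.cons_val_one, Matrix.cons_val] at e20 e21 e22
  refine ⟨fun z => ?_, ?_, ?_, ?_, ?_⟩
  · have e4 := congrArg (fun w => inner ℝ w z) e3
    have hsum : ∀ L : TangentSpace (𝓡 4) x →L[ℝ] ℝ, ∀ w, ∑ i, L (B i) * inner ℝ (B i) w = L w := by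
      intro L w
      conv_rhs => rw [← B.sum_repr' w]
      simp [mul_comm]
    have hcoord : ∀ (i : Fin 3) w, ∑ j, mvfderiv (𝓡 4) (fun y => (ψ p y).2.1) x (B j) i *
        inner ℝ (B j) w = mvfderiv (𝓡 4) (fun y => (ψ p y).2.1) x w i := fun i w =>
      hsum ((ContinuousLinearMap.proj (R := ℝ) (φ := fun _ : Fin 3 => ℝ) i).comp
        (mvfderiv (𝓡 4) (fun y => (ψ p y).2.1) x)) w
    simp only [inner_add_left, sum_inner, inner_sub_left, real_inner_smul_left, act, h.K_skew,
      h.J_skew, h.I_skew, Finset.sum_sub_distrib, Finset.sum_add_distrib, mul_neg,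
      Finset.sum_neg_distrib, hcoord, hsum, inner_zero_left] at e4 ⊢
    linarith
  · rw [LinearMap.trace_eq_sum_inner _ B]
    simp only [Finset.sum_neg_distrib] at e1
    simp only [ContinuousLinearMap.coe_coe]
    linarith
  · rw [LinearMap.trace_eq_sum_inner _ B]
    simp only [h.K_skew, Finset.sum_neg_distrib] at e20
    simp only [ContinuousLinearMap.coe_coe, ContinuousLinearMap.comp_apply]
    linarith
  · rw [LinearMap.trace_eq_sum_inner _ B]
    simp only [h.J_skew, Finset.sum_neg_distrib] at e21
    simp only [ContinuousLinearMap.coe_coe, ContinuousLinearMap.comp_apply]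
    linarith
  · rw [LinearMap.trace_eq_sum_inner _ B]
    simp only [h.I_skew, Finset.sum_neg_distrib] at e22
    simp only [ContinuousLinearMap.coe_coe, ContinuousLinearMap.comp_apply]
    linarith

theorem isDiracSolution [T2Space M]
    [IsContMDiffRiemannianBundle (𝓡 4) ∞ R4 (fun x : M => TangentSpace (𝓡 4) x)]
    {ψ : Spinor M} (hψ : IsSmoothSpinor ψ) (hD : h.diracX ψ = 0) (c : M) :
    (h.chart c).IsDiracSolution (EuclideanSpace.single 0 1) (EuclideanSpace.single 1 1)
      (spinorReal c ψ) (spinorFlat c ψ 0) (spinorFlat c ψ 1) (spinorFlat c ψ 2)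
      (spinorField c ψ) := by
  have hU := (chartAt R4 c).open_target
  have hD' := fun p x => h.dirac_equations (congrFun (congrFun hD p) x)
  have t0 : ∀ p, ∀ y ∈ (chartAt R4 c).target, ∀ i, fderiv ℝ (spinorReal c ψ) (p, y)
      (EuclideanSpace.single i 1, 0) = (torusDeriv ψ p ((chartAt R4 c).symm y) i).1 :=
    fun p y hy i => by
    rw [← fderiv_left hU hψ.contDiffOn_spinorReal hy]
    exact hψ.fderiv_torus (x := (chartAt R4 c).symm y) p (ContinuousLinearMap.fst ℝ _ _) i
  have t1 : ∀ j p, ∀ y ∈ (chartAt R4 c).target, ∀ i, fderiv ℝ (spinorFlat c ψ j) (p, y)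
      (EuclideanSpace.single i 1, 0) = (torusDeriv ψ p ((chartAt R4 c).symm y) i).2.1 j :=
    fun j p y hy i => by
    rw [← fderiv_left hU (hψ.contDiffOn_spinorFlat j) hy]
    exact hψ.fderiv_torus (x := (chartAt R4 c).symm y) p ((ContinuousLinearMap.proj (R := ℝ) (φ := fun _ : Fin 3 => ℝ) j).comp
      ((ContinuousLinearMap.fst ℝ _ _).comp (ContinuousLinearMap.snd ℝ _ _))) i
  have t2 : ∀ p, ∀ y ∈ (chartAt R4 c).target, ∀ i, fderiv ℝ (spinorField c ψ) (p, y)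
      (EuclideanSpace.single i 1, 0) =
        chartProj c _ (torusDeriv ψ p ((chartAt R4 c).symm y) i).2.2 :=
    fun p y hy i => by
    rw [← fderiv_left hU hψ.contDiffOn_spinorField hy]
    exact hψ.fderiv_torus (x := (chartAt R4 c).symm y) p ((chartProj c _).comp
      ((ContinuousLinearMap.snd ℝ _ _).comp (ContinuousLinearMap.snd ℝ _ _))) i
  have m0 : ∀ p, ∀ y ∈ (chartAt R4 c).target, ∀ z, fderiv ℝ (fun y => spinorReal c ψ (p, y)) y z =
      mvfderiv (𝓡 4) (fun y => (ψ p y).1) ((chartAt R4 c).symm y) (chartLift c _ z) :=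
    fun p y hy z => (mvfderiv_chartLift hy (hψ.diff_one p _) z).symm
  have m1 : ∀ j p, ∀ y ∈ (chartAt R4 c).target, ∀ z,
      fderiv ℝ (fun y => spinorFlat c ψ j (p, y)) y z =
      mvfderiv (𝓡 4) (fun y => (ψ p y).2.1) ((chartAt R4 c).symm y) (chartLift c _ z) j :=
    fun j p y hy z => by
    have k1 := mvfderiv_clm_comp (ContinuousLinearMap.proj (R := ℝ) (φ := fun _ : Fin 3 => ℝ) j)
      (hψ.diff_two p ((chartAt R4 c).symm y)) (chartLift c _ z)
    refine Eq.trans ?_ k1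
    exact (mvfderiv_chartLift hy ((ContinuousLinearMap.proj (R := ℝ) (φ := fun _ : Fin 3 => ℝ)
      j).differentiableAt.mdifferentiableAt.comp _ (hψ.diff_two p _)) z).symm
  have n0 : ∀ p, ∀ y ∈ (chartAt R4 c).target, chartCov (h.chart c).Γ
      (fun y => spinorField c ψ (p, y)) y = chartEnd c (h.nabla fun y => (ψ p y).2.2) y :=
    fun p y hy => (h.chartEnd_nabla hy (hψ.field p _)).symm
  have tr : ∀ p, ∀ y ∈ (chartAt R4 c).target,
      ∀ Q : (x : M) → TangentSpace (𝓡 4) x →L[ℝ] TangentSpace (𝓡 4) x,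
      LinearMap.trace ℝ R4 ((chartEnd c Q y).comp (chartCov (h.chart c).Γ
        (fun y => spinorField c ψ (p, y)) y) : R4 →ₗ[ℝ] R4) = LinearMap.trace ℝ _
      ((Q ((chartAt R4 c).symm y)).comp (h.nabla (fun y => (ψ p y).2.2) ((chartAt R4 c).symm y)) :
        TangentSpace (𝓡 4) ((chartAt R4 c).symm y) →ₗ[ℝ] _) := fun p y hy Q => by
    have k := trace_chartEnd (c := c) (A := fun x => (Q x).comp (h.nabla (fun y => (ψ p y).2.2) x)) hy
    rw [← k, n0 p y hy]
    congr 1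
    ext1 z
    exact congrArg (chartProj c _) (congrArg (Q _) (chartLift_chartEnd _ hy z))
  refine ⟨hψ.contDiffOn_spinorReal, hψ.contDiffOn_spinorFlat 0, hψ.contDiffOn_spinorFlat 1,
    hψ.contDiffOn_spinorFlat 2, hψ.contDiffOn_spinorField, fun p y hy z => ?_, fun p y hy => ?_,
    fun p y hy => ?_, fun p y hy => ?_, fun p y hy => ?_⟩
  · have hx := (chartAt R4 c).map_target hy
    rw [t2 p y hy, t2 p y hy, m0 p y hy, m1 0 p y hy, m1 1 p y hy, m1 2 p y hy,
      ← (hD' p ((chartAt R4 c).symm y)).1 (chartLift c _ z)]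
    have k1 : ∀ w, (h.chart c).g y w z = inner ℝ (chartLift c ((chartAt R4 c).symm y) w)
      (chartLift c _ z) := fun w => rfl
    have k2 : ∀ w, (h.chart c).I y w = chartEnd c h.I y w := fun w => rfl
    have k3 : ∀ w, (h.chart c).J y w = chartEnd c h.J y w := fun w => rfl
    have k4 : ∀ w, (h.chart c).K y w = chartEnd c h.K y w := fun w => rfl
    simp only [k2, k3, k4, map_add, add_apply, k1, chartLift_chartEnd _ hy,
      chartLift_chartProj hx, inner_add_left]
  · rw [t1 1 p y hy, t1 2 p y hy, n0 p y hy, trace_chartEnd hy]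
    exact (hD' p _).2.1
  · rw [t1 2 p y hy, t1 1 p y hy]
    exact (congrArg _ (tr p y hy h.K)).trans (hD' p _).2.2.1
  · rw [t0 p y hy, t1 0 p y hy]
    exact (congrArg _ (tr p y hy h.J)).trans (hD' p _).2.2.2.1
  · rw [t0 p y hy, t1 0 p y hy]
    exact (congrArg _ (tr p y hy h.I)).trans (hD' p _).2.2.2.2

end HyperKahlerStructure

end DiracInChart

/-! ### Global argument: harmonic spinors are constant. -/

section HarmonicSpinors

/-- The level set of `F` through `z₀` is closed by continuity and open by hypothesis. This
globalises the local maximum principles. -/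
theorem eq_of_eventually_eq {X α : Type*} [TopologicalSpace X] [PreconnectedSpace X]
    [TopologicalSpace α] [T1Space α] {F : X → α} (hF : Continuous F) {z₀ : X}
    (hloc : ∀ z, F z = F z₀ → ∀ᶠ w in nhds z, F w = F z₀) (z : X) : F z = F z₀ := by
  have h1 : IsClopen {z | F z = F z₀} :=
    ⟨isClosed_singleton.preimage hF, isOpen_iff_eventually.2 hloc⟩
  have h2 := h1.eq_univ ⟨z₀, rfl⟩
  exact h2.ge (Set.mem_univ z)

/-- Periodicity moves every point into the fundamental domain, whose closure times `M` is compact.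
The quotient torus itself is never needed. -/
theorem exists_forall_le_of_periodic {M : Type*} [TopologicalSpace M] [CompactSpace M] [Nonempty M]
    (b : Module.Basis (Fin 2) ℝ Plane) {F : Plane × M → ℝ} (hF : Continuous F)
    (hper : ∀ i p x, F (p + b i, x) = F (p, x)) : ∃ z₀, ∀ z, F z ≤ F z₀ := by
  have hlat : ∀ w ∈ Submodule.span ℤ (Set.range b), ∀ p x, F (p + w, x) = F (p, x) := by
    intro w hw
    induction hw using Submodule.span_induction with
    | mem w hw =>
      obtain ⟨i, rfl⟩ := hw
      exact hper i
    | zero => simp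
    | add v w _ _ hv hw => exact fun p x => by rw [← add_assoc, hw, hv]
    | smul n w _ hw =>
      induction n using Int.induction_on with
      | zero => simp
      | succ n ih => exact fun p x => by rw [add_smul, one_smul, ← add_assoc, hw, ih]
      | pred n ih =>
        intro p x
        rw [← ih p x, ← hw (p + (-(n : ℤ) - 1) • w) x, sub_smul, one_smul, add_assoc,
          sub_add_cancel]
  have hK := ((ZSpan.fundamentalDomain_isBounded b).isCompact_closure.prod
    (isCompact_univ (X := M)))
  have hne : (closure (ZSpan.fundamentalDomain b) ×ˢ (Set.univ : Set M)).Nonempty := by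
    obtain ⟨x⟩ := ‹Nonempty M›
    exact ⟨(ZSpan.fract b 0, x), subset_closure (ZSpan.fract_mem_fundamentalDomain b 0), trivial⟩
  obtain ⟨z₀, -, hz₀⟩ := hK.exists_isMaxOn hne hF.continuousOn
  refine ⟨z₀, fun z => ?_⟩
  have h1 : F (ZSpan.fract b z.1, z.2) ≤ F z₀ := hz₀
    ⟨subset_closure (ZSpan.fract_mem_fundamentalDomain b z.1), trivial⟩
  have h2 := hlat _ (ZSpan.floor b z.1).2 (ZSpan.fract b z.1) z.2
  rw [ZSpan.fract_apply, sub_add_cancel] at h2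
  exact h2.le.trans h1

theorem Plane.dual_eq_zero {ℓ : Plane →L[ℝ] ℝ} (h0 : ℓ (EuclideanSpace.single 0 1) = 0)
    (h1 : ℓ (EuclideanSpace.single 1 1) = 0) : ℓ = 0 := by
  ext p
  have hp : p = p 0 • EuclideanSpace.single 0 1 + p 1 • EuclideanSpace.single 1 1 := by
    ext j
    fin_cases j <;> simp
  rw [hp]
  simp [h0, h1]

variable {M : Type*} [TopologicalSpace M] [T2Space M] [CompactSpace M] [ConnectedSpace M]
  [ChartedSpace R4 M] [IsManifold (𝓡 4) ∞ M]
  [RiemannianBundle (fun x : M => TangentSpace (𝓡 4) x)]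
  [IsContMDiffRiemannianBundle (𝓡 4) ∞ R4 (fun x : M => TangentSpace (𝓡 4) x)]

theorem finrank_R4 : Module.finrank ℝ R4 = 4 := by simp

namespace HyperKahlerStructure

variable (h : HyperKahlerStructure M) {b : Module.Basis (Fin 2) ℝ Plane} {ψ : Spinor M}

/-- Both components are periodic and harmonic. At each point where the global maximum is attained,
the chart maximum principle makes the component locally constant, and connectedness does the rest.
-/
theorem real_and_first_const (hψ : ψ ∈ h.harmonicSpinors b) :
    (∃ r : ℝ, ∀ p x, (ψ p x).1 = r) ∧ ∃ r : ℝ, ∀ p x, (ψ p x).2.1 1 = r := by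
  obtain ⟨hs, hper, hD⟩ := hψ
  have key : ∀ F : Plane × M → ℝ, Continuous F → (∀ i p x, F (p + b i, x) = F (p, x)) →
      (∀ c : M, ContDiffOn ℝ ∞ (fun q : Plane × R4 => F (q.1, (chartAt R4 c).symm q.2))
        (Set.univ ×ˢ (chartAt R4 c).target)) →
      (∀ (c : M) p, ∀ y ∈ (chartAt R4 c).target, ∀ z, (h.chart c).g y z z *
        (fderiv ℝ (fderiv ℝ (fun q : Plane × R4 => F (q.1, (chartAt R4 c).symm q.2))) (p, y)
            (EuclideanSpace.single 0 1, 0) (EuclideanSpace.single 0 1, 0)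
          + fderiv ℝ (fderiv ℝ (fun q : Plane × R4 => F (q.1, (chartAt R4 c).symm q.2))) (p, y)
            (EuclideanSpace.single 1 1, 0) (EuclideanSpace.single 1 1, 0)) +
        ∑ i, chartHess (h.chart c).Γ (fun y => F (p, (chartAt R4 c).symm y)) y
          ((h.chart c).frame z i y) ((h.chart c).frame z i y) = 0) →
      ∃ r : ℝ, ∀ p x, F (p, x) = r := by
    intro F hF hFp hFs hFh
    obtain ⟨z₀, hz₀⟩ := exists_forall_le_of_periodic b hF hFp
    refine ⟨F z₀, fun p x => eq_of_eventually_eq hF (fun z hz => ?_) (p, x)⟩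
    obtain ⟨p₀, x₀⟩ := z
    have hx₀ := mem_chart_source R4 x₀
    have hleft : (chartAt R4 x₀).symm (chartAt R4 x₀ x₀) = x₀ := (chartAt R4 x₀).left_inv hx₀
    have h1 := (h.chart x₀).eventually_const_of_harmonic finrank_R4
      (fun ℓ => Plane.dual_eq_zero) (hFs x₀) (hFh x₀) (p₀ := p₀)
      ((chartAt R4 x₀).map_source hx₀)
      (fun p y _ => by simpa only [hleft, hz] using hz₀ (p, (chartAt R4 x₀).symm y))
    have h2 : Filter.Tendsto (fun z : Plane × M => (z.1, chartAt R4 x₀ z.2)) (nhds (p₀, x₀))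
        (nhds (p₀, chartAt R4 x₀ x₀)) := by
      have h3 := ((chartAt R4 x₀).continuousAt hx₀)
      exact (continuousAt_fst.prodMk (ContinuousAt.comp (x := (p₀, x₀)) h3 continuousAt_snd))
    have h3 : ∀ᶠ z : Plane × M in nhds (p₀, x₀), z.2 ∈ (chartAt R4 x₀).source :=
      continuousAt_snd.eventually ((chartAt R4 x₀).open_source.mem_nhds hx₀)
    filter_upwards [h2.eventually h1, h3] with z hz1 hz2
    simp only [(chartAt R4 x₀).left_inv hz2, hleft] at hz1
    exact hz1.trans hz
  have hfc := hs.flat.continuous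
  refine ⟨key (fun z => (ψ z.1 z.2).1) hfc.fst (fun i p x => by simp only [hper i p x])
      (fun c => hs.contDiffOn_spinorReal) (fun c p y hy z =>
        ((h.isDiracSolution hs hD c).harmonic finrank_R4 hy z).1),
    key (fun z => (ψ z.1 z.2).2.1 1) ((continuous_apply 1).comp hfc.snd)
      (fun i p x => by simp only [hper i p x])
      (fun c => hs.contDiffOn_spinorFlat 1) (fun c p y hy z =>
        ((h.isDiracSolution hs hD c).harmonic finrank_R4 hy z).2)⟩

/-- The remaining two components come from `γψ`, which is again harmonic: its real component is
`-a₀` and its `∂_u` component is `-a₂`. -/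
theorem flat_const (hψ : ψ ∈ h.harmonicSpinors b) :
    ∃ (f : ℝ) (a : Fin 3 → ℝ), ∀ p x, (ψ p x).1 = f ∧ (ψ p x).2.1 = a := by
  obtain ⟨⟨f, hf⟩, ⟨a₁, h₁⟩⟩ := h.real_and_first_const hψ
  obtain ⟨⟨a₀, h₀⟩, ⟨a₂, h₂⟩⟩ := h.real_and_first_const (h.gamma b ⟨ψ, hψ⟩).2
  have hγ : ∀ p x, (h.gamma b ⟨ψ, hψ⟩).1 p x = h.clifford x (frame x 0) (ψ p x) := fun _ _ => rfl
  simp only [hγ, h.clifford_normal, Matrix.cons_val_one, Matrix.cons_val_zero] at h₀ h₂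
  refine ⟨f, ![-a₀, a₁, -a₂], fun p x => ⟨hf p x, ?_⟩⟩
  ext i
  fin_cases i
  · simp [← h₀ p x]
  · simp [← h₁ p x]
  · simp [← h₂ p x]

theorem contMDiff_slice (hψ : IsSmoothSpinor ψ) (p : Plane) :
    IsSmoothField (fun x => (ψ p x).2.2) := by
  have h1 : ContMDiff (𝓡 4) (𝓘(ℝ, Plane).prod (𝓡 4)) ∞ (fun y : M => (p, y)) :=
    contMDiff_const.prodMk contMDiff_id
  exact hψ.tangent.comp h1

/-- Once the flat components are constant, the scalar Dirac equations reduce to the vanishing of the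
traces of `∇Y, I∇Y, J∇Y, K∇Y` on the slice. These are the hypotheses of the Bochner argument,
applied at the maximum of `|Y|²`. -/
theorem field_parallel (hψ : ψ ∈ h.harmonicSpinors b) (p : Plane) :
    (∀ x, h.nabla (fun x => (ψ p x).2.2) x = 0) ∧
      ∃ r : ℝ, ∀ x, (inner ℝ (ψ p x).2.2 (ψ p x).2.2 : ℝ) = r := by
  obtain ⟨f, a, hfa⟩ := h.flat_const hψ
  obtain ⟨hs, hper, hD⟩ := hψ
  have hY : ∀ c : M, ContDiffOn ℝ ∞ (fun y => spinorField c ψ (p, y)) (chartAt R4 c).target :=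
    fun c => contDiffOn_slice hs.contDiffOn_spinorField p
  have hf0 : ∀ c q, fderiv ℝ (spinorReal c ψ) q = 0 := fun c q => by
    have : spinorReal c ψ = fun _ => f := funext fun q => (hfa _ _).1
    rw [this]; simp
  have ha0 : ∀ c i q, fderiv ℝ (spinorFlat c ψ i) q = 0 := fun c i q => by
    have : spinorFlat c ψ i = fun _ => a i := funext fun q => congrFun (hfa _ _).2 i
    rw [this]; simp
  have S := fun c => h.isDiracSolution hs hD c
  have t1 := fun c y hy => (S c).real p y hy
  have tI := fun c y hy => (S c).second p y hy
  have tJ := fun c y hy => (S c).first p y hy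
  have tK := fun c y hy => (S c).normal p y hy
  simp only [hf0, ha0, zero_apply, zero_add, sub_zero, zero_sub, neg_eq_zero] at t1 tI tJ tK
  have hg : ∀ c : M, ∀ y ∈ (chartAt R4 c).target, (h.chart c).g y (spinorField c ψ (p, y))
      (spinorField c ψ (p, y)) = inner ℝ (ψ p ((chartAt R4 c).symm y)).2.2
        (ψ p ((chartAt R4 c).symm y)).2.2 := fun c y hy => by
    refine (chartMetric_apply c y _ _).trans ?_
    rw [spinorField, chartLift_chartProj ((chartAt R4 c).map_target hy)]
  have hcont : Continuous fun x => (inner ℝ (ψ p x).2.2 (ψ p x).2.2 : ℝ) :=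
    ((contMDiff_slice hs p).inner_bundle (contMDiff_slice hs p)).continuous
  obtain ⟨x₀, -, hx₀⟩ := isCompact_univ.exists_isMaxOn (Set.univ_nonempty (α := M)) hcont.continuousOn
  have hmax : ∀ x, (inner ℝ (ψ p x).2.2 (ψ p x).2.2 : ℝ) ≤ inner ℝ (ψ p x₀).2.2 (ψ p x₀).2.2 :=
    fun x => hx₀ (Set.mem_univ x)
  have hconst : ∀ x, (inner ℝ (ψ p x).2.2 (ψ p x).2.2 : ℝ) = inner ℝ (ψ p x₀).2.2 (ψ p x₀).2.2 := by
    refine eq_of_eventually_eq hcont fun c hc => ?_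
    have hcs := mem_chart_source R4 c
    have hct := (chartAt R4 c).map_source hcs
    have hgc : (h.chart c).g (chartAt R4 c c) (spinorField c ψ (p, chartAt R4 c c))
        (spinorField c ψ (p, chartAt R4 c c)) = inner ℝ (ψ p x₀).2.2 (ψ p x₀).2.2 := by
      rw [hg c _ hct, (chartAt R4 c).left_inv hcs, hc]
    have h1 := (h.chart c).eventually_norm_sq_const finrank_R4 (hY c) (t1 c) (tI c) (tJ c) (tK c)
      hct (fun y hy => by rw [hgc, hg c y hy]; exact hmax _)
    rw [hgc] at h1
    filter_upwards [((chartAt R4 c).continuousAt hcs).eventually h1,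
      (chartAt R4 c).open_source.mem_nhds hcs] with x hx hxs
    rw [hg c _ ((chartAt R4 c).map_source hxs), (chartAt R4 c).left_inv hxs] at hx
    exact hx
  refine ⟨fun c => ?_, _, hconst⟩
  have hcs := mem_chart_source R4 c
  have hct := (chartAt R4 c).map_source hcs
  have h1 := (h.chart c).chartCov_eq_zero_of_norm_sq_const finrank_R4 (hY c) (t1 c) (tI c) (tJ c)
    (tK c) hct (c := inner ℝ (ψ p x₀).2.2 (ψ p x₀).2.2) (by
      filter_upwards [(chartAt R4 c).open_target.mem_nhds hct] with y hy
      rw [hg c y hy, hconst])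
  have h2 := (h.chartEnd_nabla hct (hs.field p _)).trans h1
  ext1 e
  have h3 := chartLift_chartEnd (c := c) (h.nabla fun x => (ψ p x).2.2) hct (chartProj c _ e)
  rw [h2] at h3
  simp only [zero_apply, map_zero] at h3
  rw [(chartAt R4 c).left_inv hcs, chartLift_chartProj hcs] at h3
  exact h3.symm

end HyperKahlerStructure

namespace HyperKahlerK3

variable (h : HyperKahlerK3 M) {b : Module.Basis (Fin 2) ℝ Plane} {ψ : Spinor M}

/-- There are no parallel vector fields on a K3 surface. -/
theorem field_eq_zero (hψ : ψ ∈ h.harmonicSpinors b) (p : Plane) (x : M) : (ψ p x).2.2 = 0 := by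
  obtain ⟨hpar, r, hr⟩ := h.field_parallel hψ p
  -- `∇Y = 0` is in particular symmetric, so `⟨Y, ·⟩` is closed and hence equal to `dF`. At a
  -- maximum of `F` the field vanishes, and its length is constant.
  obtain ⟨F, hF, hFY⟩ := h.closed_exact _ (HyperKahlerStructure.contMDiff_slice hψ.1 p)
    (fun x a b => by rw [hpar]; simp)
  obtain ⟨c, -, hc⟩ := isCompact_univ.exists_isMaxOn (Set.univ_nonempty (α := M))
    hF.continuous.continuousOn
  have hcs := mem_chart_source R4 c
  have hct := (chartAt R4 c).map_source hcs
  have hleft := (chartAt R4 c).left_inv hcs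
  have h1 : IsLocalMax (fun y => F ((chartAt R4 c).symm y)) (chartAt R4 c c) :=
    Filter.Eventually.of_forall fun y => by
      simp only [hleft]
      exact hc (Set.mem_univ _)
  have h2 : ∀ e, mvfderiv (𝓡 4) F ((chartAt R4 c).symm (chartAt R4 c c)) e = 0 := fun e => by
    rw [← chartLift_chartProj ((chartAt R4 c).map_target hct) e,
      mvfderiv_chartLift hct (hF.mdifferentiable (by simp) _), h1.fderiv_eq_zero]
    simp
  rw [hleft] at h2
  have h3 := h2 (ψ p c).2.2
  rw [hFY, hr] at h3
  exact inner_self_eq_zero.1 ((hr x).trans h3)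

theorem eq_constSpinor (hψ : ψ ∈ h.harmonicSpinors b) :
    ∃ (f : ℝ) (a : Fin 3 → ℝ), ψ = constSpinor f a := by
  obtain ⟨f, a, hfa⟩ := h.flat_const hψ
  refine ⟨f, a, ?_⟩
  funext p x
  exact Prod.ext (hfa p x).1 (Prod.ext (hfa p x).2 (h.field_eq_zero hψ p x))

variable (b) in
/-- Harmonic spinors on the product of a torus and a K3 surface are constant. -/
noncomputable def constEquiv : (ℝ × (Fin 3 → ℝ)) ≃ₗ[ℝ] h.harmonicSpinors b :=
  LinearEquiv.ofBijective
    { toFun := fun v => ⟨constSpinor v.1 v.2, constSpinor_mem h.toHyperKahlerStructure b v.1 v.2⟩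
      map_add' := fun v w => by
        ext1
        funext p x
        simp [constSpinor]
      map_smul' := fun r v => by
        ext1
        funext p x
        simp [constSpinor] }
    ⟨fun v w hvw => by
      obtain ⟨x⟩ := (inferInstance : Nonempty M)
      have h1 : ((v.1, v.2, 0) : SpinorFiber x) = (w.1, w.2, 0) :=
        congrFun (congrFun (congrArg Subtype.val hvw) 0) x
      exact Prod.ext (congrArg (fun σ : SpinorFiber x => σ.1) h1)
        (congrArg (fun σ : SpinorFiber x => σ.2.1) h1),
    fun ψ => by
      obtain ⟨f, a, hfa⟩ := h.eq_constSpinor ψ.2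
      exact ⟨(f, a), Subtype.ext hfa.symm⟩⟩

theorem finrank_harmonicSpinors : Module.finrank ℝ (h.harmonicSpinors b) = 4 := by
  rw [← (h.constEquiv b).finrank_eq]
  simp

end HyperKahlerK3

end HarmonicSpinors

/-! ### The `L²` metric on constant spinors. -/

section L2

variable {M : Type*} [TopologicalSpace M] [ChartedSpace R4 M] [IsManifold (𝓡 4) ∞ M]
  [RiemannianBundle (fun x : M => TangentSpace (𝓡 4) x)]

theorem chartGram_apply {c : M} {y : R4} (hy : y ∈ (chartAt R4 c).target) (i j : Fin 4) :
    chartGram c y i j = chartMetric c y (EuclideanSpace.single i 1) (EuclideanSpace.single j 1) := by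
  rw [chartMetric_apply, chartLift_eq_mfderiv hy, chartLift_eq_mfderiv hy]
  rfl

theorem chartGram_det_pos {c : M} {y : R4} (hy : y ∈ (chartAt R4 c).target) :
    0 < (chartGram c y).det := by
  have h1 : LinearIndependent ℝ fun i : Fin 4 =>
      chartLift c ((chartAt R4 c).symm y) (EuclideanSpace.single i 1) := by
    have h2 := (EuclideanSpace.basisFun (Fin 4) ℝ).toBasis.linearIndependent.map'
      (chartLift c ((chartAt R4 c).symm y) : R4 →ₗ[ℝ] TangentSpace (𝓡 4) ((chartAt R4 c).symm y))
      (LinearMap.ker_eq_bot.2 (Function.LeftInverse.injective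
        (g := chartProj c ((chartAt R4 c).symm y))
        fun z => chartProj_chartLift ((chartAt R4 c).map_target hy) z))
    simpa [Function.comp_def] using h2
  have h2 := (Matrix.posDef_gram_of_linearIndependent (𝕜 := ℝ) h1).det_pos
  have h3 : chartGram c y = Matrix.gram ℝ fun i : Fin 4 =>
      chartLift c ((chartAt R4 c).symm y) (EuclideanSpace.single i 1) := by
    ext i j
    rw [chartGram_apply hy]
    rfl
  rwa [h3]

theorem continuousOn_chartGram_det
    [IsContMDiffRiemannianBundle (𝓡 4) ∞ R4 (fun x : M => TangentSpace (𝓡 4) x)] (c : M) :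
    ContinuousOn (fun y => (chartGram c y).det) (chartAt R4 c).target := by
  have h1 : ContinuousOn (fun y => (Matrix.of fun i j : Fin 4 =>
      chartMetric c y (EuclideanSpace.single i 1) (EuclideanSpace.single j 1)).det)
      (chartAt R4 c).target := by
    simp only [Matrix.det_apply, Matrix.of_apply]
    refine continuousOn_finsetSum _ fun σ _ => ContinuousOn.const_smul
      (continuousOn_finsetProd _ fun i _ => ?_) _
    exact ((contDiffOn_chartMetric c).continuousOn.clm_apply continuousOn_const).clm_apply
      continuousOn_const
  refine h1.congr fun y hy => ?_
  congr 1
  ext i j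
  exact chartGram_apply hy i j

variable [MeasurableSpace M] [BorelSpace M]
  [IsContMDiffRiemannianBundle (𝓡 4) ∞ R4 (fun x : M => TangentSpace (𝓡 4) x)]

/-- In a chart the volume has positive density on a nonempty open set. This is what makes the scale
of the `L²` metric nonzero. -/
theorem IsRiemannianVolume.measure_univ_ne_zero [Nonempty M] {vol : Measure M}
    (hvol : IsRiemannianVolume vol) : vol Set.univ ≠ 0 := by
  obtain ⟨c⟩ := ‹Nonempty M›
  intro h0
  have h1 : vol = 0 := Measure.measure_univ_eq_zero.1 h0
  have h2 := congrArg (fun μ : Measure M => μ Set.univ) (hvol c)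
  have hT := (chartAt R4 c).open_target
  have hm : AEMeasurable (fun y => ENNReal.ofReal (Real.sqrt (chartGram c y).det))
      (volume.restrict (chartAt R4 c).target) :=
    ((continuousOn_chartGram_det c).aemeasurable hT.measurableSet).sqrt.ennreal_ofReal
  have hs : AEMeasurable (chartAt R4 c).symm ((volume.restrict (chartAt R4 c).target).withDensity
      fun y => ENNReal.ofReal (Real.sqrt (chartGram c y).det)) :=
    ((chartAt R4 c).continuousOn_symm.aemeasurable hT.measurableSet).mono_ac
      (withDensity_absolutelyContinuous _ _)
  simp only [h1, Measure.restrict_zero, Measure.coe_zero, Pi.zero_apply] at h2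
  rw [Measure.map_apply_of_aemeasurable hs MeasurableSet.univ, Set.preimage_univ,
    withDensity_apply _ MeasurableSet.univ, Measure.restrict_univ] at h2
  have h3 := (lintegral_eq_zero_iff' hm).1 h2.symm
  have h4 := ae_restrict_mem (μ := (volume : Measure R4)) hT.measurableSet
  have h5 : ∀ᵐ y ∂(volume.restrict (chartAt R4 c).target), False := by
    filter_upwards [h3, h4] with y hy hyT
    have := chartGram_det_pos hyT
    simp only [Pi.zero_apply, ENNReal.ofReal_eq_zero] at hy
    exact absurd (Real.sqrt_pos.2 this) (not_lt.2 hy)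
  rw [Filter.eventually_false_iff_eq_bot, ae_eq_bot, Measure.restrict_eq_zero] at h5
  exact (hT.measure_pos volume ⟨_, mem_chart_target R4 c⟩).ne' h5

/-- The integrand is constant, so the `L²` metric is the Euclidean one scaled by `r`, the volume of
the torus times that of `M`. -/
theorem HyperKahlerStructure.exists_l2_constSpinor [CompactSpace M] [Nonempty M]
    (h : HyperKahlerStructure M) {vol : Measure M} [IsFiniteMeasure vol]
    (hvol : IsRiemannianVolume vol) (b : Module.Basis (Fin 2) ℝ Plane) :
    ∃ r : ℝ, 0 < r ∧ ∀ f a f' a', h.l2 b vol ⟨constSpinor f a, constSpinor_mem h b f a⟩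
      ⟨constSpinor f' a', constSpinor_mem h b f' a'⟩ = r * (f * f' + a ⬝ᵥ a') := by
  have hb := ZSpan.fundamentalDomain_isBounded b
  have : IsFiniteMeasure (volume.restrict (ZSpan.fundamentalDomain b)) :=
    isFiniteMeasure_restrict.2 hb.measure_lt_top.ne
  refine ⟨((volume.restrict (ZSpan.fundamentalDomain b)).prod vol).real Set.univ, ?_,
    fun f a f' a' => ?_⟩
  · refine ENNReal.toReal_pos ?_ (measure_ne_top _ _)
    rw [← Set.univ_prod_univ, Measure.prod_prod, Measure.restrict_apply_univ]
    exact mul_ne_zero (ZSpan.measure_fundamentalDomain_ne_zero b) hvol.measure_univ_ne_zero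
  · have h1 : ∀ z : Plane × M, spinorInner ((constSpinor f a : Spinor M) z.1 z.2)
        ((constSpinor f' a' : Spinor M) z.1 z.2) = f * f' + a ⬝ᵥ a' := fun z => by
      simp [spinorInner, constSpinor]
    change ∫ z : Plane × M, spinorInner ((constSpinor f a : Spinor M) z.1 z.2)
        ((constSpinor f' a' : Spinor M) z.1 z.2) ∂_ = _
    simp only [h1]
    rw [integral_const, smul_eq_mul]

end L2

/-! ### The Maslov angle of two planes in an adapted basis. -/

section MaslovPlane

/-- As `a ≠ d`, each of these eigenvalues has a line as its eigenspace and every other eigenspace is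
zero, so the sum over `ℂ` has two terms, each with multiplicity one. -/
theorem traceLog_of_diagonal {V : Type*} [AddCommGroup V] [Module ℂ V] (e : (ℂ × ℂ) ≃ₗ[ℂ] V)
    {T : V →ₗ[ℂ] V} {a d : ℂ} (had : a ≠ d) (hT : ∀ p q, T (e (p, q)) = e (a * p, d * q)) :
    traceLog T = Complex.log a + Complex.log d := by
  have hmem : ∀ c p q, e (p, q) ∈ Module.End.eigenspace T c ↔ a * p = c * p ∧ d * q = c * q := by
    intro c p q
    rw [Module.End.mem_eigenspace_iff, hT, ← map_smul, e.injective.eq_iff]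
    simp
  have ha : Module.End.eigenspace T a = ℂ ∙ e (1, 0) := by
    ext w
    obtain ⟨⟨p, q⟩, rfl⟩ := e.surjective w
    rw [hmem, Submodule.mem_span_singleton]
    constructor
    · rintro ⟨-, h⟩
      have hq : q = 0 := by
        by_contra hq
        exact had (mul_right_cancel₀ hq h).symm
      exact ⟨p, by rw [← map_smul, hq]; simp⟩
    · rintro ⟨r, hr⟩
      rw [← map_smul, e.injective.eq_iff] at hr
      simp only [Prod.smul_mk, smul_eq_mul, mul_zero, Prod.mk.injEq] at hr
      simp [← hr.2]
  have hd : Module.End.eigenspace T d = ℂ ∙ e (0, 1) := by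
    ext w
    obtain ⟨⟨p, q⟩, rfl⟩ := e.surjective w
    rw [hmem, Submodule.mem_span_singleton]
    constructor
    · rintro ⟨h, -⟩
      have hp : p = 0 := by
        by_contra hp
        exact had (mul_right_cancel₀ hp h)
      exact ⟨q, by rw [← map_smul, hp]; simp⟩
    · rintro ⟨r, hr⟩
      rw [← map_smul, e.injective.eq_iff] at hr
      simp only [Prod.smul_mk, smul_eq_mul, mul_zero, Prod.mk.injEq] at hr
      simp [← hr.1]
  have ho : ∀ c, c ≠ a → c ≠ d → Module.End.eigenspace T c = ⊥ := by
    intro c hca hcd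
    rw [eq_bot_iff]
    intro w hw
    obtain ⟨⟨p, q⟩, rfl⟩ := e.surjective w
    rw [hmem] at hw
    have hp : p = 0 := by
      by_contra hp
      exact hca (mul_right_cancel₀ hp hw.1).symm
    have hq : q = 0 := by
      by_contra hq
      exact hcd (mul_right_cancel₀ hq hw.2).symm
    rw [hp, hq, Submodule.mem_bot]
    exact map_zero e
  have hne : ∀ v : ℂ × ℂ, v ≠ 0 → e v ≠ 0 := fun v hv => by simpa using hv
  have hsum := finsum_eq_sum_of_support_subset (s := {a, d})
    (fun c : ℂ => (Module.finrank ℂ (Module.End.eigenspace T c) : ℂ) * Complex.log c) (by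
      intro c hc
      by_contra hcs
      simp only [Finset.coe_insert, Finset.coe_singleton, Set.mem_insert_iff,
        Set.mem_singleton_iff, not_or] at hcs
      refine hc ?_
      change (Module.finrank ℂ (Module.End.eigenspace T c) : ℂ) * Complex.log c = 0
      rw [ho c hcs.1 hcs.2, finrank_bot, Nat.cast_zero, zero_mul])
  rw [traceLog, hsum, Finset.sum_pair had, ha, hd, finrank_span_singleton (hne _ (by simp)),
    finrank_span_singleton (hne _ (by simp))]
  simp

variable {W : Type*} [AddCommGroup W] [Module ℝ W] {g : W →ₗ[ℝ] W →ₗ[ℝ] ℝ} {γ : W →ₗ[ℝ] W}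

/-- A basis `B 0`, `B 1 = γ (B 0)`, `B 2`, `B 3 = γ (B 2)` of orthogonal vectors of the same norm. -/
structure IsAdaptedBasis (g : W →ₗ[ℝ] W →ₗ[ℝ] ℝ) (γ : W →ₗ[ℝ] W) (B : Module.Basis (Fin 4) ℝ W)
    (r : ℝ) : Prop where
  pos : 0 < r
  inner : ∀ i j, g (B i) (B j) = if i = j then r else 0
  γ_zero : γ (B 0) = B 1
  γ_one : γ (B 1) = -B 0
  γ_two : γ (B 2) = B 3
  γ_three : γ (B 3) = -B 2

/-- The planes spanned by `B 0` and a unit vector in the span of `B 2`, `B 3`. -/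
noncomputable def rotatedPlane (B : Module.Basis (Fin 4) ℝ W) (ϑ : ℝ) : Submodule ℝ W :=
  Submodule.span ℝ {B 0, Real.sin ϑ • B 2 + Real.cos ϑ • B 3}

namespace IsAdaptedBasis

variable {B : Module.Basis (Fin 4) ℝ W} {r : ℝ} (H : IsAdaptedBasis g γ B r)

theorem eq_sum (B : Module.Basis (Fin 4) ℝ W) (x : W) :
    ∃ x₀ x₁ x₂ x₃ : ℝ, x = x₀ • B 0 + x₁ • B 1 + x₂ • B 2 + x₃ • B 3 :=
  ⟨B.repr x 0, B.repr x 1, B.repr x 2, B.repr x 3, by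
    conv_lhs => rw [← B.sum_repr x]
    rw [Fin.sum_univ_four]⟩

theorem coeff_eq {K W : Type*} [Field K] [AddCommGroup W] [Module K W]
    (B : Module.Basis (Fin 4) K W) {x₀ x₁ x₂ x₃ y₀ y₁ y₂ y₃ : K}
    (h : x₀ • B 0 + x₁ • B 1 + x₂ • B 2 + x₃ • B 3 =
      y₀ • B 0 + y₁ • B 1 + y₂ • B 2 + y₃ • B 3) : x₀ = y₀ ∧ x₁ = y₁ ∧ x₂ = y₂ ∧ x₃ = y₃ := by
  have h1 := congrArg B.repr h
  have h2 := fun i => congrArg (fun f => f i) h1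
  have e0 := h2 0
  have e1 := h2 1
  have e2 := h2 2
  have e3 := h2 3
  simp at e0 e1 e2 e3
  exact ⟨e0, e1, e2, e3⟩

theorem mem_rotatedPlane (B : Module.Basis (Fin 4) ℝ W) (ϑ x₀ x₁ x₂ x₃ : ℝ) :
    x₀ • B 0 + x₁ • B 1 + x₂ • B 2 + x₃ • B 3 ∈ rotatedPlane B ϑ ↔
      x₁ = 0 ∧ x₂ * Real.cos ϑ = x₃ * Real.sin ϑ := by
  rw [rotatedPlane, Submodule.mem_span_pair]
  constructor
  · rintro ⟨a, d, h⟩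
    have h1 : a • B 0 + (0 : ℝ) • B 1 + (d * Real.sin ϑ) • B 2 + (d * Real.cos ϑ) • B 3 =
        x₀ • B 0 + x₁ • B 1 + x₂ • B 2 + x₃ • B 3 := by
      rw [← h]
      module
    obtain ⟨-, e1, e2, e3⟩ := coeff_eq B h1
    refine ⟨e1.symm, ?_⟩
    rw [← e2, ← e3]
    ring
  · rintro ⟨rfl, h⟩
    refine ⟨x₀, x₂ * Real.sin ϑ + x₃ * Real.cos ϑ, ?_⟩
    have hs := Real.sin_sq_add_cos_sq ϑ
    have e2 : (x₂ * Real.sin ϑ + x₃ * Real.cos ϑ) * Real.sin ϑ = x₂ := by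
      linear_combination x₂ * hs - Real.cos ϑ * h
    have e3 : (x₂ * Real.sin ϑ + x₃ * Real.cos ϑ) * Real.cos ϑ = x₃ := by
      linear_combination x₃ * hs + Real.sin ϑ * h
    rw [smul_add, smul_smul, smul_smul, e2, e3]
    module

include H

/-- The plane is the sum of a real line in each of the complex lines `⟨B 0, B 1⟩` and `⟨B 2, B 3⟩`.
These are orthogonal, and a real line in a complex line is Lagrangian. -/
theorem isLagrangian (ϑ : ℝ) : IsLagrangian g γ (rotatedPlane B ϑ) := by
  intro x
  obtain ⟨x₀, x₁, x₂, x₃, rfl⟩ := eq_sum B x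
  have h1 : γ (x₀ • B 0 + x₁ • B 1 + x₂ • B 2 + x₃ • B 3) =
      x₀ • B 1 - x₁ • B 0 + x₂ • B 3 - x₃ • B 2 := by
    simp only [map_add, map_smul, H.γ_zero, H.γ_one, H.γ_two, H.γ_three]
    module
  have hr := H.pos.ne'
  rw [mem_rotatedPlane, h1]
  constructor
  · rintro ⟨rfl, h⟩ y hy
    rw [rotatedPlane, Submodule.mem_span_pair] at hy
    obtain ⟨a, d, rfl⟩ := hy
    simp [H.inner]
    linear_combination d * r * h
  · intro h
    have k0 := h (B 0) (Submodule.subset_span (by simp))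
    have k1 := h (Real.sin ϑ • B 2 + Real.cos ϑ • B 3) (Submodule.subset_span (by simp))
    simp [H.inner, hr] at k0 k1
    refine ⟨k0, ?_⟩
    have k2 : r * (x₂ * Real.cos ϑ - x₃ * Real.sin ϑ) = 0 := by linear_combination k1
    exact sub_eq_zero.1 ((mul_eq_zero.1 k2).resolve_left hr)

-- Both planes contain `B 0`; `sin ϑ ≠ 0` separates their lines in `⟨B 2, B 3⟩`.
omit H in
theorem finrank_inf {ϑ : ℝ} (hϑ : Real.sin ϑ ≠ 0) :
    Module.finrank ℝ (rotatedPlane B ϑ ⊓ rotatedPlane B 0 : Submodule ℝ W) = 1 := by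
  have h1 : (rotatedPlane B ϑ ⊓ rotatedPlane B 0 : Submodule ℝ W) = ℝ ∙ B 0 := by
    ext x
    obtain ⟨x₀, x₁, x₂, x₃, rfl⟩ := eq_sum B x
    rw [Submodule.mem_inf, mem_rotatedPlane, mem_rotatedPlane, Submodule.mem_span_singleton]
    simp only [Real.cos_zero, Real.sin_zero, mul_one, mul_zero]
    constructor
    · rintro ⟨⟨rfl, h2⟩, -, rfl⟩
      rw [zero_mul, eq_comm, mul_eq_zero] at h2
      rw [h2.resolve_right hϑ]
      exact ⟨x₀, by module⟩
    · rintro ⟨a, h⟩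
      obtain ⟨-, rfl, rfl, rfl⟩ := coeff_eq B (y₀ := x₀) (y₁ := x₁) (y₂ := x₂) (y₃ := x₃)
        (x₀ := a) (x₁ := 0) (x₂ := 0) (x₃ := 0) (by rw [← h]; module)
      simp
  rw [h1, finrank_span_singleton (B.ne_zero 0)]

section Complexification

/-- The complexification of the basis `B`. -/
noncomputable abbrev cBasis (B : Module.Basis (Fin 4) ℝ W) : Module.Basis (Fin 4) ℂ (ℂ ⊗[ℝ] W) :=
  Algebra.TensorProduct.basis ℂ B

omit H in
theorem exists_eq_sum (B : Module.Basis (Fin 4) ℝ W) (z : ℂ ⊗[ℝ] W) : ∃ z₀ z₁ z₂ z₃ : ℂ,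
    z = z₀ • cBasis B 0 + z₁ • cBasis B 1 + z₂ • cBasis B 2 + z₃ • cBasis B 3 :=
  ⟨(cBasis B).repr z 0, (cBasis B).repr z 1, (cBasis B).repr z 2, (cBasis B).repr z 3, by
    conv_lhs => rw [← (cBasis B).sum_repr z]
    rw [Fin.sum_univ_four]⟩

omit H in
theorem cBasis_apply (i : Fin 4) : cBasis B i = (1 : ℂ) ⊗ₜ[ℝ] B i := by simp

theorem baseChange_γ (z₀ z₁ z₂ z₃ : ℂ) : γ.baseChange ℂ
      (z₀ • cBasis B 0 + z₁ • cBasis B 1 + z₂ • cBasis B 2 + z₃ • cBasis B 3) =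
    (-z₁) • cBasis B 0 + z₀ • cBasis B 1 + (-z₃) • cBasis B 2 + z₂ • cBasis B 3 := by
  simp only [map_add, map_smul, cBasis_apply, LinearMap.baseChange_tmul, H.γ_zero, H.γ_one, H.γ_two,
    H.γ_three, TensorProduct.tmul_neg]
  module

theorem hermitianExt_eq (z₀ z₁ z₂ z₃ w₀ w₁ w₂ w₃ : ℂ) : hermitianExt g
      (z₀ • cBasis B 0 + z₁ • cBasis B 1 + z₂ • cBasis B 2 + z₃ • cBasis B 3)
      (w₀ • cBasis B 0 + w₁ • cBasis B 1 + w₂ • cBasis B 2 + w₃ • cBasis B 3) =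
    r * (star z₀ * w₀ + star z₁ * w₁ + star z₂ * w₂ + star z₃ * w₃) := by
  have h1 : ∀ (z : ℂ) i, z • cBasis B i = z ⊗ₜ[ℝ] B i := fun z i => by
    rw [cBasis_apply, TensorProduct.smul_tmul', smul_eq_mul, mul_one]
  simp only [hermitianExt, h1, map_add, LinearMap.rTensor_tmul, LinearMap.add_apply,
    LinearMap.BilinForm.baseChange_tmul, H.inner]
  simp
  ring

theorem mem_gammaEigenspace (c z₀ z₁ z₂ z₃ : ℂ) :
    z₀ • cBasis B 0 + z₁ • cBasis B 1 + z₂ • cBasis B 2 + z₃ • cBasis B 3 ∈ gammaEigenspace γ c ↔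
      -z₁ = c * z₀ ∧ z₀ = c * z₁ ∧ -z₃ = c * z₂ ∧ z₂ = c * z₃ := by
  rw [Module.End.mem_eigenspace_iff, H.baseChange_γ]
  constructor
  · intro h
    refine coeff_eq (cBasis B) (h.trans ?_)
    module
  · rintro ⟨h0, h1, h2, h3⟩
    rw [smul_add, smul_add, smul_add, smul_smul, smul_smul, smul_smul, smul_smul, ← h0, ← h1, ← h2,
      ← h3]

/-- For `c² = -1`, `γ (B 0 - c B 1) = B 1 + c B 0 = c (B 0 - c B 1)`, and likewise for `B 2, B 3`.
-/
theorem mem_gammaEigenspace_of_mul_self {c : ℂ} (hc : c * c = -1) (p q : ℂ) :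
    p • cBasis B 0 + (-c * p) • cBasis B 1 + q • cBasis B 2 + (-c * q) • cBasis B 3 ∈
      gammaEigenspace γ c :=
  (H.mem_gammaEigenspace c _ _ _ _).2 ⟨by ring, by linear_combination p * hc, by ring,
    by linear_combination q * hc⟩

/-- Coordinates on the eigenspaces of the complexification of `γ`. -/
noncomputable def eigenEquiv {c : ℂ} (hc : c * c = -1) : (ℂ × ℂ) ≃ₗ[ℂ] gammaEigenspace γ c :=
  LinearEquiv.ofBijective
    { toFun := fun v => ⟨v.1 • cBasis B 0 + (-c * v.1) • cBasis B 1 + v.2 • cBasis B 2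
          + (-c * v.2) • cBasis B 3, H.mem_gammaEigenspace_of_mul_self hc v.1 v.2⟩
      map_add' := fun v w => by
        ext1
        simp only [Prod.fst_add, Prod.snd_add, Submodule.coe_add]
        module
      map_smul' := fun a v => by
        ext1
        simp only [Prod.smul_fst, Prod.smul_snd, Submodule.coe_smul, smul_eq_mul, RingHom.id_apply]
        module }
    ⟨fun v w h => by
      obtain ⟨e0, -, e2, -⟩ := coeff_eq (cBasis B) (congrArg Subtype.val h)
      exact Prod.ext e0 e2,
    fun x => by
      obtain ⟨x, hx⟩ := x
      obtain ⟨z₀, z₁, z₂, z₃, rfl⟩ := exists_eq_sum B x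
      obtain ⟨h0, h1, h2, h3⟩ := (H.mem_gammaEigenspace _ _ _ _ _).1 hx
      refine ⟨(z₀, z₂), Subtype.ext ?_⟩
      simp only [LinearMap.coe_mk, AddHom.coe_mk, neg_mul, ← h0, ← h2, neg_neg]⟩

theorem eigenEquiv_coe {c : ℂ} (hc : c * c = -1) (p q : ℂ) :
    (H.eigenEquiv hc (p, q) : ℂ ⊗[ℝ] W) = p • cBasis B 0 + (-c * p) • cBasis B 1 + q • cBasis B 2
      + (-c * q) • cBasis B 3 := rfl

omit H in
theorem mem_baseChange_rotatedPlane (ϑ : ℝ) (z : ℂ ⊗[ℝ] W) :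
    z ∈ (rotatedPlane B ϑ).baseChange ℂ ↔ ∃ a d : ℂ, z = a • cBasis B 0 + (0 : ℂ) • cBasis B 1 +
      (d * Complex.sin ϑ) • cBasis B 2 + (d * Complex.cos ϑ) • cBasis B 3 := by
  rw [rotatedPlane, Submodule.baseChange_span, Set.image_pair, Submodule.mem_span_pair]
  refine exists_congr fun a => exists_congr fun d => ?_
  rw [eq_comm]
  refine Eq.congr_right ?_
  have h1 : ∀ (t : ℝ) i, (1 : ℂ) ⊗ₜ[ℝ] (t • B i) = (t : ℂ) • cBasis B i := fun t i => by
    rw [cBasis_apply, TensorProduct.tmul_smul, TensorProduct.smul_tmul', TensorProduct.smul_tmul',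
      Complex.real_smul, smul_eq_mul]
  simp only [TensorProduct.mk_apply, TensorProduct.tmul_add, h1, ← cBasis_apply]
  push_cast
  module

theorem hasMaslovAngle {ϑ : ℝ} (h0 : 0 < ϑ) (h1 : ϑ < Real.pi) :
    HasMaslovAngle g γ (rotatedPlane B ϑ) (rotatedPlane B 0)
      ((Real.pi - 2 * ϑ) / Real.pi) := by
  have hI : Complex.I * Complex.I = -1 := Complex.I_mul_I
  have hI' : -Complex.I * -Complex.I = -1 := by rw [neg_mul_neg, hI]
  set eP := H.eigenEquiv hI with heP
  set eM := H.eigenEquiv hI' with heM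
  have hP : ∀ p q, (eP (p, q) : ℂ ⊗[ℝ] W) = p • cBasis B 0 + (-Complex.I * p) • cBasis B 1
      + q • cBasis B 2 + (-Complex.I * q) • cBasis B 3 := H.eigenEquiv_coe hI
  have hM : ∀ p q, (eM (p, q) : ℂ ⊗[ℝ] W) = p • cBasis B 0 + (Complex.I * p) • cBasis B 1
      + q • cBasis B 2 + (Complex.I * q) • cBasis B 3 := fun p q => by
    rw [heM, H.eigenEquiv_coe hI', neg_neg]
  let D : ℂ → (ℂ × ℂ) →ₗ[ℂ] (ℂ × ℂ) := fun a => LinearMap.prodMap LinearMap.id (a • LinearMap.id)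
  have hD : ∀ a p q, D a (p, q) = (p, a * q) := fun a p q => rfl
  -- The graph condition determines the entries. The coefficient of `B 1` vanishes only if the first
  -- entry is `1`. A vector `q (B 2 - i B 3) + q' (B 2 + i B 3)` is proportional to `sin t B 2 + cos
  -- t B 3` exactly when `q' = -e^{2it} q`.
  let Φ : ℝ → (gammaEigenspace γ Complex.I →ₗ[ℂ] gammaEigenspace γ (-Complex.I)) := fun t =>
    eM.toLinearMap ∘ₗ D (-Complex.exp (2 * t * Complex.I)) ∘ₗ eP.symm.toLinearMap
  have hΦ : ∀ t p q, Φ t (eP (p, q)) = eM (p, -Complex.exp (2 * t * Complex.I) * q) :=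
    fun t p q => by simp [Φ, hD]
  have hgraph : ∀ t, IsGraphMap γ (rotatedPlane B t) (Φ t) := by
    intro t z
    have hE : Complex.exp (2 * t * Complex.I) =
        (Complex.cos t + Complex.sin t * Complex.I) * (Complex.cos t + Complex.sin t * Complex.I) := by
      rw [← Complex.exp_mul_I, ← Complex.exp_add]
      ring_nf
    have hsc := Complex.sin_sq_add_cos_sq t
    have hI2 := Complex.I_sq
    have hsum : ∀ p q, (eP (p, q) : ℂ ⊗[ℝ] W) + (Φ t (eP (p, q)) : ℂ ⊗[ℝ] W) =
        (2 * p) • cBasis B 0 + (0 : ℂ) • cBasis B 1 +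
        ((-2 * Complex.I * (Complex.cos t + Complex.sin t * Complex.I) * q) * Complex.sin t)
          • cBasis B 2 +
        ((-2 * Complex.I * (Complex.cos t + Complex.sin t * Complex.I) * q) * Complex.cos t)
          • cBasis B 3 := by
      intro p q
      rw [hΦ, hP, hM, hE]
      have k2 : q + -((Complex.cos t + Complex.sin t * Complex.I) *
          (Complex.cos t + Complex.sin t * Complex.I)) * q =
          (-2 * Complex.I * (Complex.cos t + Complex.sin t * Complex.I) * q) * Complex.sin t := by
        linear_combination (-q) * hsc + q * (Complex.sin t) ^ 2 * hI2
      have k3 : -Complex.I * q + Complex.I * (-((Complex.cos t + Complex.sin t * Complex.I) *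
          (Complex.cos t + Complex.sin t * Complex.I)) * q) =
          (-2 * Complex.I * (Complex.cos t + Complex.sin t * Complex.I) * q) * Complex.cos t := by
        linear_combination (Complex.I * q) * hsc - Complex.I * q * (Complex.sin t) ^ 2 * hI2
      rw [← k2, ← k3]
      module
    rw [mem_baseChange_rotatedPlane]
    constructor
    · rintro ⟨a, d, rfl⟩
      -- Inverts `hsum`: `a = 2p` and `d = -2i e^{it} q`, hence `q = i e^{-it} d / 2`.
      refine ⟨eP (a / 2, d * Complex.I * (Complex.cos t - Complex.sin t * Complex.I) / 2), ?_⟩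
      rw [hsum]
      have k1 : 2 * (a / 2) = a := by ring
      have k2 : -2 * Complex.I * (Complex.cos t + Complex.sin t * Complex.I) *
          (d * Complex.I * (Complex.cos t - Complex.sin t * Complex.I) / 2) = d := by
        linear_combination d * hsc + (-d * (Complex.cos t ^ 2 - Complex.sin t ^ 2 * Complex.I ^ 2)
          - d * Complex.sin t ^ 2) * hI2
      rw [k1, k2]
    · rintro ⟨x, rfl⟩
      obtain ⟨⟨p, q⟩, rfl⟩ := eP.surjective x
      exact ⟨_, _, hsum p q⟩
  have hΦ0 : ∀ p q, Φ 0 (eP (p, q)) = eM (p, -q) := fun p q => by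
    rw [hΦ]
    simp
  -- `Φ 0` is `diag(1, -1)`. The coordinates on both eigenspaces are orthogonal with the same scale,
  -- so the adjoint is the conjugate transpose, again `diag(1, -1)`.
  let Φadj : gammaEigenspace γ (-Complex.I) →ₗ[ℂ] gammaEigenspace γ Complex.I :=
    eP.toLinearMap ∘ₗ D (-1) ∘ₗ eM.symm.toLinearMap
  have hadj : ∀ p q, Φadj (eM (p, q)) = eP (p, -q) := fun p q => by simp [Φadj, hD]
  refine ⟨Φ ϑ, Φ 0, Φadj, hgraph ϑ, hgraph 0, fun x y => ?_, ?_⟩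
  · obtain ⟨⟨p, q⟩, rfl⟩ := eP.surjective x
    obtain ⟨⟨p', q'⟩, rfl⟩ := eM.surjective y
    rw [hΦ0, hadj, hM, hM, hP, hP, H.hermitianExt_eq, H.hermitianExt_eq]
    simp
  · have hsin : Real.sin ϑ ≠ 0 := (Real.sin_pos_of_pos_of_lt_pi h0 h1).ne'
    have hexp : -Complex.exp (2 * ϑ * Complex.I) =
        Complex.exp (((2 * ϑ - Real.pi : ℝ) : ℂ) * Complex.I) := by
      push_cast
      rw [sub_mul, Complex.exp_sub, Complex.exp_pi_mul_I]
      ring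
    -- The angle is shifted to `2ϑ - π`, which lies in `(-π, π)` precisely because `0 < ϑ < π`, so
    -- this is the principal branch.
    have hlog : Complex.log (-Complex.exp (2 * ϑ * Complex.I)) =
        ((2 * ϑ - Real.pi : ℝ) : ℂ) * Complex.I := by
      rw [hexp, Complex.log_exp]
      · simp; linarith
      · simp; linarith
    have hne : (-1 : ℂ) ≠ -Complex.exp (2 * ϑ * Complex.I) := by
      intro h
      have h2 := hlog
      rw [← h, Complex.log_neg_one] at h2
      have h3 := mul_right_cancel₀ Complex.I_ne_zero h2
      have h4 : Real.pi = 2 * ϑ - Real.pi := by exact_mod_cast h3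
      linarith
    have htr := traceLog_of_diagonal eM (T := -(Φ ϑ ∘ₗ Φadj)) hne (fun p q => by
      simp only [LinearMap.neg_apply, LinearMap.comp_apply, hadj, hΦ]
      rw [← map_neg]
      simp)
    have hpi : (Real.pi : ℂ) ≠ 0 := by exact_mod_cast Real.pi_ne_zero
    -- `1 - (π + (2ϑ - π))/π`: the eigenvalue `-1` from the common line `B 0` cancels the
    -- intersection dimension.
    rw [htr, hlog, Complex.log_neg_one, finrank_inf hsin]
    push_cast
    field_simp
    ring

end Complexification

end IsAdaptedBasis

end MaslovPlane

/-! ### The space of harmonic spinors as an instance of the linear model. -/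

section MaslovAngleK3

variable {M : Type*} [TopologicalSpace M] [T2Space M] [CompactSpace M] [ConnectedSpace M]
  [ChartedSpace R4 M] [IsManifold (𝓡 4) ∞ M]
  [RiemannianBundle (fun x : M => TangentSpace (𝓡 4) x)]
  [IsContMDiffRiemannianBundle (𝓡 4) ∞ R4 (fun x : M => TangentSpace (𝓡 4) x)]
  (h : HyperKahlerK3 M) (b : Module.Basis (Fin 2) ℝ Plane)

namespace HyperKahlerK3

/-- The basis `s`, `c_t s`, `c_u s`, `c_v s` of the space of harmonic spinors. -/
noncomputable def spinorBasis : Module.Basis (Fin 4) ℝ (h.harmonicSpinors b) :=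
  (Pi.basisFun ℝ (Fin 4)).map
    ((Fin.consLinearEquiv ℝ (fun _ : Fin 4 => ℝ)).symm.trans (h.constEquiv b))

theorem spinorBasis_zero : h.spinorBasis b 0 = h.constEquiv b (1, 0) := by
  refine congrArg (h.constEquiv b) (Prod.ext ?_ ?_)
  · simp [Fin.consLinearEquiv]
  · ext i
    fin_cases i <;> simp [Fin.consLinearEquiv, Fin.tail]

theorem spinorBasis_succ (i : Fin 3) :
    h.spinorBasis b i.succ = h.constEquiv b (0, Pi.single i 1) := by
  refine congrArg (h.constEquiv b) (Prod.ext ?_ ?_)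
  · simp [Fin.consLinearEquiv]
  · ext j
    simp [Fin.consLinearEquiv, Fin.tail, Pi.single_apply]

theorem gamma_constEquiv (f : ℝ) (a : Fin 3 → ℝ) :
    h.gamma b (h.constEquiv b (f, a)) = h.constEquiv b (-a 0, ![f, -a 2, a 1]) := by
  refine Subtype.ext (funext fun p => funext fun x => ?_)
  refine (h.clifford_normal x _).trans ?_
  refine Prod.ext rfl (Prod.ext rfl ?_)
  exact map_zero (h.K x)

/-- Clifford multiplication by `∂_t` sends `s` to `c_t s` and `c_u s` to `c_v s`, because `∂_t × ∂_u
= ∂_v`; the common norm is that of `exists_l2_constSpinor`. -/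
theorem isAdaptedBasis [MeasurableSpace M] [BorelSpace M] {vol : Measure M} [IsFiniteMeasure vol]
    (hvol : IsRiemannianVolume vol) :
    ∃ r, IsAdaptedBasis (h.l2 b vol) (h.gamma b) (h.spinorBasis b) r := by
  obtain ⟨r, hr, hl2⟩ := h.exists_l2_constSpinor hvol b
  have h0 := h.spinorBasis_zero b
  have h1 : h.spinorBasis b 1 = _ := h.spinorBasis_succ b 0
  have h2 : h.spinorBasis b 2 = _ := h.spinorBasis_succ b 1
  have h3 : h.spinorBasis b 3 = _ := h.spinorBasis_succ b 2
  have hl : ∀ v w, h.l2 b vol (h.constEquiv b v) (h.constEquiv b w) =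
    r * (v.1 * w.1 + v.2 ⬝ᵥ w.2) := fun v w => hl2 v.1 v.2 w.1 w.2
  refine ⟨r, hr, fun i j => ?_, ?_, ?_, ?_, ?_⟩
  · fin_cases i <;> fin_cases j <;> simp [h0, h1, h2, h3, hl]
  · rw [h0, h1, gamma_constEquiv]
    congr 1
    ext i
    · simp
    · fin_cases i <;> simp
  · rw [h0, h1, gamma_constEquiv, ← map_neg]
    congr 1
    ext i
    · simp
    · fin_cases i <;> simp
  · rw [h2, h3, gamma_constEquiv]
    congr 1
    ext i
    · simp
    · fin_cases i <;> simp
  · rw [h2, h3, gamma_constEquiv, ← map_neg]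
    congr 1
    ext i
    · simp
    · fin_cases i <;> simp

theorem spinorPlane_eq (ϑ : ℝ) :
    spinorPlane h.toHyperKahlerStructure b ![0, Real.sin ϑ, Real.cos ϑ] =
      rotatedPlane (h.spinorBasis b) ϑ := by
  have h2 : h.spinorBasis b 2 = _ := h.spinorBasis_succ b 1
  have h3 : h.spinorBasis b 3 = _ := h.spinorBasis_succ b 2
  rw [spinorPlane, rotatedPlane, h.spinorBasis_zero, h2, h3, ← map_smul, ← map_smul, ← map_add]
  have h4 : cliffordParallel h.toHyperKahlerStructure b ![0, Real.sin ϑ, Real.cos ϑ] =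
      h.constEquiv b (0, ![0, Real.sin ϑ, Real.cos ϑ]) :=
    Subtype.ext (clifford_parallelSpinor h.toHyperKahlerStructure b _)
  rw [h4]
  congr 4
  ext i
  · simp
  · fin_cases i <;> simp

end HyperKahlerK3

end MaslovAngleK3

theorem theorem5p8 {M : Type*} [TopologicalSpace M] [T2Space M] [CompactSpace M]
    [ConnectedSpace M] [ChartedSpace R4 M] [IsManifold (𝓡 4) ∞ M]
    [RiemannianBundle (fun x : M => TangentSpace (𝓡 4) x)]
    [IsContMDiffRiemannianBundle (𝓡 4) ∞ R4 (fun x : M => TangentSpace (𝓡 4) x)]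
    [MeasurableSpace M] [BorelSpace M]
    -- the hyper-Kähler K3 surface, its volume measure, and the lattice of the torus
    (h : HyperKahlerK3 M) (vol : Measure M) [IsFiniteMeasure vol] (hvol : IsRiemannianVolume vol)
    (b : Module.Basis (Fin 2) ℝ Plane)
    -- the gluing angle
    (ϑ : ℝ) (hϑ : 0 < ϑ ∧ ϑ < Real.pi)
    -- the orthonormal frames of the torus, in components with respect to `∂_t, ∂_u, ∂_v`
    (uMinus vMinus uPlus vPlus : Fin 3 → ℝ)
    (huMinus : uMinus = Pi.single 1 1) (hvMinus : vMinus = Pi.single 2 1)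
    (hv : vMinus = Real.cos ϑ • vPlus + Real.sin ϑ • uPlus)
    (hu : uMinus = Real.sin ϑ • vPlus - Real.cos ϑ • uPlus)
    (ρ : ℝ) (hρ : ρ = Real.pi - 2 * ϑ) :
    Module.finrank ℝ (h.harmonicSpinors b) = 4 ∧
    IsLagrangian (h.l2 b vol) (h.gamma b) (spinorPlane h.toHyperKahlerStructure b vPlus) ∧
    IsLagrangian (h.l2 b vol) (h.gamma b) (spinorPlane h.toHyperKahlerStructure b vMinus) ∧
    HasMaslovAngle (h.l2 b vol) (h.gamma b)
      (spinorPlane h.toHyperKahlerStructure b vPlus)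
      (spinorPlane h.toHyperKahlerStructure b vMinus) (ρ / Real.pi) := by
  obtain ⟨r, H⟩ := h.isAdaptedBasis b hvol
  -- Inverting the change of frame gives `v₊ = cos ϑ v₋ + sin ϑ u₋`. So the plus plane is the
  -- rotated plane of angle `ϑ`, and the minus plane is the one of angle `0`.
  have hvp : vPlus = ![0, Real.sin ϑ, Real.cos ϑ] := by
    have h1 : vPlus = Real.cos ϑ • vMinus + Real.sin ϑ • uMinus := by
      have h2 : (1 : ℝ) • vPlus = (Real.sin ϑ ^ 2 + Real.cos ϑ ^ 2) • vPlus := by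
        rw [Real.sin_sq_add_cos_sq]
      rw [one_smul] at h2
      rw [h2, hv, hu]
      module
    rw [h1, huMinus, hvMinus]
    ext i
    fin_cases i <;> simp
  have hvm : vMinus = ![0, Real.sin 0, Real.cos 0] := by
    rw [hvMinus]
    ext i
    fin_cases i <;> simp
  rw [hvp, hvm, hρ, h.spinorPlane_eq, h.spinorPlane_eq]
  exact ⟨h.finrank_harmonicSpinors, H.isLagrangian ϑ, H.isLagrangian 0,
    H.hasMaslovAngle hϑ.1 hϑ.2⟩
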